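/- \textbf{Theorem (Caffarelli--Silvestre for forms).} Let $n\ge 0$, $a\in(-1,1)$ and $2\gamma=1-a$. There is a constant $C=C_{n,a}>0$, depending only on $n$ and $a$, such that the following holds for every $p\ge 0$. Let $\omega$ be a $p$-form on $\mathbb R^n$ in the domain of the Hodge Laplacian $\Delta_x=d_xd_x^*+d_x^*d_x$ on $L^2$ forms (that is, $\omega\in L^2$ and $\Delta_x\omega\in L^2$ in the weak sense). On $\mathbb R^n\times(0,\infty)$, with coordinates $(x,y)$ and the flat metric, let $\alpha$ be a bounded $p$-form of class $C^2$ with $$d(y^a d^*\alpha)+d^*(y^a d\alpha)=0,\qquad \alpha|_{y=0}=\omega,\qquad d^*\alpha|_{y=0}=d_x^*\omega .$$ Here $d^*$ is the formal adjoint of $d$ (zero on functions). The restriction of a form to $y=0$ means the restriction of all its components, those containing $dy$ included: as $y\to0^+$ they converge, in the sense of distributions in $x$, to the components of the given form on $\mathbb R^n$, the latter being regarded as a form in $(x,y)$ without $dy$-components. In particular the $dy$-components of $\alpha$ tend to $0$. Then $$\lim_{y\to0^+}y^a\, i_{\partial_y}d\alpha(\cdot,y)=(-1)^{p+1}\,C\,(\Delta_x)^\gamma\omega\qquad\text{in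 }L^2(\mathbb R^n),$$ where $(i_V\eta)(X_1,\dots,X_p)=\eta(X_1,\dots,X_p,V)$ for a $(p+1)$-form $\eta$. (If instead $V$ is inserted in the first slot of $\eta$, the right-hand side is $-C(\Delta_x)^\gamma\omega$.) The fractional Hodge Laplacian is $$(\Delta_x)^\gamma\omega=\frac1{\Gamma(-\gamma)}\int_0^\infty\bigl(e^{-t\Delta_x}\omega-\omega\bigr)\frac{dt}{t^{1+\gamma}},$$ where the integral converges in $L^2$ and $\beta(t)=e^{-t\Delta_x}\omega$ is the $L^2$ solution of $\partial_t\beta+\Delta_x\beta=0$, $\beta(0)=\omega$. -/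

import Mathlib

open MeasureTheory Filter Topology

noncomputable section

namespace CSForms

/-- Euclidean space of dimension `m`. -/
abbrev Eu (m : ℕ) : Type := EuclideanSpace ℝ (Fin m)

/-- Alternating `p`-covectors on Euclidean `m`-space.  A `p`-form on (a part of) that space is a
function `Eu m → Covec m p`. -/
abbrev Covec (m p : ℕ) : Type := Eu m [⋀^Fin p]→L[ℝ] ℝ

/-- The `k`-th standard basis vector, i.e. the coordinate vector field of the `k`-th coordinate. -/
def basisVec {m : ℕ} (k : Fin m) : Eu m := EuclideanSpace.single k 1

/-- The pointwise scalar product of two `p`-forms, the sum over `i_1 < ... < i_p` of the products of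
the components; written as the sum over all index tuples divided by `p!`. -/
def covecInner {m p : ℕ} (η θ : Covec m p) : ℝ :=
  (p.factorial : ℝ)⁻¹ *
    ∑ v : Fin p → Fin m, η (fun j => basisVec (v j)) * θ (fun j => basisVec (v j))

/-- The codifferential of a `(p+1)`-form for the flat metric (the formal adjoint of the exterior
derivative): minus the sum over `k` of the contraction, in the first slot, of the `k`-th partial
derivative with the `k`-th basis vector. -/
def codiff {m p : ℕ} (α : Eu m → Covec m (p + 1)) : Eu m → Covec m p := fun x =>
  -∑ k : Fin m, (fderiv ℝ α x (basisVec k)).curryLeft (basisVec k)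

/-- The weighted Hodge operator `d (f d* α) + d* (f d α)` on `p`-forms; on functions `d*` is zero. -/
def weightedHodge {m : ℕ} (f : Eu m → ℝ) : (p : ℕ) → (Eu m → Covec m p) → Eu m → Covec m p
  | 0, α => codiff (fun x => f x • extDeriv α x)
  | _ + 1, α => fun x =>
      extDeriv (fun z => f z • codiff α z) x + codiff (fun z => f z • extDeriv α z) x

/-- The Hodge Laplacian `d d* + d* d` on (twice differentiable) `p`-forms. -/
def hodgeLaplacian {m p : ℕ} (α : Eu m → Covec m p) : Eu m → Covec m p :=
  weightedHodge (fun _ => 1) p α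

/-- Smooth compactly supported maps, in particular smooth compactly supported forms. -/
def IsTest {m : ℕ} {F : Type*} [NormedAddCommGroup F] [NormedSpace ℝ F] (φ : Eu m → F) : Prop :=
  ContDiff ℝ (⊤ : ℕ∞) φ ∧ HasCompactSupport φ

/-- Square integrable `p`-forms. -/
abbrev L2Form (n p : ℕ) : Type := Lp (Covec n p) 2 (volume : Measure (Eu n))

/-- `u` is in the domain of the Hodge Laplacian on square integrable `p`-forms, and `v` is its
Hodge Laplacian. -/
def IsHodgeLaplacian {n p : ℕ} (u v : L2Form n p) : Prop :=
  ∀ φ : Eu n → Covec n p, IsTest φ →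
    ∫ x, covecInner (u x) (hodgeLaplacian φ x) = ∫ x, covecInner (v x) (φ x)

/-- The domain of the Hodge Laplacian. -/
def InHodgeDomain {n p : ℕ} (u : L2Form n p) : Prop := ∃ v, IsHodgeLaplacian u v

/-- `δ` is the codifferential of the square integrable form `u` in the weak sense. -/
def IsWeakCodiff {n p : ℕ} (u : L2Form n (p + 1)) (δ : L2Form n p) : Prop :=
  ∀ ψ : Eu n → Covec n p, IsTest ψ →
    ∫ x, covecInner (δ x) (ψ x) = ∫ x, covecInner (u x) (extDeriv ψ x)

/-- `β t`, for `0 ≤ t`, is the solution of the diffusion equation `∂β/∂t + Δ β = 0` with initial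
value `ω`, i.e. the heat semigroup applied to `ω`. -/
def IsHeatFlow {n p : ℕ} (ω : L2Form n p) (β : ℝ → L2Form n p) : Prop :=
  ContinuousOn β (Set.Ici 0) ∧ β 0 = ω ∧
    ∀ t : ℝ, 0 < t → ∃ v, IsHodgeLaplacian (β t) v ∧ HasDerivAt β (-v) t

/-- `σ` is the fractional Hodge Laplacian of `ω` of order `γ ∈ (0,1)`:
`σ = Γ(-γ)⁻¹ ∫_0^∞ (exp(-tΔ) ω - ω) t^(-1-γ) dt`, an integral that converges in `L²`. -/
def IsFracHodgeLaplacian {n p : ℕ} (γ : ℝ) (ω σ : L2Form n p) : Prop :=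
  ∃ β : ℝ → L2Form n p, IsHeatFlow ω β ∧
    IntegrableOn (fun t : ℝ => t ^ (-(1 + γ)) • (β t - ω)) (Set.Ioi 0) ∧
    σ = (Real.Gamma (-γ))⁻¹ • ∫ t in Set.Ioi (0 : ℝ), t ^ (-(1 + γ)) • (β t - ω)

/-- The coordinate `y` on Euclidean `(n+1)`-space: the last one. -/
def yCoord {n : ℕ} (z : Eu (n + 1)) : ℝ := z (Fin.last n)

/-- The open upper half-space. -/
def upperHalf (n : ℕ) : Set (Eu (n + 1)) := {z | 0 < yCoord z}

/-- The point with coordinates `(x, y)`. -/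
def pt {n : ℕ} (x : Eu n) (y : ℝ) : Eu (n + 1) :=
  WithLp.toLp 2 (Fin.snoc (α := fun _ => ℝ) (fun i => x i) y)

/-- The projection `(x, y) ↦ x`. -/
def proj (n : ℕ) : Eu (n + 1) →L[ℝ] Eu n :=
  LinearMap.toContinuousLinearMap
    { toFun := fun z => WithLp.toLp 2 (fun i : Fin n => z i.castSucc)
      map_add' := fun _ _ => rfl
      map_smul' := fun _ _ => rfl }

/-- A covector in the variable `x` regarded as a covector in the variables `(x, y)` without
`dy`-components. -/
def pull {n p : ℕ} (η : Covec n p) : Covec (n + 1) p := η.compContinuousLinearMap (proj n)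

/-- The restriction of the form `A` (given on the upper half-space) to the boundary `y = 0` is the
form `u`: all components of `A` (those with `dy` included) converge, as `y → 0+`, to the
components of `u`, in the sense of distributions in `x`. -/
def HasBoundaryValue {n p : ℕ} (A : Eu (n + 1) → Covec (n + 1) p) (u : Eu n → Covec n p) : Prop :=
  ∀ ψ : Eu n → Covec (n + 1) p, IsTest ψ →
    Tendsto (fun y : ℝ => ∫ x, covecInner (A (pt x y)) (ψ x)) (𝓝[>] 0)
      (𝓝 (∫ x, covecInner (pull (u x)) (ψ x)))

/-- The restriction of `d* α` to the boundary is the codifferential of `ω` (no condition for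
functions, where both codifferentials are zero). -/
def CodiffHasBoundaryValue {n : ℕ} :
    (p : ℕ) → (Eu (n + 1) → Covec (n + 1) p) → L2Form n p → Prop
  | 0, _, _ => True
  | _ + 1, α, ω => ∃ δ, IsWeakCodiff ω δ ∧ HasBoundaryValue (codiff α) δ

/-- The interior product `(i_V η)(X_1, ..., X_p) = η(X_1, ..., X_p, V)`, with `V` in the last slot;
see `interiorLast_apply`. -/
def interiorLast {m p : ℕ} (V : Eu m) (η : Covec m (p + 1)) : Covec m p :=
  (-1 : ℝ) ^ p • η.curryLeft V

theorem interiorLast_apply {m p : ℕ} (V : Eu m) (η : Covec m (p + 1)) (X : Fin p → Eu m) :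
    interiorLast V η X = η (Fin.snoc (α := fun _ => Eu m) X V) := by
  have h := η.toAlternatingMap.map_perm (Fin.cons (α := fun _ => Eu m) V X) (finRotate (p + 1))
  rw [Fin.snoc_eq_cons_rotate]
  have e : (fun i => (Fin.cons V X : Fin (p + 1) → Eu m) (finRotate (p + 1) i)) =
      (Fin.cons V X : Fin (p + 1) → Eu m) ∘ finRotate (p + 1) := rfl
  rw [e]
  change _ = η.toAlternatingMap _
  rw [h, sign_finRotate]
  simp [interiorLast, Matrix.vecCons, Units.smul_def]

/-- `α` is a bounded solution of the extension problem with boundary datum `ω`: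
a bounded form on the open upper half-space with `d (y^a d* α) + d* (y^a d α) = 0` there, whose
restriction to the boundary is `ω` and whose codifferential restricts to that of `ω`. -/
structure IsBoundedExtension {n p : ℕ} (a : ℝ) (ω : L2Form n p)
    (α : Eu (n + 1) → Covec (n + 1) p) : Prop where
  regular : ContDiffOn ℝ 2 α (upperHalf n)
  bounded : ∃ M : ℝ, ∀ z ∈ upperHalf n, ‖α z‖ ≤ M
  equation : ∀ z ∈ upperHalf n, weightedHodge (fun w => yCoord w ^ a) p α z = 0
  boundary : HasBoundaryValue α ω
  boundary_codiff : CodiffHasBoundaryValue p α ω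

end CSForms

end

/-!
Split a bounded solution `α` of the extension problem into its tangential components and the
components containing `dy`.  The flat Weitzenböck formula (`weightedHodge_succ_apply`) turns the
equation into a system for these components.  Everything is mollified in `x`: pairing a component
with translates of a test function `ψ` gives functions of `(x, y)` whose horizontal derivatives are
obtained by replacing `ψ` by its derivatives (`XDiff`), so that bounds on all horizontal derivatives
come for free from the boundedness of `α`.  The tool for uniqueness is a maximum principle on the
half-space for the operator `∂²/∂y² + (b / y) ∂/∂y + Δ` (`XDiff.eq_zero_of_solution`).

*The `dy`-components vanish.*  Let `u` be a mollified `dy`-component, and `δ` the corresponding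
component of the horizontal codifferential of the tangential part.  The horizontal divergence of the
`dy`-components vanishes by uniqueness (`dv_normal_eq_zero`), and `u`, `δ` then solve a closed system
(`NormalSystem`) for which `z = y ^ a (δ - u')` is harmonic.  The two boundary conditions say that
`u → 0` and `u' → 0`.  For `a = 0` the function `u` is itself harmonic.  For `a > 0` the function `z`
vanishes on the boundary and grows like `y ^ a`, hence is zero.  For `a < 0` it is only known that
`z` is bounded and of size `y ^ a`; Bernstein's gradient bound (`abs_gradient_le_of_harmonic`) gives
decay of its horizontal derivatives, for which `u` has an explicit representation by `z`.  The
condition `u' → 0` then makes a fractional integral of `z` vanish on the boundary, and fractional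
integration is injective (`eq_zero_of_overdetermined`).  In all cases `z = 0`, so `u` is harmonic and
zero (`NormalSystem.eq_zero`).

*The tangential components.*  They now solve the scalar equation with `b = a`.  A solution with the
same boundary values is obtained by subordination to the heat semigroup,
`U(y) = ω + c y ^ (2γ) ∫ exp(-y² / 4t) (exp(-tΔ) ω - ω) t ^ (-1 - γ) dt` (`sol`), where `c` normalizes
the mass of the kernel.  The heat semigroup is given by Gaussian averages of translates (`heat`), so
that it acts componentwise and commutes with mollification; integration by parts in `t`
(`IsIncrement.subInt_heat`) yields the equation for `U`, and uniqueness yields `α = U`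
(`cm_eq_pairL_sol`).

*The limit.*  As the `dy`-components vanish, contracting `dα` with `∂/∂y` gives `±U'(y)`
(`curryLeft_extDeriv_ae`), and dominated convergence in `L²` shows that `y ^ a U'(y)` tends to
`2 γ c ∫ (exp(-tΔ) ω - ω) t ^ (-1 - γ) dt = -C Δ ^ γ ω`, with `C = -2 γ Γ(-γ) c = 2 Γ(1 - γ) c`
(`tendsto_normal_derivative`).
-/


noncomputable section

namespace CSForms

/-! ### Exterior derivative and codifferential in components -/

section Weitzenboeck

section Evaluation

variable {E F V : Type*} [NormedAddCommGroup E] [NormedSpace ℝ E] [NormedAddCommGroup F]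
  [NormedSpace ℝ F] [NormedAddCommGroup V] [NormedSpace ℝ V] {p : ℕ} {z : V}

theorem contDiffAt_apply_const {k : WithTop ℕ∞} {β : V → E [⋀^Fin p]→L[ℝ] F}
    (h : ContDiffAt ℝ k β z) (v : Fin p → E) : ContDiffAt ℝ k (fun x => β x v) z :=
  (ContinuousAlternatingMap.apply ℝ E F v).contDiff.contDiffAt.comp z h

theorem contDiffAt_curryLeft {k : WithTop ℕ∞} {β : V → E [⋀^Fin (p + 1)]→L[ℝ] F}
    (h : ContDiffAt ℝ k β z) (e : E) : ContDiffAt ℝ k (fun x => (β x).curryLeft e) z := by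
  let T : (E [⋀^Fin (p + 1)]→L[ℝ] F) →L[ℝ] E [⋀^Fin p]→L[ℝ] F :=
    (ContinuousLinearMap.apply ℝ (E [⋀^Fin p]→L[ℝ] F) e).comp
      (ContinuousAlternatingMap.curryLeftLI (𝕜 := ℝ) (E := E) (F := F)
        (n := p)).toContinuousLinearMap
  exact T.contDiff.contDiffAt.comp z h

end Evaluation

theorem fderiv_covec_apply {m p : ℕ} {α : Eu m → Covec m p} {z : Eu m}
    (h : DifferentiableAt ℝ α z) (u : Eu m) (v : Fin p → Eu m) :
    fderiv ℝ α z u v = fderiv ℝ (fun x => α x v) z u :=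
  (fderiv_continuousAlternatingMap_apply_const_apply h v u).symm

theorem removeNth_succ_cons {α : Type*} {p : ℕ} (e : α) (v : Fin (p + 1) → α) (i : Fin (p + 1)) :
    i.succ.removeNth (Fin.cons (α := fun _ => α) e v) =
      Fin.cons (α := fun _ => α) e (i.removeNth v) := by
  ext j
  refine Fin.cases ?_ (fun j => ?_) j <;> simp [Fin.removeNth]

/-- The second directional derivative of a function: first in direction `w`, then in
direction `u`. -/
def secondDeriv {m : ℕ} (g : Eu m → ℝ) (u w : Eu m) (z : Eu m) : ℝ :=
  fderiv ℝ (fun x => fderiv ℝ g x w) z u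

variable {m p : ℕ} {α : Eu m → Covec m p} {f g : Eu m → ℝ} {z : Eu m}

theorem contDiffAt_covec_apply {k : WithTop ℕ∞} (hα : ContDiffAt ℝ k α z) (v : Fin p → Eu m) :
    ContDiffAt ℝ k (fun x => α x v) z :=
  contDiffAt_apply_const hα v

theorem differentiableAt_fderiv_apply (hg : ContDiffAt ℝ 2 g z) (w : Eu m) :
    DifferentiableAt ℝ (fun x => fderiv ℝ g x w) z :=
  ((hg.fderiv_right (m := 1) (by norm_num)).differentiableAt (by norm_num)).clm_apply
    (differentiableAt_const w)

theorem secondDeriv_comm (hg : ContDiffAt ℝ 2 g z) (u w : Eu m) :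
    secondDeriv g u w z = secondDeriv g w u z := by
  have hd := (hg.fderiv_right (m := 1) (by norm_num)).differentiableAt (by norm_num)
  have h : ∀ u w : Eu m, secondDeriv g u w z = fderiv ℝ (fderiv ℝ g) z u w := fun u w => by
    rw [secondDeriv, fderiv_clm_apply hd (differentiableAt_const w)]
    simp
  rw [h, h]
  exact hg.isSymmSndFDerivAt (by simp) u w

theorem codiff_apply {α : Eu m → Covec m (p + 1)} (h : DifferentiableAt ℝ α z)
    (v : Fin p → Eu m) :
    codiff α z v = -∑ k : Fin m,
      fderiv ℝ (fun x => α x (Fin.cons (α := fun _ => Eu m) (basisVec k) v)) z (basisVec k) := by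
  simp only [codiff, ContinuousAlternatingMap.neg_apply, ContinuousAlternatingMap.sum_apply,
    ← fderiv_covec_apply h]
  rfl

theorem extDeriv_apply_cons (h : DifferentiableAt ℝ α z) (e : Eu m) (v : Fin p → Eu m) :
    extDeriv α z (Fin.cons (α := fun _ => Eu m) e v) = fderiv ℝ (fun x => α x v) z e -
      ∑ i : Fin p, (-1 : ℝ) ^ (i : ℕ) *
        fderiv ℝ (fun x => α x (i.succ.removeNth (Fin.cons (α := fun _ => Eu m) e v))) z
          (v i) := by
  rw [extDeriv_apply h, Fin.sum_univ_succ]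
  simp [pow_succ, sub_eq_add_neg, zsmul_eq_mul]

theorem eventually_differentiableAt (hα : ContDiffAt ℝ 2 α z) :
    ∀ᶠ x in 𝓝 z, DifferentiableAt ℝ α x :=
  (hα.eventually (by simp)).mono fun _ h => h.differentiableAt (by norm_num)

theorem differentiableAt_extDeriv (hα : ContDiffAt ℝ 2 α z) :
    DifferentiableAt ℝ (extDeriv α) z := by
  have h : DifferentiableAt ℝ (fderiv ℝ α) z :=
    (hα.fderiv_right (m := 1) (by norm_num)).differentiableAt (by norm_num)
  exact (ContinuousAlternatingMap.alternatizeUncurryFinCLM ℝ (Eu m) ℝ).differentiableAt.comp z h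

theorem contDiffAt_codiff {α : Eu m → Covec m (p + 1)} (hα : ContDiffAt ℝ 2 α z) :
    ContDiffAt ℝ 1 (codiff α) z := by
  have h : ∀ k : Fin m, ContDiffAt ℝ 1 (fun x => fderiv ℝ α x (basisVec k)) z := fun k =>
    (hα.fderiv_right (m := 1) (by norm_num)).clm_apply contDiffAt_const
  exact (ContDiffAt.sum fun k _ => contDiffAt_curryLeft (h k) _).neg

theorem differentiableAt_codiff {α : Eu m → Covec m (p + 1)} (hα : ContDiffAt ℝ 2 α z) :
    DifferentiableAt ℝ (codiff α) z :=
  (contDiffAt_codiff hα).differentiableAt (by norm_num)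

/-- The operator `d* (f d α)`: a weighted rough Laplacian, mixed second derivatives, and the first
order term from the derivative of the weight. -/
theorem codiff_smul_extDeriv_apply (hα : ContDiffAt ℝ 2 α z) (hf : DifferentiableAt ℝ f z)
    (v : Fin p → Eu m) :
    codiff (fun x => f x • extDeriv α x) z v =
      -(f z * ∑ k : Fin m, secondDeriv (fun x => α x v) (basisVec k) (basisVec k) z)
      + f z * ∑ k : Fin m, ∑ i : Fin p, (-1 : ℝ) ^ (i : ℕ) *
        secondDeriv
          (fun x => α x (i.succ.removeNth (Fin.cons (α := fun _ => Eu m) (basisVec k) v)))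
          (basisVec k) (v i) z
      - ∑ k : Fin m, fderiv ℝ f z (basisVec k) *
          extDeriv α z (Fin.cons (α := fun _ => Eu m) (basisVec k) v) := by
  rw [codiff_apply (hf.fun_smul (differentiableAt_extDeriv hα))]
  have key : ∀ k : Fin m, fderiv ℝ (fun x => (f x • extDeriv α x)
      (Fin.cons (α := fun _ => Eu m) (basisVec k) v)) z (basisVec k) =
      f z * (secondDeriv (fun x => α x v) (basisVec k) (basisVec k) z -
        ∑ i : Fin p, (-1 : ℝ) ^ (i : ℕ) * secondDeriv
          (fun x => α x (i.succ.removeNth (Fin.cons (α := fun _ => Eu m) (basisVec k) v)))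
          (basisVec k) (v i) z) +
      fderiv ℝ f z (basisVec k) *
          extDeriv α z (Fin.cons (α := fun _ => Eu m) (basisVec k) v) := by
    intro k
    set V := Fin.cons (α := fun _ => Eu m) (basisVec k) v
    have h1 : (fun x => extDeriv α x V) =ᶠ[𝓝 z] fun x => fderiv ℝ (fun x => α x v) x (basisVec k) -
        ∑ i : Fin p, (-1 : ℝ) ^ (i : ℕ) *
        fderiv ℝ (fun x => α x (i.succ.removeNth V)) x (v i) :=
      (eventually_differentiableAt hα).mono fun x hx => extDeriv_apply_cons hx _ _
    have h2 : HasFDerivAt (fun x => extDeriv α x V)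
        (fderiv ℝ (fun x => fderiv ℝ (fun x => α x v) x (basisVec k)) z -
        ∑ i : Fin p, (-1 : ℝ) ^ (i : ℕ) •
        fderiv ℝ (fun x => fderiv ℝ (fun x => α x (i.succ.removeNth V)) x (v i)) z) z := by
      refine HasFDerivAt.congr_of_eventuallyEq ?_ h1
      refine (differentiableAt_fderiv_apply (contDiffAt_covec_apply hα _) _).hasFDerivAt.sub ?_
      refine HasFDerivAt.fun_sum fun i _ => ?_
      exact (differentiableAt_fderiv_apply
        (contDiffAt_covec_apply hα _) _).hasFDerivAt.const_mul _
    have h3 := (hf.hasFDerivAt.mul h2).fderiv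
    have h4 : (fun x => (f x • extDeriv α x) V) = f * fun x => extDeriv α x V := by
      ext x; simp
    rw [h4, h3]
    simp only [add_apply, smul_apply, sub_apply, sum_apply, smul_eq_mul, secondDeriv]
    ring
  rw [Finset.sum_congr rfl fun k _ => key k, Finset.sum_add_distrib, ← Finset.mul_sum,
    Finset.sum_sub_distrib]
  ring

/-- The operator `d (f d* α)`, with the same mixed second derivatives as `d* (f d α)` up to sign. -/
theorem extDeriv_smul_codiff_apply {α : Eu m → Covec m (p + 1)}
    (hα : ContDiffAt ℝ 2 α z) (hf : DifferentiableAt ℝ f z) (v : Fin (p + 1) → Eu m) :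
    extDeriv (fun x => f x • codiff α x) z v =
      -(f z * ∑ i : Fin (p + 1), ∑ k : Fin m, (-1 : ℝ) ^ (i : ℕ) *
        secondDeriv
          (fun x => α x (i.succ.removeNth (Fin.cons (α := fun _ => Eu m) (basisVec k) v)))
          (v i) (basisVec k) z)
      + ∑ i : Fin (p + 1), (-1 : ℝ) ^ (i : ℕ) * (fderiv ℝ f z (v i) *
          codiff α z (i.removeNth v)) := by
  rw [extDeriv_apply (hf.fun_smul (differentiableAt_codiff hα)), Finset.mul_sum,
    ← Finset.sum_neg_distrib, ← Finset.sum_add_distrib]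
  refine Finset.sum_congr rfl fun i _ => ?_
  have h1 : (fun x => codiff α x (i.removeNth v)) =ᶠ[𝓝 z] fun x => -∑ k : Fin m,
      fderiv ℝ (fun x => α x (i.succ.removeNth
        (Fin.cons (α := fun _ => Eu m) (basisVec k) v))) x (basisVec k) :=
    (eventually_differentiableAt hα).mono fun x hx => by
      simp only [codiff_apply hx, removeNth_succ_cons]
  have h2 : HasFDerivAt (fun x => codiff α x (i.removeNth v))
      (-∑ k : Fin m, fderiv ℝ (fun x => fderiv ℝ (fun x => α x (i.succ.removeNth
        (Fin.cons (α := fun _ => Eu m) (basisVec k) v))) x (basisVec k)) z) z := by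
    refine HasFDerivAt.congr_of_eventuallyEq ?_ h1
    exact (HasFDerivAt.fun_sum fun k _ => (differentiableAt_fderiv_apply
        (contDiffAt_covec_apply hα _) _).hasFDerivAt).neg
  have h3 := (hf.hasFDerivAt.mul h2).fderiv
  have h4 : (fun x => (f x • codiff α x) (i.removeNth v)) =
      f * fun x => codiff α x (i.removeNth v) := by
    ext x; simp
  rw [h4, h3]
  simp only [add_apply, smul_apply, neg_apply, sum_apply, smul_eq_mul, secondDeriv, zsmul_eq_mul]
  rw [← Finset.mul_sum]
  push_cast
  ring

/-- The flat Weitzenböck formula, with weight: the mixed second derivatives of `d d*` and `d* d`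
cancel because they are symmetric. -/
theorem weightedHodge_succ_apply {α : Eu m → Covec m (p + 1)}
    (hα : ContDiffAt ℝ 2 α z) (hf : DifferentiableAt ℝ f z) (v : Fin (p + 1) → Eu m) :
    weightedHodge f (p + 1) α z v =
      -(f z * ∑ k : Fin m, secondDeriv (fun x => α x v) (basisVec k) (basisVec k) z)
      + ∑ i : Fin (p + 1), (-1 : ℝ) ^ (i : ℕ) * (fderiv ℝ f z (v i) *
          codiff α z (i.removeNth v))
      - ∑ k : Fin m, fderiv ℝ f z (basisVec k) *
          extDeriv α z (Fin.cons (α := fun _ => Eu m) (basisVec k) v) := by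
  rw [weightedHodge, ContinuousAlternatingMap.add_apply, extDeriv_smul_codiff_apply hα hf,
    codiff_smul_extDeriv_apply hα hf, Finset.sum_comm]
  have : ∀ (k : Fin m) (i : Fin (p + 1)), secondDeriv
          (fun x => α x (i.succ.removeNth (Fin.cons (α := fun _ => Eu m) (basisVec k) v)))
          (v i) (basisVec k) z = secondDeriv
          (fun x => α x (i.succ.removeNth (Fin.cons (α := fun _ => Eu m) (basisVec k) v)))
          (basisVec k) (v i) z :=
    fun k i => secondDeriv_comm (contDiffAt_covec_apply hα _) _ _
  simp only [this]
  ring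

theorem weightedHodge_zero_apply {α : Eu m → Covec m 0}
    (hα : ContDiffAt ℝ 2 α z) (hf : DifferentiableAt ℝ f z) (v : Fin 0 → Eu m) :
    weightedHodge f 0 α z v =
      -(f z * ∑ k : Fin m, secondDeriv (fun x => α x v) (basisVec k) (basisVec k) z)
      - ∑ k : Fin m, fderiv ℝ f z (basisVec k) *
          extDeriv α z (Fin.cons (α := fun _ => Eu m) (basisVec k) v) := by
  rw [weightedHodge, codiff_smul_extDeriv_apply hα hf]
  simp

/-- The flat Hodge Laplacian acts componentwise. -/
theorem hodgeLaplacian_apply (hα : ContDiffAt ℝ 2 α z) (v : Fin p → Eu m) :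
    hodgeLaplacian α z v =
      -∑ k : Fin m, secondDeriv (fun x => α x v) (basisVec k) (basisVec k) z := by
  have hf : DifferentiableAt ℝ (fun _ : Eu m => (1 : ℝ)) z := by fun_prop
  cases p with
  | zero => rw [hodgeLaplacian, weightedHodge_zero_apply hα hf]; simp
  | succ p => rw [hodgeLaplacian, weightedHodge_succ_apply hα hf]; simp

end Weitzenboeck

/-! ### The extension equation in components -/

section Components

variable {n p : ℕ} {a : ℝ} {z : Eu (n + 1)}

theorem hasFDerivAt_yCoord_rpow (hz : 0 < yCoord z) :
    HasFDerivAt (fun w : Eu (n + 1) => yCoord w ^ a)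
      ((a * yCoord z ^ (a - 1)) • (EuclideanSpace.proj (Fin.last n) : Eu (n + 1) →L[ℝ] ℝ)) z := by
  have h : HasFDerivAt (fun w : Eu (n + 1) => yCoord w)
      (EuclideanSpace.proj (Fin.last n) : Eu (n + 1) →L[ℝ] ℝ) z :=
    (EuclideanSpace.proj (Fin.last n) : Eu (n + 1) →L[ℝ] ℝ).hasFDerivAt
  exact h.rpow_const (Or.inl hz.ne')

theorem sum_fderiv_yCoord_rpow_mul (hz : 0 < yCoord z) (g : Fin (n + 1) → ℝ) :
    ∑ k, fderiv ℝ (fun w : Eu (n + 1) => yCoord w ^ a) z (basisVec k) * g k =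
      a * yCoord z ^ (a - 1) * g (Fin.last n) := by
  rw [(hasFDerivAt_yCoord_rpow hz).fderiv, Finset.sum_eq_single (Fin.last n)]
  · simp [basisVec]
  · intro k _ hk
    simp [basisVec, hk.symm]
  · simp

/-- The extension equation on tangential arguments. -/
theorem tangential_equation {α : Eu (n + 1) → Covec (n + 1) p} (hz : 0 < yCoord z)
    (hα : ContDiffAt ℝ 2 α z) (h0 : weightedHodge (fun w => yCoord w ^ a) p α z = 0)
    (v : Fin p → Eu (n + 1)) (hv : ∀ i, v i (Fin.last n) = 0) :
    ∑ k, secondDeriv (fun x => α x v) (basisVec k) (basisVec k) z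
      + a / yCoord z * extDeriv α z
        (Fin.cons (α := fun _ => Eu (n + 1)) (basisVec (Fin.last n)) v) = 0 := by
  have hf := hasFDerivAt_yCoord_rpow (a := a) hz
  have hy : yCoord z ^ (a - 1) = yCoord z ^ a / yCoord z := by
    rw [Real.rpow_sub_one hz.ne']
  have hpos : yCoord z ^ a ≠ 0 := (Real.rpow_pos_of_pos hz a).ne'
  have key : -(yCoord z ^ a * ∑ k, secondDeriv (fun x => α x v) (basisVec k) (basisVec k) z)
      - a * yCoord z ^ (a - 1) * extDeriv α z
        (Fin.cons (α := fun _ => Eu (n + 1)) (basisVec (Fin.last n)) v) = 0 := by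
    have h1 := congrArg (fun η : Covec (n + 1) p => η v) h0
    rw [ContinuousAlternatingMap.coe_zero, Pi.zero_apply] at h1
    cases p with
    | zero =>
      rw [weightedHodge_zero_apply hα hf.differentiableAt, sum_fderiv_yCoord_rpow_mul hz] at h1
      exact h1
    | succ p =>
      rw [weightedHodge_succ_apply hα hf.differentiableAt, sum_fderiv_yCoord_rpow_mul hz,
        Finset.sum_eq_zero (s := Finset.univ (α := Fin (p + 1))), add_zero] at h1
      · exact h1
      · intro i _
        rw [hf.fderiv]
        simp [hv i]
  rw [hy] at key
  have : yCoord z ^ a * (∑ k, secondDeriv (fun x => α x v) (basisVec k) (basisVec k) z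
      + a / yCoord z * extDeriv α z
        (Fin.cons (α := fun _ => Eu (n + 1)) (basisVec (Fin.last n)) v)) = 0 := by
    linear_combination -key
  exact (mul_eq_zero.1 this).resolve_left hpos

/-- The extension equation with the normal vector in the first slot and tangential arguments
in the others. -/
theorem normal_equation {α : Eu (n + 1) → Covec (n + 1) (p + 1)} (hz : 0 < yCoord z)
    (hα : ContDiffAt ℝ 2 α z) (h0 : weightedHodge (fun w => yCoord w ^ a) (p + 1) α z = 0)
    (v : Fin p → Eu (n + 1)) (hv : ∀ i, v i (Fin.last n) = 0) :
    ∑ k, secondDeriv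
        (fun x => α x (Fin.cons (α := fun _ => Eu (n + 1)) (basisVec (Fin.last n)) v))
        (basisVec k) (basisVec k) z
      = a / yCoord z * codiff α z v := by
  have hf := hasFDerivAt_yCoord_rpow (a := a) hz
  have hy : yCoord z ^ (a - 1) = yCoord z ^ a / yCoord z := by
    rw [Real.rpow_sub_one hz.ne']
  have hpos : yCoord z ^ a ≠ 0 := (Real.rpow_pos_of_pos hz a).ne'
  have h1 := congrArg (fun η : Covec (n + 1) (p + 1) => η
    (Fin.cons (α := fun _ => Eu (n + 1)) (basisVec (Fin.last n)) v)) h0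
  rw [ContinuousAlternatingMap.coe_zero, Pi.zero_apply] at h1
  rw [weightedHodge_succ_apply hα hf.differentiableAt, sum_fderiv_yCoord_rpow_mul hz,
    (extDeriv α z).map_eq_zero_of_eq (i := 0) (j := 1) _ rfl (by simp),
    mul_zero, sub_zero, Fin.sum_univ_succ (n := p), Finset.sum_eq_zero (s := Finset.univ (α := Fin p)), add_zero,
    hf.fderiv] at h1
  · simp only [Fin.val_zero, pow_zero, one_mul, Fin.cons_zero, smul_apply,
      Fin.removeNth_zero, Fin.tail_cons, smul_eq_mul] at h1
    have h2 : (EuclideanSpace.proj (Fin.last n) : Eu (n + 1) →L[ℝ] ℝ)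
        (basisVec (Fin.last n)) = 1 := by simp [basisVec]
    rw [h2, hy] at h1
    refine mul_left_cancel₀ hpos ?_
    linear_combination -h1
  · intro i _
    rw [hf.fderiv]
    simp [hv i]

end Components

/-! ### The scalar product of covectors -/

section Inner

variable {m p : ℕ}

/-- The component of a covector with index tuple `w`. -/
abbrev comp (η : Covec m p) (w : Fin p → Fin m) : ℝ := η fun j => basisVec (w j)

theorem covec_ext {η θ : Covec m p} (h : ∀ w : Fin p → Fin m, comp η w = comp θ w) : η = θ := by
  have hb : ∀ k, (EuclideanSpace.basisFun (Fin m) ℝ).toBasis k = basisVec k := fun k => by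
    simp [basisVec]
  have := Module.Basis.ext_multilinear (fun _ : Fin p => (EuclideanSpace.basisFun (Fin m) ℝ).toBasis)
    (f := η.toMultilinearMap) (g := θ.toMultilinearMap) fun w => by
      simp only [hb]; exact h w
  ext v
  exact congrArg (fun f => f v) this

theorem covecInner_eq (η θ : Covec m p) :
    covecInner η θ = (p.factorial : ℝ)⁻¹ * ∑ w : Fin p → Fin m, comp η w * comp θ w := rfl

theorem norm_basisVec (k : Fin m) : ‖(basisVec k : Eu m)‖ = 1 := by simp [basisVec]

theorem abs_comp_le (η : Covec m p) (w : Fin p → Fin m) : |comp η w| ≤ ‖η‖ := by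
  have := η.le_opNorm fun j => basisVec (w j)
  simpa [norm_basisVec] using this

/-- The scalar product of covectors as a continuous bilinear map. -/
def covecInnerL (m p : ℕ) : Covec m p →L[ℝ] Covec m p →L[ℝ] ℝ :=
  LinearMap.mkContinuous₂ (LinearMap.mk₂ ℝ covecInner
    (fun η η' θ => by simp [covecInner, add_mul, Finset.sum_add_distrib, mul_add])
    (fun c η θ => by simp [covecInner, Finset.mul_sum]; congr; ext; ring)
    (fun η η' θ => by simp [covecInner, Finset.sum_add_distrib, mul_add])
    (fun c η θ => by simp [covecInner, Finset.mul_sum]; congr; ext; ring))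
    ((p.factorial : ℝ)⁻¹ * (Fintype.card (Fin p → Fin m) : ℝ)) fun η θ => by
      change ‖covecInner η θ‖ ≤ _
      rw [covecInner_eq, norm_mul, Real.norm_eq_abs, Real.norm_eq_abs, mul_assoc, mul_assoc,
        abs_of_nonneg (by positivity : (0 : ℝ) ≤ (p.factorial : ℝ)⁻¹)]
      gcongr
      refine (Finset.abs_sum_le_sum_abs _ _).trans ?_
      have : ∀ w ∈ (Finset.univ : Finset (Fin p → Fin m)),
          |comp η w * comp θ w| ≤ ‖η‖ * ‖θ‖ := fun w _ => by
        rw [abs_mul]; exact mul_le_mul (abs_comp_le _ _) (abs_comp_le _ _) (abs_nonneg _)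
          (norm_nonneg _)
      refine (Finset.sum_le_card_nsmul _ _ _ this).trans ?_
      simp

theorem covecInnerL_apply (η θ : Covec m p) : covecInnerL m p η θ = covecInner η θ := rfl

theorem covecInner_smul_right (c : ℝ) (η θ : Covec m p) :
    covecInner η (c • θ) = c * covecInner η θ := by
  simp [← covecInnerL_apply]

theorem eq_zero_of_covecInner_self {η : Covec m p} (h : covecInner η η = 0) : η = 0 := by
  rw [covecInner_eq, mul_eq_zero, Finset.sum_eq_zero_iff_of_nonneg fun w _ => mul_self_nonneg _] at h
  refine covec_ext fun w => ?_
  have h1 : (p.factorial : ℝ)⁻¹ ≠ 0 := by positivity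
  exact mul_self_eq_zero.1 ((h.resolve_left h1) w (Finset.mem_univ w))

instance finiteDimensional_covec : FiniteDimensional ℝ (Covec m p) := by
  let T : Covec m p →ₗ[ℝ] ((Fin p → Fin m) → ℝ) :=
    { toFun := fun η w => comp η w
      map_add' := fun _ _ => rfl
      map_smul' := fun _ _ => rfl }
  exact FiniteDimensional.of_injective T fun η θ h => covec_ext fun w => congrFun h w

/-- Every component functional is represented by a covector, as the scalar product is
nondegenerate. -/
theorem exists_dualCovec (w : Fin p → Fin m) :
    ∃ θ : Covec m p, ∀ η : Covec m p, covecInner η θ = comp η w := by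
  let B : Covec m p →ₗ[ℝ] Module.Dual ℝ (Covec m p) :=
    { toFun := fun θ => ((covecInnerL m p).flip θ).toLinearMap
      map_add' := fun _ _ => by ext; simp
      map_smul' := fun _ _ => by ext; simp }
  have hinj : Function.Injective B := by
    rw [← LinearMap.ker_eq_bot, LinearMap.ker_eq_bot']
    intro θ h
    exact eq_zero_of_covecInner_self (LinearMap.congr_fun h θ)
  have hsurj : Function.Surjective B :=
    (LinearMap.injective_iff_surjective_of_finrank_eq_finrank
      (Subspace.dual_finrank_eq (K := ℝ) (V := Covec m p)).symm).1 hinj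
  obtain ⟨θ, hθ⟩ := hsurj (ContinuousAlternatingMap.apply ℝ (Eu m) ℝ
    fun j => basisVec (w j)).toLinearMap
  exact ⟨θ, fun η => LinearMap.congr_fun hθ η⟩

/-- A covector whose scalar product with any covector is the component with index `w`. -/
def dualCovec (w : Fin p → Fin m) : Covec m p := (exists_dualCovec w).choose

theorem covecInner_dualCovec (w : Fin p → Fin m) (η : Covec m p) :
    covecInner η (dualCovec w) = comp η w := (exists_dualCovec w).choose_spec η

/-- Exterior multiplication is adjoint to contraction. -/
theorem covecInner_alternatizeUncurryFin (η : Covec m (p + 1)) (L : Eu m →L[ℝ] Covec m p) :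
    covecInner η (ContinuousAlternatingMap.alternatizeUncurryFin L) =
      ∑ k, covecInner (η.curryLeft (basisVec k)) (L (basisVec k)) := by
  have key : ∀ i : Fin (p + 1), ∑ v : Fin (p + 1) → Fin m, comp η v *
      ((-1 : ℝ) ^ (i : ℕ) * L (basisVec (v i)) (i.removeNth fun j => basisVec (v j))) =
      ∑ k, ∑ w : Fin p → Fin m, comp (η.curryLeft (basisVec k)) w * comp (L (basisVec k)) w := by
    intro i
    rw [← Fintype.sum_prod_type' (f := fun k w =>
      comp (η.curryLeft (basisVec k)) w * comp (L (basisVec k)) w),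
      ← (Fin.insertNthEquiv (fun _ => Fin m) i).sum_comp]
    refine Finset.sum_congr rfl fun kw _ => ?_
    obtain ⟨k, w⟩ := kw
    have h1 : (fun j => (basisVec ((Fin.insertNthEquiv (fun _ => Fin m) i) (k, w) j) : Eu m)) =
        i.insertNth (basisVec k) fun j => basisVec (w j) := by
      rw [Fin.eq_insertNth_iff]
      constructor
      · simp
      · ext j : 1; simp [Fin.removeNth]
    simp only [comp]
    rw [h1, η.map_insertNth, Fin.removeNth_insertNth]
    have h2 : ((-1 : ℝ) ^ (i : ℕ)) * (-1 : ℝ) ^ (i : ℕ) = 1 := by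
      rw [← mul_pow]; simp
    have h3 : (Fin.insertNthEquiv (fun _ => Fin m) i) (k, w) i = k := by simp
    rw [h3, zsmul_eq_mul, ContinuousAlternatingMap.curryLeft_apply_apply]
    push_cast
    linear_combination (η (Matrix.vecCons (basisVec k) fun j => basisVec (w j)) *
      L (basisVec k) fun j => basisVec (w j)) * h2
  have h : ∑ v : Fin (p + 1) → Fin m, comp η v *
      comp (ContinuousAlternatingMap.alternatizeUncurryFin L) v = ((p + 1 : ℕ) : ℝ) *
      ∑ k, ∑ w : Fin p → Fin m, comp (η.curryLeft (basisVec k)) w * comp (L (basisVec k)) w := by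
    simp only [comp, ContinuousAlternatingMap.alternatizeUncurryFin_apply, Finset.mul_sum,
      zsmul_eq_mul]
    rw [Finset.sum_comm]
    push_cast
    rw [Finset.sum_congr rfl fun i _ => key i]
    simp [Finset.mul_sum]
  rw [covecInner_eq, h]
  simp only [covecInner_eq, ← Finset.mul_sum, Nat.factorial_succ]
  have : ((p + 1 : ℕ) : ℝ) ≠ 0 := by positivity
  push_cast at this ⊢
  field_simp

/-- The weak codifferential is tested on forms `ψ θ` with `θ` a constant covector representing a
component. -/
theorem covecInner_extDeriv_smul_dualCovec {ψ : Eu m → ℝ} {x : Eu m}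
    (hψ : DifferentiableAt ℝ ψ x) (η : Covec m (p + 1)) (w : Fin p → Fin m) :
    covecInner η (extDeriv (fun z => ψ z • (dualCovec w : Covec m p)) x) =
      ∑ k, fderiv ℝ ψ x (basisVec k) * comp η (Fin.cons k w) := by
  rw [extDeriv, covecInner_alternatizeUncurryFin]
  refine Finset.sum_congr rfl fun k _ => ?_
  rw [fderiv_smul_const hψ, ContinuousLinearMap.smulRight_apply, covecInner_smul_right,
    covecInner_dualCovec]
  refine congrArg _ (congrArg η (funext fun j => ?_))
  refine Fin.cases ?_ (fun j => ?_) j <;> simp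

end Inner

/-! ### Maximum principle for the weighted Laplacian on a strip -/

/-- At a local maximum the second derivative is nonpositive. -/
theorem second_deriv_nonpos_of_isLocalMax {f f' : ℝ → ℝ} {x c : ℝ} (hmax : IsLocalMax f x)
    (hf : ∀ᶠ y in 𝓝 x, HasDerivAt f (f' y) y) (hf' : HasDerivAt f' c x) : c ≤ 0 := by
  by_contra! hc
  have h0 : f' x = 0 := hmax.hasDerivAt_eq_zero hf.self_of_nhds
  have h1 : ∀ᶠ y in 𝓝[>] x, 0 < f' y := by
    have h2 : Tendsto (slope f' x) (𝓝[>] x) (𝓝 c) :=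
      (hasDerivAt_iff_tendsto_slope.1 hf').mono_left
        (nhdsWithin_mono _ fun y hy => ne_of_gt hy)
    filter_upwards [h2.eventually (lt_mem_nhds hc), self_mem_nhdsWithin] with y hy hxy
    rw [slope_def_field, h0, sub_zero] at hy
    have hxy' : 0 < y - x := sub_pos.2 hxy
    exact (div_pos_iff_of_pos_right hxy').1 hy
  obtain ⟨δ, hδ, hδ'⟩ := Metric.eventually_nhds_iff.1 (hf.and hmax)
  obtain ⟨r, hr, hr'⟩ := (mem_nhdsGT_iff_exists_Ioo_subset.1 h1)
  have hr0 : x < r := hr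
  set y := x + min (δ / 2) ((r - x) / 2) with hy
  have hm : 0 < min (δ / 2) ((r - x) / 2) := lt_min (by linarith) (by linarith)
  have hm1 : min (δ / 2) ((r - x) / 2) ≤ δ / 2 := min_le_left _ _
  have hm2 : min (δ / 2) ((r - x) / 2) ≤ (r - x) / 2 := min_le_right _ _
  have hxy : x < y := by linarith
  have hd : ∀ z ∈ Set.Icc x y, dist z x < δ := fun z hz => by
    rw [Real.dist_eq, abs_of_nonneg (by linarith [hz.1])]; linarith [hz.2]
  obtain ⟨z, hz, hz'⟩ := exists_hasDerivAt_eq_slope f f' hxy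
    (fun z hz => (hδ' (hd z hz)).1.continuousAt.continuousWithinAt)
    (fun z hz => (hδ' (hd z (Set.Ioo_subset_Icc_self hz))).1)
  have hpos : 0 < f' z := hr' ⟨hz.1, by linarith [hz.2]⟩
  have hle : f y ≤ f x := (hδ' (hd y ⟨hxy.le, le_rfl⟩)).2
  rw [hz'] at hpos
  have : 0 < f y - f x := (div_pos_iff_of_pos_right (by linarith)).1 hpos
  linarith

theorem norm_add_smul_basisVec_sq {n : ℕ} (x : Eu n) (s : ℝ) (k : Fin n) :
    ‖x + s • (basisVec k : Eu n)‖ ^ 2 = ‖x‖ ^ 2 + 2 * s * x k + s ^ 2 := by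
  rw [norm_add_sq_real, norm_smul, norm_basisVec, inner_smul_right]
  simp [basisVec, EuclideanSpace.inner_single_right]
  ring

theorem hasDerivAt_line {n : ℕ} {f : Eu n → ℝ} {c : ℝ} {x e : Eu n} {s : ℝ}
    (h : HasDerivAt (fun r : ℝ => f (x + s • e + r • e)) c 0) :
    HasDerivAt (fun r : ℝ => f (x + r • e)) c s := by
  have h1 : HasDerivAt (fun r : ℝ => f (x + s • e + (r - s) • e)) c s :=
    HasDerivAt.comp_sub_const s s (by rwa [sub_self])
  refine h1.congr_of_eventuallyEq (Eventually.of_forall fun r => ?_)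
  simp only [add_assoc, ← add_smul]; congr 3; ring

/-- A subsolution of the weighted Laplace equation on a strip, bounded above, that is nonpositive
at the top and locally uniformly at the bottom, is nonpositive.  The barrier
`‖x‖² + K (Y² - y²)` handles the unbounded directions. -/
theorem nonpos_of_subsolution_strip {n : ℕ} {b Y M : ℝ} (hb : -1 < b)
    {F F1 F2 : Eu n → ℝ → ℝ} {G H : Fin n → Eu n → ℝ → ℝ}
    (hF1 : ∀ x, ∀ y ∈ Set.Ioo 0 Y, HasDerivAt (F x) (F1 x y) y)
    (hF2 : ∀ x, ∀ y ∈ Set.Ioo 0 Y, HasDerivAt (F1 x) (F2 x y) y)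
    (hG : ∀ k x, ∀ y ∈ Set.Ioo 0 Y,
      HasDerivAt (fun s : ℝ => F (x + s • basisVec k) y) (G k x y) 0)
    (hH : ∀ k x, ∀ y ∈ Set.Ioo 0 Y,
      HasDerivAt (fun s : ℝ => G k (x + s • basisVec k) y) (H k x y) 0)
    (hpde : ∀ x, ∀ y ∈ Set.Ioo 0 Y, 0 ≤ F2 x y + b / y * F1 x y + ∑ k, H k x y)
    (hcont : ContinuousOn (fun q : Eu n × ℝ => F q.1 q.2) (Set.univ ×ˢ Set.Ioc 0 Y))
    (hM : ∀ x, ∀ y ∈ Set.Ioc 0 Y, F x y ≤ M) (htop : ∀ x, F x Y ≤ 0)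
    (hbot : ∀ R ε : ℝ, 0 < ε → ∃ η > 0, ∀ x : Eu n, ‖x‖ ≤ R → ∀ y, 0 < y → y < η → F x y ≤ ε)
    (x0 : Eu n) {y0 : ℝ} (hy0 : y0 ∈ Set.Ioc 0 Y) : F x0 y0 ≤ 0 := by
  by_contra! hpos
  set K : ℝ := (n + 1) / (1 + b) with hK
  have hb' : 0 < 1 + b := by linarith
  have hK0 : 0 < K := by positivity
  set B : Eu n → ℝ → ℝ := fun x y => ‖x‖ ^ 2 + K * (Y ^ 2 - y ^ 2) with hB
  have hB0 : ∀ x, ∀ y ∈ Set.Ioc 0 Y, ‖x‖ ^ 2 ≤ B x y := fun x y hy => by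
    have : 0 ≤ K * (Y ^ 2 - y ^ 2) := mul_nonneg hK0.le (by nlinarith [hy.1, hy.2])
    simp only [hB]; linarith
  have hB1 : 0 ≤ B x0 y0 := (sq_nonneg _).trans (hB0 x0 y0 hy0)
  set ε : ℝ := F x0 y0 / (2 * (B x0 y0 + 1)) with hε
  have hε0 : 0 < ε := by positivity
  set W : Eu n → ℝ → ℝ := fun x y => F x y - ε * B x y with hW
  set m : ℝ := W x0 y0 with hm
  have hm0 : 0 < m := by
    have : ε * (2 * (B x0 y0 + 1)) = F x0 y0 := by rw [hε]; field_simp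
    simp only [hm, hW]; nlinarith
  -- beyond radius `R` the barrier dominates
  obtain ⟨R, hR0, hR⟩ : ∃ R : ℝ, ‖x0‖ < R ∧ M ≤ ε * R ^ 2 := by
    refine ⟨max (‖x0‖ + 1) (|M| / ε + 1), by simp, ?_⟩
    set R := max (‖x0‖ + 1) (|M| / ε + 1)
    have h1 : |M| / ε + 1 ≤ R := le_max_right _ _
    have h2 : 0 ≤ |M| / ε := by positivity
    have h3 : |M| / ε ≤ R ^ 2 := by nlinarith
    calc M ≤ |M| := le_abs_self M
      _ = ε * (|M| / ε) := by field_simp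
      _ ≤ ε * R ^ 2 := by gcongr
  have hWout : ∀ x y, y ∈ Set.Ioc 0 Y → ‖x‖ = R → W x y ≤ 0 := fun x y hy hx => by
    have h1 := hB0 x y hy
    have h2 := hM x y hy
    rw [hx] at h1
    simp only [hW]
    nlinarith
  obtain ⟨η, hη, hη'⟩ := hbot R (m / 2) (by linarith)
  set y1 : ℝ := min η y0 / 2 with hy1
  have hy1pos : 0 < y1 := by have := lt_min hη hy0.1; rw [hy1]; linarith
  have hy1η : y1 < η := by have := min_le_left η y0; rw [hy1] at *; linarith
  have hy1y0 : y1 < y0 := by have := min_le_right η y0; rw [hy1] at *; linarith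
  set S : Set (Eu n × ℝ) := Metric.closedBall 0 R ×ˢ Set.Icc y1 Y with hS
  have hScomp : IsCompact S := (isCompact_closedBall _ _).prod isCompact_Icc
  have hSmem : (x0, y0) ∈ S := ⟨by simpa using hR0.le, hy1y0.le, hy0.2⟩
  have hWcont : ContinuousOn (fun q : Eu n × ℝ => W q.1 q.2) S := by
    refine ContinuousOn.sub (hcont.mono ?_) (Continuous.continuousOn ?_)
    · rintro ⟨x, y⟩ ⟨_, hy⟩
      exact ⟨trivial, lt_of_lt_of_le hy1pos hy.1, hy.2⟩
    · simp only [hB]; fun_prop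
  obtain ⟨⟨x, y⟩, hq, hmax⟩ := hScomp.exists_isMaxOn ⟨_, hSmem⟩ hWcont
  have hWm : m ≤ W x y := hmax hSmem
  have hy0' : 0 < y := lt_of_lt_of_le hy1pos hq.2.1
  have hyIoc : y ∈ Set.Ioc 0 Y := ⟨hy0', hq.2.2⟩
  have hxR : ‖x‖ < R := by
    refine lt_of_le_of_ne (by simpa using hq.1) fun h => ?_
    linarith [hWout x y hyIoc h]
  have hyY : y < Y := by
    refine lt_of_le_of_ne hq.2.2 fun h => ?_
    have h1 := hB0 x y hyIoc
    have h2 := htop x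
    have h3 : 0 ≤ ε * B x y := mul_nonneg hε0.le ((sq_nonneg _).trans h1)
    rw [← h] at h2
    simp only [hW] at hWm; linarith
  have hyy1 : y1 < y := by
    refine lt_of_le_of_ne hq.2.1 fun h => ?_
    have h1 := hB0 x y hyIoc
    have h2 := hη' x hxR.le y hy0' (h ▸ hy1η)
    have h3 : 0 ≤ ε * B x y := mul_nonneg hε0.le ((sq_nonneg _).trans h1)
    simp only [hW] at hWm; linarith
  have hyIoo : y ∈ Set.Ioo 0 Y := ⟨hy0', hyY⟩
  have hnear : ∀ᶠ s in 𝓝 y, s ∈ Set.Ioo 0 Y := Ioo_mem_nhds hy0' hyY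
  -- derivatives of `W` in the direction `y`
  have hWy : ∀ s ∈ Set.Ioo 0 Y, HasDerivAt (W x) (F1 x s + 2 * ε * K * s) s := fun s hs => by
    have h1 : HasDerivAt (fun y : ℝ => ‖x‖ ^ 2 + K * (Y ^ 2 - y ^ 2)) (-(2 * K * s)) s := by
      refine ((((hasDerivAt_pow 2 s).const_sub (Y ^ 2)).const_mul K).const_add
        (‖x‖ ^ 2)).congr_deriv ?_
      push_cast; ring
    refine ((hF1 x s hs).sub (h1.const_mul ε)).congr_deriv ?_
    ring
  have hmaxy : IsLocalMax (W x) y := by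
    filter_upwards [Ioo_mem_nhds hyy1 hyY] with s hs
    exact hmax (a := (x, s)) ⟨hq.1, hs.1.le, hs.2.le⟩
  have hWy0 : F1 x y + 2 * ε * K * y = 0 := hmaxy.hasDerivAt_eq_zero (hWy y hyIoo)
  have hWyy : F2 x y + 2 * ε * K ≤ 0 := by
    refine second_deriv_nonpos_of_isLocalMax hmaxy (hnear.mono fun s hs => hWy s hs) ?_
    exact ((hF2 x y hyIoo).add ((hasDerivAt_id y).const_mul (2 * ε * K))).congr_deriv (by ring)
  have hWk : ∀ k, H k x y - 2 * ε ≤ 0 := fun k => by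
    set f : ℝ → ℝ := fun s => W (x + s • basisVec k) y with hf
    have hloc : IsLocalMax f 0 := by
      have hc : Continuous fun s : ℝ => ‖x + s • (basisVec k : Eu n)‖ := by fun_prop
      have : ∀ᶠ s in 𝓝 (0 : ℝ), ‖x + s • (basisVec k : Eu n)‖ < R :=
        hc.continuousAt.eventually_lt continuousAt_const (by simpa using hxR)
      filter_upwards [this] with s hs
      have := hmax (a := (x + s • basisVec k, y)) ⟨by simpa using hs.le, hq.2⟩
      simpa [hf] using this
    have hd : ∀ s, HasDerivAt f (G k (x + s • basisVec k) y - ε * (2 * x k + 2 * s)) s := by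
      intro s
      have h1 : HasDerivAt (fun s : ℝ => F (x + s • basisVec k) y)
          (G k (x + s • basisVec k) y) s :=
        hasDerivAt_line (f := fun x => F x y) (hG k (x + s • basisVec k) y hyIoo)
      have h2 : HasDerivAt (fun s : ℝ => B (x + s • basisVec k) y) (2 * x k + 2 * s) s := by
        simp only [hB, norm_add_smul_basisVec_sq]
        have : HasDerivAt (fun s : ℝ => ‖x‖ ^ 2 + 2 * s * x k + s ^ 2) (2 * x k + 2 * s) s := by
          refine (((((hasDerivAt_id s).const_mul 2).mul_const (x k)).const_add (‖x‖ ^ 2)).add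
            (hasDerivAt_pow 2 s)).congr_deriv ?_
          push_cast; ring
        exact this.add_const _
      exact h1.sub (h2.const_mul ε)
    have hdd : HasDerivAt (fun s => G k (x + s • basisVec k) y - ε * (2 * x k + 2 * s))
        (H k x y - 2 * ε) 0 := by
      exact ((hH k x y hyIoo).sub ((((hasDerivAt_id (0 : ℝ)).const_mul 2).const_add
        (2 * x k)).const_mul ε)).congr_deriv (by ring)
    exact second_deriv_nonpos_of_isLocalMax hloc (Eventually.of_forall hd) hdd
  have hsum : ∑ k, H k x y ≤ n * (2 * ε) := by
    have : ∀ k ∈ (Finset.univ : Finset (Fin n)), H k x y ≤ 2 * ε := fun k _ => by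
      linarith [hWk k]
    simpa using Finset.sum_le_card_nsmul _ _ _ this
  have hp := hpde x y hyIoo
  have h1 : b / y * F1 x y = -(2 * ε * K * b) := by
    have : F1 x y = -(2 * ε * K * y) := by linarith
    rw [this]; field_simp
  have h2 : K * (1 + b) = n + 1 := by rw [hK]; field_simp
  rw [h1] at hp
  nlinarith

/-! ### Families of functions closed under horizontal differentiation -/

section Families

variable {n : ℕ} {I : Type*} {D : Fin n → I → I}

/-- A family of functions of `(x, y)` indexed by `I`, such that the `k`-th horizontal derivative of
the member with index `i` is the member with index `D k i`. -/
def XDiff (D : Fin n → I → I) (F : I → Eu n → ℝ → ℝ) : Prop :=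
  ∀ i k x y, 0 < y → HasDerivAt (fun s : ℝ => F i (x + s • basisVec k) y) (F (D k i) x y) 0

theorem XDiff.hasDerivAt {F : I → Eu n → ℝ → ℝ} (h : XDiff D F) (i : I) (k : Fin n) (x : Eu n)
    {y : ℝ} (hy : 0 < y) (s : ℝ) :
    HasDerivAt (fun s : ℝ => F i (x + s • basisVec k) y) (F (D k i) (x + s • basisVec k) y) s :=
  hasDerivAt_line (f := fun x => F i x y) (h i k (x + s • basisVec k) y hy)

theorem abs_sub_le_of_coordinate_lipschitz {f : Eu n → ℝ} {C : ℝ}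
    (h : ∀ x k (s : ℝ), |f (x + s • basisVec k) - f x| ≤ C * |s|) (x v : Eu n) :
    |f (x + v) - f x| ≤ C * ∑ k, |v k| := by
  have key : ∀ S : Finset (Fin n),
      |f (x + ∑ k ∈ S, v k • basisVec k) - f x| ≤ C * ∑ k ∈ S, |v k| := by
    intro S
    induction S using Finset.induction_on with
    | empty => simp
    | insert k S hk ih =>
      rw [Finset.sum_insert hk, Finset.sum_insert hk]
      have h1 := h (x + ∑ k ∈ S, v k • basisVec k) k (v k)
      rw [add_assoc, add_comm (∑ k ∈ S, v k • basisVec k)] at h1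
      rw [mul_add]
      refine (abs_sub_le _ (f (x + ∑ k ∈ S, v k • basisVec k)) _).trans (add_le_add h1 ih)
  have hv : ∑ k, v k • basisVec k = v := by
    have := (EuclideanSpace.basisFun (Fin n) ℝ).sum_repr v
    simpa [basisVec] using this
  simpa [hv] using key Finset.univ

/-- Members of a family that is bounded on a set of heights are uniformly Lipschitz in `x`. -/
theorem XDiff.exists_lipschitz {F : I → Eu n → ℝ → ℝ} (h : XDiff D F) (T : Set ℝ)
    (hT : ∀ y ∈ T, 0 < y) (hb : ∀ i, ∃ M, ∀ x, ∀ y ∈ T, |F i x y| ≤ M) (i : I) :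
    ∃ L : NNReal, ∀ y ∈ T, LipschitzWith L fun x => F i x y := by
  choose M hM using hb
  set C : ℝ := ∑ k, |M (D k i)|
  have hC0 : 0 ≤ C := Finset.sum_nonneg fun _ _ => abs_nonneg _
  have hC : ∀ k, ∀ x, ∀ y ∈ T, |F (D k i) x y| ≤ C := fun k x y hy =>
    (hM _ x y hy).trans ((le_abs_self _).trans
      (Finset.single_le_sum (f := fun k => |M (D k i)|) (fun _ _ => abs_nonneg _)
        (Finset.mem_univ k)))
  refine ⟨(C * n).toNNReal, fun y hy => LipschitzWith.of_dist_le_mul fun x x' => ?_⟩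
  have h1 : ∀ x k (s : ℝ), |F i (x + s • basisVec k) y - F i x y| ≤ C * |s| := fun x k s => by
    have := (convex_univ (𝕜 := ℝ) (E := ℝ)).norm_image_sub_le_of_norm_hasDerivWithin_le
      (f := fun s : ℝ => F i (x + s • basisVec k) y)
      (fun s _ => (h.hasDerivAt i k x (hT y hy) s).hasDerivWithinAt)
      (fun s _ => hC k (x + s • basisVec k) y hy) (Set.mem_univ 0) (Set.mem_univ s)
    simpa using this
  have h2 := abs_sub_le_of_coordinate_lipschitz (f := fun x => F i x y) h1 x' (x - x')
  rw [add_sub_cancel] at h2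
  rw [Real.dist_eq]
  refine h2.trans ?_
  rw [Real.coe_toNNReal _ (by positivity), mul_assoc, dist_eq_norm]
  gcongr
  have : ∀ k ∈ (Finset.univ : Finset (Fin n)), |(x - x') k| ≤ ‖x - x'‖ := fun k _ => by
    simpa using PiLp.norm_apply_le (x - x') k
  simpa using Finset.sum_le_card_nsmul _ _ _ this

theorem continuousOn_prod_of_lipschitz {f : Eu n → ℝ → ℝ} {T : Set ℝ} {L : NNReal}
    (hL : ∀ y ∈ T, LipschitzWith L fun x => f x y) (hc : ∀ x, ContinuousOn (f x) T) :
    ContinuousOn (fun q : Eu n × ℝ => f q.1 q.2) (Set.univ ×ˢ T) :=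
  continuousOn_prod_of_continuousOn_lipschitzOnWith _ L (fun x _ => hc x)
    fun y hy => (hL y hy).lipschitzOnWith

/-- Pointwise decay at the bottom is locally uniform for uniformly Lipschitz functions. -/
theorem bottom_of_lipschitz {f : Eu n → ℝ → ℝ} {Y : ℝ} (hY : 0 < Y) {L : NNReal}
    (hL : ∀ y ∈ Set.Ioc 0 Y, LipschitzWith L fun x => f x y)
    (h0 : ∀ x, Tendsto (f x) (𝓝[>] 0) (𝓝 0)) (R ε : ℝ) (hε : 0 < ε) :
    ∃ η > 0, ∀ x : Eu n, ‖x‖ ≤ R → ∀ y, 0 < y → y < η → |f x y| ≤ ε := by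
  set r : ℝ := ε / (2 * (L + 1)) with hr
  have hr0 : 0 < r := by positivity
  obtain ⟨t, -, htf, ht⟩ := (isCompact_closedBall (0 : Eu n) R).finite_cover_balls hr0
  have h1 : ∀ᶠ y in 𝓝[>] (0 : ℝ), ∀ x ∈ t, |f x y| < ε / 2 := by
    rw [eventually_all_finite htf]
    intro x _
    have := (h0 x).abs
    rw [abs_zero] at this
    exact this.eventually (gt_mem_nhds (by linarith))
  obtain ⟨u, hu, hu'⟩ := mem_nhdsGT_iff_exists_Ioo_subset.1 h1
  refine ⟨min u Y, lt_min hu hY, fun x hx y hy hyη => ?_⟩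
  obtain ⟨c, hc, hxc⟩ := Set.mem_iUnion₂.1 (ht (by simpa using hx : x ∈ Metric.closedBall 0 R))
  have h2 : |f c y| < ε / 2 := hu' ⟨hy, hyη.trans_le (min_le_left _ _)⟩ c hc
  have h3 := (hL y ⟨hy, hyη.le.trans (min_le_right _ _)⟩).dist_le_mul x c
  rw [Real.dist_eq] at h3
  have h4 : (L : ℝ) * dist x c ≤ ε / 2 := by
    have h5 : dist x c ≤ r := (Metric.mem_ball.1 hxc).le
    calc (L : ℝ) * dist x c ≤ (L + 1) * r := by gcongr; linarith
      _ = ε / 2 := by rw [hr]; field_simp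
  calc |f x y| = |(f x y - f c y) + f c y| := by ring_nf
    _ ≤ |f x y - f c y| + |f c y| := abs_add_le _ _
    _ ≤ ε := by linarith

theorem hasDerivAt_div_rpow {c Y y : ℝ} (hy : 0 < y) (hY : 0 < Y) :
    HasDerivAt (fun y => (y / Y) ^ c) (c * y ^ (c - 1) / Y ^ c) y := by
  have h : HasDerivAt (fun y : ℝ => y ^ c / Y ^ c) (c * y ^ (c - 1) / Y ^ c) y :=
    (Real.hasDerivAt_rpow_const (Or.inl hy.ne')).div_const _
  refine h.congr_of_eventuallyEq ?_
  filter_upwards [lt_mem_nhds hy] with z hz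
  exact Real.div_rpow hz.le hY.le _

/-- The one-dimensional solution `y ^ (1 - b)` dominates a solution that vanishes at the bottom and has
smaller growth. -/
theorem XDiff.nonpos_of_solution {F F1 F2 : I → Eu n → ℝ → ℝ} {b c : ℝ} (hb : -1 < b)
    (hc : 0 ≤ c) (hcb : c < 1 - b) (hx : XDiff D F)
    (h1 : ∀ i x y, 0 < y → HasDerivAt (F i x) (F1 i x y) y)
    (h2 : ∀ i x y, 0 < y → HasDerivAt (F1 i x) (F2 i x y) y)
    (hpde : ∀ i x y, 0 < y → F2 i x y + b / y * F1 i x y + ∑ k, F (D k (D k i)) x y = 0)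
    (hbd : ∀ i, ∃ M, ∀ x y, 0 < y → |F i x y| ≤ M * (1 + y) ^ c)
    (hbot : ∀ i x, Tendsto (F i x) (𝓝[>] 0) (𝓝 0)) (i : I) (x : Eu n) {y : ℝ} (hy : 0 < y) :
    F i x y ≤ 0 := by
  obtain ⟨M, hM⟩ := hbd i
  have hM0 : 0 ≤ M := by
    have := (abs_nonneg _).trans (hM 0 1 one_pos)
    exact nonneg_of_mul_nonneg_left this (by positivity)
  have hd : 0 < 1 - b := hc.trans_lt hcb
  -- comparison with the one-dimensional solution `y ^ (1 - b)` on the strip of height `Y`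
  have key : ∀ Y, y ≤ Y → F i x y ≤ M * (1 + Y) ^ c * (y / Y) ^ (1 - b) := by
    intro Y hyY
    have hY : 0 < Y := hy.trans_le hyY
    have hbY : ∀ i, ∃ M, ∀ x, ∀ y ∈ Set.Ioc 0 Y, |F i x y| ≤ M := fun i => by
      obtain ⟨M, hM⟩ := hbd i
      refine ⟨|M| * (1 + Y) ^ c, fun x y hy => (hM x y hy.1).trans ?_⟩
      have := hy.1
      have h3 : (1 + y) ^ c ≤ (1 + Y) ^ c := by gcongr; exact hy.2
      exact mul_le_mul (le_abs_self _) h3 (by positivity) (abs_nonneg _)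
    obtain ⟨L, hL⟩ := hx.exists_lipschitz (Set.Ioc 0 Y) (fun y hy => hy.1) hbY i
    set N : ℝ := M * (1 + Y) ^ c with hN
    have hN0 : 0 ≤ N := by positivity
    have hle : ∀ x, ∀ y ∈ Set.Ioc 0 Y, |F i x y| ≤ N := fun x y hy => by
      refine (hM x y hy.1).trans ?_
      have := hy.1
      rw [hN]; gcongr; exact hy.2
    have hp0 : ∀ y ∈ Set.Ioc 0 Y, 0 ≤ N * (y / Y) ^ (1 - b) := fun y hy => by
      have := hy.1
      positivity
    have := nonpos_of_subsolution_strip (Y := Y) (M := N) hb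
      (F := fun x y => F i x y - N * (y / Y) ^ (1 - b))
      (F1 := fun x y => F1 i x y - N * ((1 - b) * y ^ (1 - b - 1) / Y ^ (1 - b)))
      (F2 := fun x y => F2 i x y -
        N * ((1 - b) * ((1 - b - 1) * y ^ (1 - b - 1 - 1)) / Y ^ (1 - b)))
      (G := fun k x y => F (D k i) x y) (H := fun k x y => F (D k (D k i)) x y)
      (fun x y hy => (h1 i x y hy.1).sub ((hasDerivAt_div_rpow hy.1 hY).const_mul N))
      (fun x y hy => (h2 i x y hy.1).sub ((((Real.hasDerivAt_rpow_const
        (Or.inl hy.1.ne')).const_mul (1 - b)).div_const _).const_mul N))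
      (fun k x y hy => (hx i k x y hy.1).sub_const _)
      (fun k x y hy => hx (D k i) k x y hy.1)
      (fun x y hy => by
        have h3 := hpde i x y hy.1
        have h4 : y ^ (1 - b - 1) = y ^ (1 - b - 1 - 1) * y := by
          rw [Real.rpow_sub_one hy.1.ne' (1 - b - 1)]
          have := hy.1.ne'
          field_simp
        have h5 : b / y * (N * ((1 - b) * y ^ (1 - b - 1) / Y ^ (1 - b))) =
            b * (N * ((1 - b) * y ^ (1 - b - 1 - 1) / Y ^ (1 - b))) := by
          rw [h4]
          have := hy.1.ne'
          field_simp
        rw [mul_sub, h5]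
        refine le_of_eq ?_
        rw [← h3]
        ring)
      ((continuousOn_prod_of_lipschitz hL fun x y hy =>
        (h1 i x y hy.1).continuousAt.continuousWithinAt).sub (Continuous.continuousOn (by
          have : Continuous fun y : ℝ => (y / Y) ^ (1 - b) :=
            (continuous_id.div_const Y).rpow_const fun _ => Or.inr hd.le
          exact continuous_const.mul (this.comp continuous_snd))))
      (fun x y hy => by
        have h3 := (abs_le.1 (hle x y hy)).2
        have h4 := hp0 y hy
        linarith)
      (fun x => by
        have h3 := (abs_le.1 (hle x Y ⟨hY, le_rfl⟩)).2
        rw [div_self hY.ne', Real.one_rpow]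
        linarith)
      (fun R ε hε => by
        obtain ⟨η, hη, h⟩ := bottom_of_lipschitz hY hL (hbot i) R ε hε
        refine ⟨min η Y, lt_min hη hY, fun x hx y hy hyη => ?_⟩
        have h3 := (abs_le.1 (h x hx y hy (hyη.trans_le (min_le_left _ _)))).2
        have h4 := hp0 y ⟨hy, (hyη.trans_le (min_le_right _ _)).le⟩
        linarith)
      x ⟨hy, hyY⟩
    linarith
  -- the comparison function tends to zero as the height tends to infinity
  have hlim : Tendsto (fun Y : ℝ => M * (2 ^ c * y ^ (1 - b) * Y ^ (-(1 - b - c)))) atTop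
      (𝓝 (M * (2 ^ c * y ^ (1 - b) * 0))) :=
    ((tendsto_rpow_neg_atTop (by linarith)).const_mul _).const_mul _
  rw [mul_zero, mul_zero] at hlim
  refine ge_of_tendsto hlim ?_
  filter_upwards [eventually_ge_atTop (max y 1)] with Y hY
  have hyY : y ≤ Y := (le_max_left _ _).trans hY
  have hY1 : 1 ≤ Y := (le_max_right _ _).trans hY
  have hY0 : 0 < Y := by linarith
  refine (key Y hyY).trans ?_
  rw [mul_assoc]
  refine mul_le_mul_of_nonneg_left ?_ hM0
  have h5 : Y ^ (-(1 - b - c)) = Y ^ c / Y ^ (1 - b) := by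
    rw [← Real.rpow_sub hY0]; congr 1; ring
  rw [Real.div_rpow hy.le hY0.le, h5]
  have h3 : (1 + Y) ^ c ≤ 2 ^ c * Y ^ c := by
    rw [← Real.mul_rpow (by norm_num) hY0.le]
    gcongr; linarith
  calc (1 + Y) ^ c * (y ^ (1 - b) / Y ^ (1 - b))
      ≤ 2 ^ c * Y ^ c * (y ^ (1 - b) / Y ^ (1 - b)) := by gcongr
    _ = 2 ^ c * y ^ (1 - b) * (Y ^ c / Y ^ (1 - b)) := by ring

/-- Uniqueness for the Dirichlet problem of the weighted Laplace equation on the half-space, for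
families of solutions of growth less than that of `y ^ (1 - b)`. -/
theorem XDiff.eq_zero_of_solution {F F1 F2 : I → Eu n → ℝ → ℝ} {b c : ℝ} (hb : -1 < b)
    (hc : 0 ≤ c) (hcb : c < 1 - b) (hx : XDiff D F)
    (h1 : ∀ i x y, 0 < y → HasDerivAt (F i x) (F1 i x y) y)
    (h2 : ∀ i x y, 0 < y → HasDerivAt (F1 i x) (F2 i x y) y)
    (hpde : ∀ i x y, 0 < y → F2 i x y + b / y * F1 i x y + ∑ k, F (D k (D k i)) x y = 0)
    (hbd : ∀ i, ∃ M, ∀ x y, 0 < y → |F i x y| ≤ M * (1 + y) ^ c)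
    (hbot : ∀ i x, Tendsto (F i x) (𝓝[>] 0) (𝓝 0)) (i : I) (x : Eu n) {y : ℝ} (hy : 0 < y) :
    F i x y = 0 := by
  refine le_antisymm (XDiff.nonpos_of_solution hb hc hcb hx h1 h2 hpde hbd hbot i x hy) ?_
  have hx' : XDiff D fun i x y => -F i x y := fun i k x y hy => (hx i k x y hy).neg
  have := XDiff.nonpos_of_solution hb hc hcb hx' (fun i x y hy => (h1 i x y hy).neg)
    (fun i x y hy => (h2 i x y hy).neg)
    (fun i x y hy => by
      have := hpde i x y hy
      rw [Finset.sum_neg_distrib]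
      linarith)
    (fun i => by simpa using hbd i) (fun i x => by simpa using (hbot i x).neg) i x hy
  linarith

end Families

/-! ### Elementary derivative bounds -/

/-- A Landau-type inequality on an interval of length one, for `f'` up to a bounded
correction `h`. -/
theorem abs_deriv_le_of_bounds {f f1 h g : ℝ → ℝ} {y M N K : ℝ}
    (hf : ∀ t ∈ Set.Icc y (y + 1), HasDerivAt f (f1 t) t)
    (hg : ∀ t ∈ Set.Icc y (y + 1), HasDerivAt (fun t => f1 t + h t) (g t) t)
    (hM : ∀ t ∈ Set.Icc y (y + 1), |f t| ≤ M) (hN : ∀ t ∈ Set.Icc y (y + 1), |h t| ≤ N)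
    (hK : ∀ t ∈ Set.Icc y (y + 1), |g t| ≤ K) : |f1 y| ≤ 2 * M + 2 * N + K := by
  have hlt : y < y + 1 := by linarith
  obtain ⟨ξ, hξ, hξ'⟩ := exists_hasDerivAt_eq_slope f f1 hlt
    (fun t ht => (hf t ht).continuousAt.continuousWithinAt)
    (fun t ht => hf t (Set.Ioo_subset_Icc_self ht))
  have hy : y ∈ Set.Icc y (y + 1) := Set.left_mem_Icc.2 hlt.le
  have hξ1 := Set.Ioo_subset_Icc_self hξ
  have h1 : |f1 ξ| ≤ 2 * M := by
    rw [hξ', add_sub_cancel_left, div_one]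
    have h2 := hM y hy
    have h3 := hM (y + 1) (Set.right_mem_Icc.2 hlt.le)
    have := abs_sub (f (y + 1)) (f y)
    linarith
  have h2 : ‖(f1 y + h y) - (f1 ξ + h ξ)‖ ≤ K * ‖y - ξ‖ :=
    (convex_Icc y (y + 1)).norm_image_sub_le_of_norm_hasDerivWithin_le
      (fun t ht => (hg t ht).hasDerivWithinAt) hK hξ1 hy
  have hK0 : 0 ≤ K := (abs_nonneg _).trans (hK y hy)
  have h3 : ‖y - ξ‖ ≤ 1 := by
    rw [Real.norm_eq_abs, abs_sub_comm, abs_of_nonneg (by linarith [hξ.1])]; linarith [hξ.2]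
  have h4 : |(f1 y + h y) - (f1 ξ + h ξ)| ≤ K := by
    refine h2.trans ?_
    simpa using mul_le_mul_of_nonneg_left h3 hK0
  have h5 := abs_le.1 (hN y hy)
  have h6 := abs_le.1 (hN ξ hξ1)
  have h7 := abs_le.1 h1
  have h8 := abs_le.1 h4
  exact abs_le.2 ⟨by linarith [h5.1, h5.2, h6.1, h6.2, h7.1, h7.2, h8.1, h8.2],
    by linarith [h5.1, h5.2, h6.1, h6.2, h7.1, h7.2, h8.1, h8.2]⟩

/-- Integration of `|h'| ≤ C t ^ (e - 1)` up to height one; the exponent `e` may be negative. -/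
theorem abs_sub_le_of_deriv_le_rpow {h h1 : ℝ → ℝ} {C e : ℝ} (he : e ≠ 0)
    (hh : ∀ t ∈ Set.Ioc (0 : ℝ) 1, HasDerivAt h (h1 t) t)
    (hb : ∀ t ∈ Set.Ioc (0 : ℝ) 1, |h1 t| ≤ C * t ^ (e - 1)) {y : ℝ}
    (hy : y ∈ Set.Ioc (0 : ℝ) 1) : |h y - h 1| ≤ C / e * (1 - y ^ e) := by
  have hsub : ∀ t ∈ Set.Icc y 1, t ∈ Set.Ioc (0 : ℝ) 1 := fun t ht => ⟨hy.1.trans_le ht.1, ht.2⟩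
  have hB : ∀ t ∈ Set.Icc y 1, HasDerivAt (fun t => C / e * (t ^ e - y ^ e))
      (C * t ^ (e - 1)) t := fun t ht => by
    refine (((Real.hasDerivAt_rpow_const (p := e)
      (Or.inl (hsub t ht).1.ne')).sub_const _).const_mul (C / e)).congr_deriv ?_
    field_simp
  have := image_norm_le_of_norm_deriv_right_le_deriv_boundary' (f := fun t => h t - h y) (f' := h1)
    (a := y) (b := 1) (B := fun t => C / e * (t ^ e - y ^ e)) (B' := fun t => C * t ^ (e - 1))
    (fun t ht => ((hh t (hsub t ht)).sub_const _).continuousAt.continuousWithinAt)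
    (fun t ht => ((hh t (hsub t (Set.Ico_subset_Icc_self ht))).sub_const _).hasDerivWithinAt)
    (by simp) (fun t ht => (hB t ht).continuousAt.continuousWithinAt)
    (fun t ht => (hB t (Set.Ico_subset_Icc_self ht)).hasDerivWithinAt)
    (fun t ht => hb t (hsub t (Set.Ico_subset_Icc_self ht)))
    (Set.right_mem_Icc.2 hy.2)
  rw [abs_sub_comm]
  simpa using this

/-! ### The system for the normal components -/

section Normal

variable {n : ℕ} {I : Type*} {D : Fin n → I → I} {a : ℝ}

/-- The horizontal Laplacian of a family. -/
def lap (D : Fin n → I → I) (F : I → Eu n → ℝ → ℝ) (i : I) (x : Eu n) (y : ℝ) : ℝ :=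
  ∑ k, F (D k (D k i)) x y

/-- Boundedness of each member of a family on the half-space. -/
def Bdd (F : I → Eu n → ℝ → ℝ) : Prop := ∀ i, ∃ M, 0 ≤ M ∧ ∀ x y, 0 < y → |F i x y| ≤ M

theorem Bdd.lap {F : I → Eu n → ℝ → ℝ} (h : Bdd F) : Bdd (lap D F) := fun i => by
  choose M hM0 hM using h
  refine ⟨∑ k, M (D k (D k i)), Finset.sum_nonneg fun k _ => hM0 _, fun x y hy => ?_⟩
  exact (Finset.abs_sum_le_sum_abs _ _).trans (Finset.sum_le_sum fun k _ => hM _ x y hy)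

/-- The system satisfied by a normal component `u` of the extension and the corresponding component
`δ` of the horizontal codifferential of its tangential part; `u1`, `δ1` are the `y`-derivatives, and
`g` is the codifferential of the boundary datum.  The full codifferential of the extension has the
component `δ - u1`, so that the last two conditions together force `u1 → 0`. -/
structure NormalSystem (a : ℝ) (D : Fin n → I → I) (u u1 δ δ1 : I → Eu n → ℝ → ℝ)
    (g : I → Eu n → ℝ) : Prop where
  xu : XDiff D u
  xu1 : XDiff D u1
  xδ : XDiff D δ
  deriv_u : ∀ i x y, 0 < y → HasDerivAt (u i x) (u1 i x y) y
  deriv_u1 : ∀ i x y, 0 < y →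
    HasDerivAt (u1 i x) (a / y * (δ i x y - u1 i x y) - lap D u i x y) y
  deriv_δ : ∀ i x y, 0 < y → HasDerivAt (δ i x) (δ1 i x y) y
  deriv_δ1 : ∀ i x y, 0 < y →
    HasDerivAt (δ1 i x) (-(a / y * δ1 i x y) - lap D δ i x y - a / y * lap D u i x y) y
  bdd_u : Bdd u
  bdd_δ : Bdd δ
  tendsto_u : ∀ i x, Tendsto (u i x) (𝓝[>] 0) (𝓝 0)
  tendsto_δ : ∀ i x, Tendsto (δ i x) (𝓝[>] 0) (𝓝 (g i x))
  tendsto_v : ∀ i x, Tendsto (fun y => δ i x y - u1 i x y) (𝓝[>] 0) (𝓝 (g i x))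

theorem tendsto_lap {F : I → Eu n → ℝ → ℝ} (h : ∀ i x, Tendsto (F i x) (𝓝[>] 0) (𝓝 0)) (i : I)
    (x : Eu n) : Tendsto (lap D F i x) (𝓝[>] 0) (𝓝 0) := by
  have := tendsto_finsetSum (Finset.univ : Finset (Fin n)) fun k _ => h (D k (D k i)) x
  simp only [Finset.sum_const_zero] at this
  exact this

theorem hasDerivAt_lap {F F1 : I → Eu n → ℝ → ℝ}
    (h : ∀ i x y, 0 < y → HasDerivAt (F i x) (F1 i x y) y) (i : I) (x : Eu n) {y : ℝ} (hy : 0 < y) :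
    HasDerivAt (lap D F i x) (lap D F1 i x y) y := by
  have : HasDerivAt (fun y => ∑ k, F (D k (D k i)) x y) (∑ k, F1 (D k (D k i)) x y) y :=
    HasDerivAt.fun_sum fun k _ => h _ x y hy
  exact this

theorem hasDerivAt_const_div {a y : ℝ} (hy : 0 < y) :
    HasDerivAt (fun t : ℝ => a / t) (-(a / y ^ 2)) y := by
  refine ((hasDerivAt_inv hy.ne').const_mul a).congr_deriv ?_
  field_simp

/-- Bounded harmonic families with zero boundary values vanish. -/
theorem eq_zero_of_harmonic {F F1 : I → Eu n → ℝ → ℝ} {c : ℝ} (hc : 0 ≤ c) (hc1 : c < 1)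
    (hx : XDiff D F) (h1 : ∀ i x y, 0 < y → HasDerivAt (F i x) (F1 i x y) y)
    (h2 : ∀ i x y, 0 < y → HasDerivAt (F1 i x) (-lap D F i x y) y)
    (hbd : ∀ i, ∃ M, ∀ x y, 0 < y → |F i x y| ≤ M * (1 + y) ^ c)
    (hbot : ∀ i x, Tendsto (F i x) (𝓝[>] 0) (𝓝 0)) (i : I) (x : Eu n) {y : ℝ} (hy : 0 < y) :
    F i x y = 0 :=
  XDiff.eq_zero_of_solution (b := 0) (by norm_num) hc (by linarith) hx h1 h2
    (fun i x y _ => by simp [lap]) hbd hbot i x hy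

theorem Bdd.growth {F : I → Eu n → ℝ → ℝ} (h : Bdd F) (i : I) :
    ∃ M, ∀ x y, 0 < y → |F i x y| ≤ M * (1 + y) ^ (0 : ℝ) := by
  obtain ⟨M, -, hM⟩ := h i
  exact ⟨M, by simpa using hM⟩

namespace NormalSystem

variable {u u1 δ δ1 : I → Eu n → ℝ → ℝ} {g : I → Eu n → ℝ}

theorem tendsto_u1 (h : NormalSystem a D u u1 δ δ1 g) (i : I) (x : Eu n) :
    Tendsto (u1 i x) (𝓝[>] 0) (𝓝 0) := by
  have := (h.tendsto_δ i x).sub (h.tendsto_v i x)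
  simpa using this

/-- The boundary values are compatible only if the codifferential of the datum vanishes: this is
l'Hôpital's rule for `y u' / y`. -/
theorem boundary_eq_zero (h : NormalSystem a D u u1 δ δ1 g) (ha : a ≠ 0) (i : I) (x : Eu n) :
    g i x = 0 := by
  have hid : Tendsto (fun y : ℝ => y) (𝓝[>] 0) (𝓝 0) :=
    tendsto_id.mono_left nhdsWithin_le_nhds
  have h1 : Tendsto (fun y => (y * u1 i x y) / y) (𝓝[>] 0) (𝓝 (a * g i x)) := by
    refine HasDerivAt.lhopital_zero_nhdsGT
      (f' := fun y => u1 i x y + (a * (δ i x y - u1 i x y) - y * lap D u i x y))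
      (g' := fun _ => 1) ?_ ?_ ?_ ?_ ?_ ?_
    · filter_upwards [self_mem_nhdsWithin] with y hy
      have hy0 : y ≠ 0 := ne_of_gt hy
      refine ((hasDerivAt_id y).mul (h.deriv_u1 i x y hy)).congr_deriv ?_
      simp only [id]
      field_simp
    · exact Eventually.of_forall fun y => hasDerivAt_id y
    · exact Eventually.of_forall fun y => one_ne_zero
    · simpa using hid.mul (h.tendsto_u1 i x)
    · exact hid
    · have h2 := (h.tendsto_u1 i x).add (((h.tendsto_v i x).const_mul a).sub
        (hid.mul (tendsto_lap (D := D) h.tendsto_u i x)))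
      simpa using h2
  have h2 : Tendsto (fun y => (y * u1 i x y) / y) (𝓝[>] 0) (𝓝 0) := by
    refine (h.tendsto_u1 i x).congr' ?_
    filter_upwards [self_mem_nhdsWithin] with y hy
    have hy0 : y ≠ 0 := ne_of_gt hy
    field_simp
  exact (mul_eq_zero.1 (tendsto_nhds_unique h1 h2)).resolve_left ha

/-- Away from the boundary, `u' + (a / y) u` has a bounded `y`-derivative. -/
theorem bound_u1_of_one_le (h : NormalSystem a D u u1 δ δ1 g) (i : I) :
    ∃ M, 0 ≤ M ∧ ∀ x y, 1 ≤ y → |u1 i x y| ≤ M := by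
  obtain ⟨A, hA0, hA⟩ := h.bdd_u i
  obtain ⟨B, hB0, hB⟩ := h.bdd_δ i
  obtain ⟨C, hC0, hC⟩ := (h.bdd_u.lap (D := D)) i
  refine ⟨2 * A + 2 * (|a| * A) + (|a| * B + C + |a| * A), by positivity, fun x y hy => ?_⟩
  have hpos : ∀ t ∈ Set.Icc y (y + 1), 0 < t := fun t ht => by linarith [ht.1]
  have hdiv : ∀ t ∈ Set.Icc y (y + 1), |a / t| ≤ |a| := fun t ht => by
    rw [abs_div, abs_of_pos (hpos t ht)]
    exact div_le_self (abs_nonneg _) (by linarith [ht.1])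
  have hdiv2 : ∀ t ∈ Set.Icc y (y + 1), |a / t ^ 2| ≤ |a| := fun t ht => by
    rw [abs_div, abs_of_pos (pow_pos (hpos t ht) 2)]
    exact div_le_self (abs_nonneg _) (one_le_pow₀ (by linarith [ht.1]))
  refine abs_deriv_le_of_bounds (f := u i x) (h := fun t => a / t * u i x t)
    (g := fun t => a / t * δ i x t - lap D u i x t - a / t ^ 2 * u i x t)
    (fun t ht => h.deriv_u i x t (hpos t ht)) (fun t ht => ?_)
    (fun t ht => hA x t (hpos t ht)) (fun t ht => ?_) (fun t ht => ?_)
  · refine ((h.deriv_u1 i x t (hpos t ht)).add ((hasDerivAt_const_div (hpos t ht)).mul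
      (h.deriv_u i x t (hpos t ht)))).congr_deriv ?_
    ring
  · rw [abs_mul]
    exact mul_le_mul (hdiv t ht) (hA x t (hpos t ht)) (abs_nonneg _) (abs_nonneg _)
  · refine (abs_sub _ _).trans (add_le_add ((abs_sub _ _).trans (add_le_add ?_ ?_)) ?_)
    · rw [abs_mul]
      exact mul_le_mul (hdiv t ht) (hB x t (hpos t ht)) (abs_nonneg _) (abs_nonneg _)
    · exact hC x t (hpos t ht)
    · rw [abs_mul]
      exact mul_le_mul (hdiv2 t ht) (hA x t (hpos t ht)) (abs_nonneg _) (abs_nonneg _)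

/-- Away from the boundary, `δ' + (a / y) δ` has a bounded `y`-derivative. -/
theorem bound_δ1_of_one_le (h : NormalSystem a D u u1 δ δ1 g) (i : I) :
    ∃ M, 0 ≤ M ∧ ∀ x y, 1 ≤ y → |δ1 i x y| ≤ M := by
  obtain ⟨A, hA0, hA⟩ := h.bdd_δ i
  obtain ⟨B, hB0, hB⟩ := (h.bdd_δ.lap (D := D)) i
  obtain ⟨C, hC0, hC⟩ := (h.bdd_u.lap (D := D)) i
  refine ⟨2 * A + 2 * (|a| * A) + (B + |a| * C + |a| * A), by positivity, fun x y hy => ?_⟩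
  have hpos : ∀ t ∈ Set.Icc y (y + 1), 0 < t := fun t ht => by linarith [ht.1]
  have hdiv : ∀ t ∈ Set.Icc y (y + 1), |a / t| ≤ |a| := fun t ht => by
    rw [abs_div, abs_of_pos (hpos t ht)]
    exact div_le_self (abs_nonneg _) (by linarith [ht.1])
  have hdiv2 : ∀ t ∈ Set.Icc y (y + 1), |a / t ^ 2| ≤ |a| := fun t ht => by
    rw [abs_div, abs_of_pos (pow_pos (hpos t ht) 2)]
    exact div_le_self (abs_nonneg _) (one_le_pow₀ (by linarith [ht.1]))
  refine abs_deriv_le_of_bounds (f := δ i x) (h := fun t => a / t * δ i x t)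
    (g := fun t => -lap D δ i x t - a / t * lap D u i x t - a / t ^ 2 * δ i x t)
    (fun t ht => h.deriv_δ i x t (hpos t ht)) (fun t ht => ?_)
    (fun t ht => hA x t (hpos t ht)) (fun t ht => ?_) (fun t ht => ?_)
  · refine ((h.deriv_δ1 i x t (hpos t ht)).add ((hasDerivAt_const_div (hpos t ht)).mul
      (h.deriv_δ i x t (hpos t ht)))).congr_deriv ?_
    ring
  · rw [abs_mul]
    exact mul_le_mul (hdiv t ht) (hA x t (hpos t ht)) (abs_nonneg _) (abs_nonneg _)
  · refine (abs_sub _ _).trans (add_le_add ((abs_sub _ _).trans (add_le_add ?_ ?_)) ?_)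
    · rw [abs_neg]; exact hB x t (hpos t ht)
    · rw [abs_mul]
      exact mul_le_mul (hdiv t ht) (hC x t (hpos t ht)) (abs_nonneg _) (abs_nonneg _)
    · rw [abs_mul]
      exact mul_le_mul (hdiv2 t ht) (hA x t (hpos t ht)) (abs_nonneg _) (abs_nonneg _)

/-- Near the boundary `y ^ a u'` differs from its value at height one by a multiple of
`(1 - y ^ a) / a`. -/
theorem bound_rpow_mul_u1 (h : NormalSystem a D u u1 δ δ1 g) (ha : a ≠ 0) (i : I) :
    ∃ M C, 0 ≤ M ∧ 0 ≤ C ∧ ∀ x, ∀ y ∈ Set.Ioc (0 : ℝ) 1,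
      |y ^ a * u1 i x y| ≤ M + C / a * (1 - y ^ a) := by
  obtain ⟨M, hM0, hM⟩ := h.bound_u1_of_one_le i
  obtain ⟨B, hB0, hB⟩ := h.bdd_δ i
  obtain ⟨C, hC0, hC⟩ := (h.bdd_u.lap (D := D)) i
  refine ⟨M, |a| * B + C, hM0, by positivity, fun x y hy => ?_⟩
  have key := abs_sub_le_of_deriv_le_rpow (h := fun t => t ^ a * u1 i x t)
    (h1 := fun t => a * t ^ (a - 1) * δ i x t - t ^ a * lap D u i x t) (C := |a| * B + C) ha
    (fun t ht => by
      have ht0 := ht.1.ne'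
      refine ((Real.hasDerivAt_rpow_const (p := a) (Or.inl ht0)).mul
        (h.deriv_u1 i x t ht.1)).congr_deriv ?_
      rw [Real.rpow_sub_one ht0]
      field_simp
      ring)
    (fun t ht => by
      have h1 : t ^ a ≤ t ^ (a - 1) :=
        Real.rpow_le_rpow_of_exponent_ge ht.1 ht.2 (by linarith)
      have h2 : 0 ≤ t ^ a := Real.rpow_nonneg ht.1.le _
      have h3 : 0 ≤ t ^ (a - 1) := Real.rpow_nonneg ht.1.le _
      have h4 := hB x t ht.1
      have h5 := hC x t ht.1
      refine (abs_sub _ _).trans ?_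
      rw [abs_mul, abs_mul, abs_mul, abs_of_nonneg h2, abs_of_nonneg h3]
      calc |a| * t ^ (a - 1) * |δ i x t| + t ^ a * |lap D u i x t|
          ≤ |a| * t ^ (a - 1) * B + t ^ (a - 1) * C := by gcongr
        _ = (|a| * B + C) * t ^ (a - 1) := by ring) hy
  have h1 := hM x 1 le_rfl
  simp only [Real.one_rpow, one_mul] at key
  have h2 := abs_sub_abs_le_abs_sub (y ^ a * u1 i x y) (u1 i x 1)
  linarith

/-- Without weight, `u` itself is harmonic. -/
theorem eq_zero_of_eq_zero (h : NormalSystem 0 D u u1 δ δ1 g) (i : I) (x : Eu n) {y : ℝ}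
    (hy : 0 < y) : u i x y = 0 :=
  eq_zero_of_harmonic le_rfl one_pos h.xu h.deriv_u
    (fun i x y hy => by simpa using h.deriv_u1 i x y hy) h.bdd_u.growth h.tendsto_u i x hy

/-- The weighted codifferential `z = y ^ a (δ - u')`. -/
def z (a : ℝ) (u1 δ : I → Eu n → ℝ → ℝ) (i : I) (x : Eu n) (y : ℝ) : ℝ :=
  y ^ a * (δ i x y - u1 i x y)

/-- The `y`-derivative of `z`. -/
def z1 (a : ℝ) (D : Fin n → I → I) (u δ1 : I → Eu n → ℝ → ℝ) (i : I) (x : Eu n) (y : ℝ) : ℝ :=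
  y ^ a * (δ1 i x y + lap D u i x y)

theorem deriv_z (h : NormalSystem a D u u1 δ δ1 g) (i : I) (x : Eu n) (y : ℝ) (hy : 0 < y) :
    HasDerivAt (z a u1 δ i x) (z1 a D u δ1 i x y) y := by
  have hy0 := hy.ne'
  refine ((Real.hasDerivAt_rpow_const (p := a) (Or.inl hy0)).mul
    ((h.deriv_δ i x y hy).sub (h.deriv_u1 i x y hy))).congr_deriv ?_
  simp only [z1]
  rw [Real.rpow_sub_one hy0]
  simp only [Pi.sub_apply]
  field_simp
  ring

/-- The weighted codifferential is harmonic. -/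
theorem deriv_z1 (h : NormalSystem a D u u1 δ δ1 g) (i : I) (x : Eu n) (y : ℝ) (hy : 0 < y) :
    HasDerivAt (z1 a D u δ1 i x) (-lap D (z a u1 δ) i x y) y := by
  have hy0 := hy.ne'
  refine ((Real.hasDerivAt_rpow_const (p := a) (Or.inl hy0)).mul
    ((h.deriv_δ1 i x y hy).add (hasDerivAt_lap h.deriv_u i x hy))).congr_deriv ?_
  have h1 : lap D (z a u1 δ) i x y = y ^ a * (lap D δ i x y - lap D u1 i x y) := by
    simp only [lap, z, ← Finset.sum_sub_distrib, Finset.mul_sum]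
  rw [h1, Real.rpow_sub_one hy0]
  simp only [Pi.add_apply]
  field_simp
  ring

theorem xz (h : NormalSystem a D u u1 δ δ1 g) : XDiff D (z a u1 δ) := fun i k x y hy =>
  ((h.xδ i k x y hy).sub (h.xu1 i k x y hy)).const_mul _

/-- The equation `u'' + Δ u = a y ^ (-1 - a) z`. -/
theorem deriv_u1_eq_z (h : NormalSystem a D u u1 δ δ1 g) (i : I) (x : Eu n) (y : ℝ) (hy : 0 < y) :
    HasDerivAt (u1 i x) (a * y ^ (-1 - a) * z a u1 δ i x y - lap D u i x y) y := by
  refine (h.deriv_u1 i x y hy).congr_deriv ?_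
  have : y ^ (-1 - a) * y ^ a = y⁻¹ := by
    rw [← Real.rpow_add hy, ← Real.rpow_neg_one]; congr 1; ring
  simp only [z]
  linear_combination (-a * (δ i x y - u1 i x y)) * this

/-- If the weighted codifferential vanishes, then `u` is harmonic with zero boundary values. -/
theorem eq_zero_of_z (h : NormalSystem a D u u1 δ δ1 g)
    (hz : ∀ i x y, 0 < y → z a u1 δ i x y = 0) (i : I) (x : Eu n) {y : ℝ} (hy : 0 < y) :
    u i x y = 0 :=
  eq_zero_of_harmonic le_rfl one_pos h.xu h.deriv_u
    (fun i x y hy => by simpa [hz i x y hy] using h.deriv_u1_eq_z i x y hy) h.bdd_u.growth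
    h.tendsto_u i x hy

theorem bound_z_of_one_le (h : NormalSystem a D u u1 δ δ1 g) (i : I) :
    ∃ M, 0 ≤ M ∧ ∀ x y, 1 ≤ y → |z a u1 δ i x y| ≤ M * y ^ a := by
  obtain ⟨M, hM0, hM⟩ := h.bound_u1_of_one_le i
  obtain ⟨B, hB0, hB⟩ := h.bdd_δ i
  refine ⟨B + M, by positivity, fun x y hy => ?_⟩
  have hy0 : 0 < y := by linarith
  rw [z, abs_mul, abs_of_nonneg (Real.rpow_nonneg hy0.le _), mul_comm]
  gcongr
  exact (abs_sub _ _).trans (add_le_add (hB x y hy0) (hM x y hy))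

/-- For `0 < a` the weighted codifferential vanishes on the boundary, as `g = 0` and `y ^ a → 0`, and
its growth `y ^ a` is less than linear. -/
theorem eq_zero_of_pos (h : NormalSystem a D u u1 δ δ1 g) (ha : 0 < a) (ha1 : a < 1) (i : I)
    (x : Eu n) {y : ℝ} (hy : 0 < y) : u i x y = 0 := by
  refine h.eq_zero_of_z (fun i x y hy => ?_) i x hy
  refine eq_zero_of_harmonic ha.le ha1 h.xz h.deriv_z h.deriv_z1 (fun i => ?_) (fun i x => ?_)
    i x hy
  · obtain ⟨M, hM0, hM⟩ := h.bound_z_of_one_le i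
    obtain ⟨N, C, hN0, hC0, hN⟩ := h.bound_rpow_mul_u1 ha.ne' i
    obtain ⟨B, hB0, hB⟩ := h.bdd_δ i
    refine ⟨M + (B + (N + C / a)), fun x y hy => ?_⟩
    have h1 : (1 : ℝ) ≤ (1 + y) ^ a := Real.one_le_rpow (by linarith) ha.le
    have hCa : 0 ≤ C / a := by positivity
    rcases le_total 1 y with hy1 | hy1
    · have h2 : y ^ a ≤ (1 + y) ^ a := by gcongr; linarith
      have h3 := hM x y hy1
      nlinarith
    · have h2 : 0 ≤ y ^ a := Real.rpow_nonneg hy.le _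
      have h3 : y ^ a ≤ 1 := Real.rpow_le_one hy.le hy1 ha.le
      have h4 := hN x y ⟨hy, hy1⟩
      have h5 : |y ^ a * δ i x y| ≤ B := by
        rw [abs_mul, abs_of_nonneg h2]
        have := hB x y hy
        have := abs_nonneg (δ i x y)
        nlinarith
      have h6 : C / a * (1 - y ^ a) ≤ C / a := by nlinarith
      have h7 : |z a u1 δ i x y| ≤ B + (N + C / a) := by
        rw [z, mul_sub]
        exact (abs_sub _ _).trans (by linarith)
      nlinarith
  · have h0 := h.boundary_eq_zero ha.ne' i x
    have h1 := h.tendsto_v i x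
    rw [h0] at h1
    have h2 : Tendsto (fun y : ℝ => y ^ a) (𝓝[>] 0) (𝓝 0) := by
      have := (Real.continuousAt_rpow_const 0 a (Or.inr ha.le)).tendsto
      rw [Real.zero_rpow ha.ne'] at this
      exact this.mono_left nhdsWithin_le_nhds
    have h3 := h2.mul h1
    rw [mul_zero] at h3
    exact h3

end NormalSystem

end Normal

section Normal

variable {n : ℕ} {I : Type*} {D : Fin n → I → I} {a : ℝ}

/-! ### Interior gradient bounds for harmonic families -/

/-- Bernstein's gradient bound: with `p = ∂w/∂x_k` and a cut-off `ζ` in the height, the function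
`ζ² p² + 4 w²` is subharmonic. -/
theorem abs_gradient_le_of_harmonic {w w1 : I → Eu n → ℝ → ℝ} (hx : XDiff D w)
    (h1 : ∀ i x y, 0 < y → HasDerivAt (w i x) (w1 i x y) y)
    (h2 : ∀ i x y, 0 < y → HasDerivAt (w1 i x) (-lap D w i x y) y) (hb : Bdd w)
    (i : I) (k : Fin n) {s h N : ℝ} (hs : 0 < s) (hh : 0 < h)
    (hN : ∀ x y, s ≤ y → |w i x y| ≤ N) (x : Eu n) : |w (D k i) x (s + h)| ≤ 4 * N / h := by
  have hN0 : 0 ≤ N := (abs_nonneg _).trans (hN x s le_rfl)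
  obtain ⟨P, hP0, hP⟩ := hb (D k i)
  -- the cut-off vanishes at the bottom and at the top of the strip `0 < t < 2 h`
  set Y : ℝ := 2 * h with hY
  have hY0 : 0 < Y := by positivity
  set ζ : ℝ → ℝ := fun t => t - t ^ 2 / Y with hζ
  have hpos : ∀ t ∈ Set.Ioc 0 Y, 0 < s + t := fun t ht => add_pos hs ht.1
  have hζ1 : ∀ t, HasDerivAt ζ (1 - 2 * t / Y) t := fun t =>
    ((hasDerivAt_id t).sub ((hasDerivAt_pow 2 t).div_const Y)).congr_deriv (by norm_num)
  have hζ2 : ∀ t, HasDerivAt (fun t : ℝ => 1 - 2 * t / Y) (-2 / Y) t := fun t =>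
    ((((hasDerivAt_id t).const_mul 2).div_const Y).const_sub 1).congr_deriv (by
      field_simp)
  have hζle : ∀ t ∈ Set.Ioc 0 Y, 0 ≤ ζ t ∧ ζ t ≤ t := fun t ht => by
    have h3 : t ^ 2 / Y ≤ t := by
      rw [div_le_iff₀ hY0]; nlinarith [ht.1, ht.2]
    have h4 : 0 ≤ t ^ 2 / Y := by positivity
    simp only [hζ]; constructor <;> linarith
  have hw1 : ∀ j x, ∀ t ∈ Set.Ioc 0 Y, HasDerivAt (fun t => w j x (s + t)) (w1 j x (s + t)) t :=
    fun j x t ht => (h1 j x (s + t) (hpos t ht)).comp_const_add s t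
  have hw2 : ∀ j x, ∀ t ∈ Set.Ioc 0 Y,
      HasDerivAt (fun t => w1 j x (s + t)) (-lap D w j x (s + t)) t :=
    fun j x t ht => (h2 j x (s + t) (hpos t ht)).comp_const_add s t
  have hIoo : ∀ t ∈ Set.Ioo 0 Y, t ∈ Set.Ioc 0 Y := fun t ht => Set.Ioo_subset_Ioc_self ht
  have hcont : ∀ j, ContinuousOn (fun q : Eu n × ℝ => w j q.1 (s + q.2))
      (Set.univ ×ˢ Set.Ioc 0 Y) := fun j => by
    obtain ⟨L, hL⟩ := hx.exists_lipschitz (Set.Ioi 0) (fun y hy => hy) (fun i => by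
      obtain ⟨M, -, hM⟩ := hb i
      exact ⟨M, fun x y hy => hM x y hy⟩) j
    exact continuousOn_prod_of_lipschitz (f := fun x t => w j x (s + t))
      (fun t ht => hL _ (hpos t ht))
      fun x t ht => (hw1 j x t ht).continuousAt.continuousWithinAt
  have hζc : Continuous ζ := continuous_iff_continuousAt.2 fun t => (hζ1 t).continuousAt
  have hwN : ∀ x, ∀ t, 0 ≤ t → w i x (s + t) ^ 2 ≤ N ^ 2 := fun x t ht => by
    have := hN x (s + t) (by linarith)
    exact sq_le_sq' (by linarith [(abs_le.1 this).1]) (abs_le.1 this).2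
  have hpP : ∀ x, ∀ t ∈ Set.Ioc 0 Y, w (D k i) x (s + t) ^ 2 ≤ P ^ 2 := fun x t ht => by
    have := hP x (s + t) (hpos t ht)
    exact sq_le_sq' (by linarith [(abs_le.1 this).1]) (abs_le.1 this).2
  have hFle : ∀ x, ∀ t ∈ Set.Ioc 0 Y, (ζ t * w (D k i) x (s + t)) ^ 2 + 4 * w i x (s + t) ^ 2
      - 4 * N ^ 2 ≤ t ^ 2 * P ^ 2 := fun x t ht => by
    have h3 := hpP x t ht
    have h4 := hwN x t ht.1.le
    have h5 : ζ t ^ 2 ≤ t ^ 2 := by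
      have := hζle t ht
      exact pow_le_pow_left₀ this.1 this.2 2
    have h6 : (ζ t * w (D k i) x (s + t)) ^ 2 ≤ t ^ 2 * P ^ 2 := by
      rw [mul_pow]
      exact mul_le_mul h5 h3 (sq_nonneg _) (sq_nonneg _)
    linarith
  have key := nonpos_of_subsolution_strip (n := n) (b := 0) (Y := Y) (M := Y ^ 2 * P ^ 2)
    (F := fun x t => (ζ t * w (D k i) x (s + t)) ^ 2 + 4 * w i x (s + t) ^ 2 - 4 * N ^ 2)
    (F1 := fun x t => 2 * (ζ t * w (D k i) x (s + t)) *
        ((1 - 2 * t / Y) * w (D k i) x (s + t) + ζ t * w1 (D k i) x (s + t))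
      + 8 * (w i x (s + t) * w1 i x (s + t)))
    (F2 := fun x t => 2 * ((1 - 2 * t / Y) * w (D k i) x (s + t) + ζ t * w1 (D k i) x (s + t)) ^ 2
      + 2 * (ζ t * w (D k i) x (s + t)) * (-2 / Y * w (D k i) x (s + t)
        + 2 * (1 - 2 * t / Y) * w1 (D k i) x (s + t) + ζ t * -lap D w (D k i) x (s + t))
      + 8 * (w1 i x (s + t) * w1 i x (s + t) + w i x (s + t) * -lap D w i x (s + t)))
    (G := fun l x t => 2 * ζ t ^ 2 * (w (D k i) x (s + t) * w (D l (D k i)) x (s + t))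
      + 8 * (w i x (s + t) * w (D l i) x (s + t)))
    (H := fun l x t => 2 * ζ t ^ 2 * (w (D l (D k i)) x (s + t) * w (D l (D k i)) x (s + t)
        + w (D k i) x (s + t) * w (D l (D l (D k i))) x (s + t))
      + 8 * (w (D l i) x (s + t) * w (D l i) x (s + t) + w i x (s + t) * w (D l (D l i)) x (s + t)))
    (by norm_num) ?_ ?_ ?_ ?_ ?_ ?_ ?_ ?_ ?_ x (y0 := h) ⟨hh, by linarith⟩
  · have hζh : ζ h = h / 2 := by simp only [hζ, hY]; field_simp; norm_num
    have h3 : (h / 2 * w (D k i) x (s + h)) ^ 2 ≤ (2 * N) ^ 2 := by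
      have := sq_nonneg (w i x (s + h))
      simp only [hζh] at key
      nlinarith
    have h4 := abs_le_of_sq_le_sq h3 (by positivity)
    rw [abs_mul, abs_of_pos (by positivity : 0 < h / 2)] at h4
    rw [le_div_iff₀ hh]
    linarith
  · intro x t ht
    refine (((((hζ1 t).mul (hw1 (D k i) x t (hIoo t ht))).pow 2).add
      (((hw1 i x t (hIoo t ht)).pow 2).const_mul 4)).sub_const _).congr_deriv ?_
    norm_num
    ring
  · intro x t ht
    have e1 := hw1 (D k i) x t (hIoo t ht)
    have e2 := hw2 (D k i) x t (hIoo t ht)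
    refine ((((((hζ1 t).mul e1).const_mul 2).mul (((hζ2 t).mul e1).add ((hζ1 t).mul e2)))).add
      (((hw1 i x t (hIoo t ht)).mul (hw2 i x t (hIoo t ht))).const_mul 8)).congr_deriv ?_
    simp only [Pi.mul_apply, Pi.add_apply]
    ring
  · intro l x t ht
    have e1 := hx (D k i) l x (s + t) (hpos t (hIoo t ht))
    have e2 := hx i l x (s + t) (hpos t (hIoo t ht))
    refine ((((e1.const_mul (ζ t)).pow 2).add ((e2.pow 2).const_mul 4)).sub_const _).congr_deriv ?_
    norm_num
    ring
  · intro l x t ht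
    have e1 := hx (D k i) l x (s + t) (hpos t (hIoo t ht))
    have e2 := hx i l x (s + t) (hpos t (hIoo t ht))
    have e3 := hx (D l (D k i)) l x (s + t) (hpos t (hIoo t ht))
    have e4 := hx (D l i) l x (s + t) (hpos t (hIoo t ht))
    refine (((e1.mul e3).const_mul (2 * ζ t ^ 2)).add ((e2.mul e4).const_mul 8)).congr_deriv ?_
    simp
  · intro x t ht
    have hsplit : ∑ l, (2 * ζ t ^ 2 * (w (D l (D k i)) x (s + t) * w (D l (D k i)) x (s + t)
        + w (D k i) x (s + t) * w (D l (D l (D k i))) x (s + t))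
      + 8 * (w (D l i) x (s + t) * w (D l i) x (s + t)
        + w i x (s + t) * w (D l (D l i)) x (s + t)))
      = 2 * ζ t ^ 2 * (∑ l, w (D l (D k i)) x (s + t) ^ 2)
        + 2 * ζ t ^ 2 * w (D k i) x (s + t) * lap D w (D k i) x (s + t)
        + 8 * (∑ l, w (D l i) x (s + t) ^ 2) + 8 * w i x (s + t) * lap D w i x (s + t) := by
      simp only [lap, Finset.mul_sum, ← Finset.sum_add_distrib]
      exact Finset.sum_congr rfl fun l _ => by ring
    rw [hsplit]
    have h3 : w (D k i) x (s + t) ^ 2 ≤ ∑ l, w (D l i) x (s + t) ^ 2 :=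
      Finset.single_le_sum (f := fun l => w (D l i) x (s + t) ^ 2) (fun _ _ => sq_nonneg _)
        (Finset.mem_univ k)
    have h4 : 0 ≤ ∑ l, w (D l (D k i)) x (s + t) ^ 2 := Finset.sum_nonneg fun _ _ => sq_nonneg _
    have h5 : (1 - 2 * t / Y) ^ 2 ≤ 1 := by
      have h6 : 2 * t / Y ≤ 2 := by rw [div_le_iff₀ hY0]; linarith [ht.2]
      have h7 : 0 ≤ 2 * t / Y := by have := ht.1; positivity
      nlinarith
    have h6 : 4 * ζ t / Y ≤ 1 := by
      rw [div_le_iff₀ hY0]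
      have : Y * (4 * ζ t) ≤ Y * Y := by
        have e : Y * ζ t = Y * t - t ^ 2 := by simp only [hζ]; field_simp
        nlinarith [sq_nonneg (2 * t - Y)]
      nlinarith
    -- the term `8 S'`, from `4 w²`, absorbs the terms with derivatives of the cut-off; the cross
    -- term is absorbed by completing the square `(2 ζ' p + ζ q)²`
    set p := w (D k i) x (s + t)
    set q := w1 (D k i) x (s + t)
    set S := ∑ l, w (D l (D k i)) x (s + t) ^ 2
    set S' := ∑ l, w (D l i) x (s + t) ^ 2
    set r := 1 - 2 * t / Y
    have h7 := sq_nonneg (2 * (r * p) + ζ t * q)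
    have h8 : r ^ 2 * p ^ 2 ≤ p ^ 2 := mul_le_of_le_one_left (sq_nonneg _) h5
    have h9 : 4 * ζ t / Y * p ^ 2 ≤ p ^ 2 := mul_le_of_le_one_left (sq_nonneg _) h6
    have h10 : 0 ≤ 2 * ζ t ^ 2 * S := by positivity
    have h11 := mul_self_nonneg (w1 i x (s + t))
    have e : 2 * (ζ t * p) * (-2 / Y * p) = -(4 * ζ t / Y * p ^ 2) := by ring
    have e' : 2 * (ζ t * p) * (-2 / Y * p + 2 * r * q + ζ t * -lap D w (D k i) x (s + t))
      = -(4 * ζ t / Y * p ^ 2) + 4 * (r * p) * (ζ t * q)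
        - 2 * ζ t ^ 2 * p * lap D w (D k i) x (s + t) := by
      rw [← e]; ring
    rw [e', zero_div, zero_mul, add_zero]
    linarith [sq_nonneg p]
  · exact ((((hζc.comp continuous_snd).continuousOn.mul (hcont (D k i))).pow 2).add
      (((hcont i).pow 2).const_smul (4 : ℝ))).sub continuousOn_const
  · intro x t ht
    refine (hFle x t ht).trans ?_
    gcongr
    · exact ht.1.le
    · exact ht.2
  · intro x
    have hζY : ζ Y = 0 := by simp only [hζ]; field_simp; ring
    have := hwN x Y hY0.le
    simp only [hζY]
    nlinarith
  · intro R ε hε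
    refine ⟨min Y (ε / (Y * P ^ 2 + 1)), by positivity, fun x _ t ht htη => ?_⟩
    have h3 : t < Y := htη.trans_le (min_le_left _ _)
    have h4 : t < ε / (Y * P ^ 2 + 1) := htη.trans_le (min_le_right _ _)
    refine (hFle x t ⟨ht, h3.le⟩).trans ?_
    rw [lt_div_iff₀ (by positivity)] at h4
    have h5 : t ^ 2 * P ^ 2 ≤ t * (Y * P ^ 2) := by
      have := sq_nonneg P
      have : t * P ^ 2 * t ≤ t * P ^ 2 * Y := by gcongr
      nlinarith
    nlinarith

end Normal

/-! ### Fractional integrals along the half-line -/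

section Abel

theorem integrableOn_one_add_rpow {e : ℝ} (he : e < -1) :
    IntegrableOn (fun s : ℝ => (1 + s) ^ e) (Set.Ioi 0) := by
  simpa only [add_comm] using integrableOn_add_rpow_Ioi_of_lt (m := 1) (c := 0) he (by norm_num)

theorem integrableOn_rpow_mul_one_add_rpow {c e : ℝ} (hc : -1 < c) (he : e ≤ 0) (hce : c + e < -1) :
    IntegrableOn (fun s : ℝ => s ^ c * (1 + s) ^ e) (Set.Ioi 0) := by
  have hm : ∀ S : Set ℝ, MeasurableSet S → S ⊆ Set.Ioi 0 →
      AEStronglyMeasurable (fun s : ℝ => s ^ c * (1 + s) ^ e) (volume.restrict S) := fun S hS hS0 =>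
    ContinuousOn.aestronglyMeasurable (fun s hs => by
      have hs0 : 0 < s := hS0 hs
      refine ContinuousAt.continuousWithinAt ?_
      exact (Real.continuousAt_rpow_const _ _ (Or.inl hs0.ne')).mul
        (ContinuousAt.rpow_const (by fun_prop) (Or.inl (by positivity)))) hS
  rw [← Set.Ioc_union_Ioi_eq_Ioi (zero_le_one : (0 : ℝ) ≤ 1)]
  refine IntegrableOn.union ?_ ?_
  · have h1 : IntegrableOn (fun s : ℝ => s ^ c) (Set.Ioc 0 1) :=
      (intervalIntegrable_iff_integrableOn_Ioc_of_le zero_le_one).1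
        (intervalIntegral.intervalIntegrable_rpow' hc)
    refine Integrable.mono' h1 (hm _ measurableSet_Ioc Set.Ioc_subset_Ioi_self) ?_
    refine (ae_restrict_iff' measurableSet_Ioc).2 (Eventually.of_forall fun s hs => ?_)
    have hs0 := hs.1
    rw [Real.norm_eq_abs, abs_of_nonneg (by positivity)]
    exact mul_le_of_le_one_right (by positivity)
      (Real.rpow_le_one_of_one_le_of_nonpos (by linarith) he)
  · refine Integrable.mono' (integrableOn_Ioi_rpow_of_lt hce zero_lt_one)
      (hm _ measurableSet_Ioi (Set.Ioi_subset_Ioi zero_le_one)) ?_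
    refine (ae_restrict_iff' measurableSet_Ioi).2 (Eventually.of_forall fun s hs => ?_)
    have hs0 : 0 < s := zero_lt_one.trans hs
    rw [Real.norm_eq_abs, abs_of_nonneg (by positivity), Real.rpow_add hs0]
    exact mul_le_mul_of_nonneg_left (Real.rpow_le_rpow_of_nonpos hs0 (by linarith) he)
      (by positivity)

/-- Injectivity of the fractional integral, up to one integration: integrating
`∫ s ^ (c - 1) g (y + 2 τ + 2 s) ds` against `τ ^ (-c) dτ`, the substitution `s = τ θ`
produces a positive multiple of `∫ g (y + 2 r) dr`. -/
theorem integral_eq_zero_of_fractional_integral {c C e : ℝ} (hc : 0 < c) (hc1 : c < 1)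
    (he : e < -1) {g : ℝ → ℝ} (hg : ContinuousOn g (Set.Ioi 0))
    (hC : ∀ t, 0 < t → |g t| ≤ C * (1 + t) ^ e)
    (h : ∀ y, 0 < y → ∫ s in Set.Ioi (0 : ℝ), s ^ (c - 1) * g (y + 2 * s) = 0) {y : ℝ}
    (hy : 0 < y) : ∫ r in Set.Ioi (0 : ℝ), g (y + 2 * r) = 0 := by
  have hint : IntegrableOn (fun r => g (y + 2 * r)) (Set.Ioi 0) := by
    refine Integrable.mono' ((integrableOn_one_add_rpow he).const_mul C) ?_ ?_
    · refine ContinuousOn.aestronglyMeasurable (hg.comp (by fun_prop) fun r hr => ?_)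
        measurableSet_Ioi
      have : 0 < r := hr
      exact (by positivity : 0 < y + 2 * r)
    · refine (ae_restrict_iff' measurableSet_Ioi).2 (Eventually.of_forall fun r hr => ?_)
      have hr0 : 0 < r := hr
      have hC0 : 0 ≤ C := by
        have := (abs_nonneg _).trans (hC 1 one_pos)
        exact nonneg_of_mul_nonneg_left this (by positivity)
      refine (hC _ (by positivity)).trans ?_
      gcongr ?_ * ?_
      exact Real.rpow_le_rpow_of_nonpos (by positivity) (by linarith) (by linarith)
  have hθi : IntegrableOn (fun θ : ℝ => θ ^ (c - 1) * (1 + θ)⁻¹) (Set.Ioi 0) := by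
    simpa only [Real.rpow_neg_one] using
      integrableOn_rpow_mul_one_add_rpow (c := c - 1) (e := -1) (by linarith) (by norm_num)
        (by linarith)
  -- the integral over `τ` for fixed `θ`
  have hτ : ∀ θ, 0 < θ → ∫ τ in Set.Ioi (0 : ℝ), g (y + 2 * ((1 + θ) * τ))
      = (1 + θ)⁻¹ * ∫ r in Set.Ioi (0 : ℝ), g (y + 2 * r) := fun θ hθ => by
    have := integral_comp_mul_left_Ioi (fun r => g (y + 2 * r)) 0 (b := 1 + θ) (by positivity)
    rwa [mul_zero, smul_eq_mul] at this
  have hτn : ∀ θ, 0 < θ → ∫ τ in Set.Ioi (0 : ℝ), |g (y + 2 * ((1 + θ) * τ))|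
      = (1 + θ)⁻¹ * ∫ r in Set.Ioi (0 : ℝ), |g (y + 2 * r)| := fun θ hθ => by
    have := integral_comp_mul_left_Ioi (fun r => |g (y + 2 * r)|) 0 (b := 1 + θ) (by positivity)
    rwa [mul_zero, smul_eq_mul] at this
  have hprod : Integrable (Function.uncurry fun τ θ : ℝ => θ ^ (c - 1) * g (y + 2 * ((1 + θ) * τ)))
      ((volume.restrict (Set.Ioi 0)).prod (volume.restrict (Set.Ioi 0))) := by
    rw [integrable_prod_iff']
    · constructor
      · refine (ae_restrict_iff' measurableSet_Ioi).2 (Eventually.of_forall fun θ hθ => ?_)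
        have hθ0 : 0 < θ := hθ
        have := (integrableOn_Ioi_comp_mul_left_iff (fun r => g (y + 2 * r)) 0
          (a := 1 + θ) (by positivity)).2 (by simpa using hint)
        exact Integrable.const_mul this (θ ^ (c - 1))
      · have h1 : IntegrableOn (fun θ : ℝ => θ ^ (c - 1) * (1 + θ)⁻¹ *
            ∫ r in Set.Ioi (0 : ℝ), |g (y + 2 * r)|) (Set.Ioi 0) := hθi.mul_const _
        refine h1.congr ?_
        refine (ae_restrict_iff' measurableSet_Ioi).2 (Eventually.of_forall fun θ hθ => ?_)
        have hθ0 : 0 < θ := hθ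
        have hθc : 0 ≤ θ ^ (c - 1) := by positivity
        simp only [Function.uncurry, norm_mul, Real.norm_eq_abs, abs_of_nonneg hθc]
        rw [integral_const_mul, hτn θ hθ0]
        ring
    · rw [Measure.prod_restrict]
      refine ContinuousOn.aestronglyMeasurable ?_ (measurableSet_Ioi.prod measurableSet_Ioi)
      refine ContinuousOn.mul (fun q hq => ?_) (hg.comp (by fun_prop) fun q hq => ?_)
      · exact (ContinuousAt.rpow_const (by fun_prop)
          (Or.inl (ne_of_gt hq.2))).continuousWithinAt
      · have h1 : 0 < q.1 := hq.1
        have h2 : 0 < q.2 := hq.2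
        exact (by positivity : 0 < y + 2 * ((1 + q.2) * q.1))
  have hswap := integral_integral_swap hprod
  -- the integral over `θ` for fixed `τ` is a multiple of the fractional integral at `y + 2 τ`
  have hL : ∀ τ, 0 < τ → ∫ θ in Set.Ioi (0 : ℝ), θ ^ (c - 1) * g (y + 2 * ((1 + θ) * τ)) = 0 :=
    fun τ hτ0 => by
      have h1 := integral_comp_mul_left_Ioi
        (fun s => s ^ (c - 1) * g (y + 2 * τ + 2 * s)) 0 (b := τ) hτ0
      rw [mul_zero, h (y + 2 * τ) (by positivity), smul_zero] at h1
      have h2 : ∫ θ in Set.Ioi (0 : ℝ), (τ * θ) ^ (c - 1) * g (y + 2 * τ + 2 * (τ * θ))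
          = τ ^ (c - 1) * ∫ θ in Set.Ioi (0 : ℝ), θ ^ (c - 1) * g (y + 2 * ((1 + θ) * τ)) := by
        rw [← integral_const_mul]
        refine setIntegral_congr_fun measurableSet_Ioi fun θ hθ => ?_
        have hθ0 : 0 < θ := hθ
        have e : y + 2 * ((1 + θ) * τ) = y + 2 * τ + 2 * (τ * θ) := by ring
        rw [Real.mul_rpow hτ0.le hθ0.le, e]
        ring
      rw [h2] at h1
      exact (mul_eq_zero.1 h1).resolve_left (Real.rpow_pos_of_pos hτ0 _).ne'
  rw [setIntegral_congr_fun measurableSet_Ioi (g := fun _ => (0 : ℝ)) fun τ hτ => hL τ hτ,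
    integral_zero] at hswap
  have hR : ∫ θ in Set.Ioi (0 : ℝ), ∫ τ in Set.Ioi (0 : ℝ),
      θ ^ (c - 1) * g (y + 2 * ((1 + θ) * τ)) =
      (∫ θ in Set.Ioi (0 : ℝ), θ ^ (c - 1) * (1 + θ)⁻¹) *
        ∫ r in Set.Ioi (0 : ℝ), g (y + 2 * r) := by
    rw [← integral_mul_const]
    refine setIntegral_congr_fun measurableSet_Ioi fun θ hθ => ?_
    have hθ0 : 0 < θ := hθ
    rw [integral_const_mul, hτ θ hθ0]
    ring
  rw [hR] at hswap
  refine (mul_eq_zero.1 hswap.symm).resolve_left (ne_of_gt ?_)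
  refine (setIntegral_pos_iff_support_of_nonneg_ae ?_ hθi).2 ?_
  · refine (ae_restrict_iff' measurableSet_Ioi).2 (Eventually.of_forall fun θ hθ => ?_)
    have hθ0 : 0 < θ := hθ
    exact (by positivity : 0 ≤ θ ^ (c - 1) * (1 + θ)⁻¹)
  · have : Function.support (fun θ : ℝ => θ ^ (c - 1) * (1 + θ)⁻¹) ∩ Set.Ioi 0 = Set.Ioi 0 := by
      refine Set.inter_eq_right.2 fun θ hθ => ?_
      have hθ0 : 0 < θ := hθ
      exact (by positivity : θ ^ (c - 1) * (1 + θ)⁻¹ ≠ 0)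
    rw [this]
    simp

end Abel

/-! ### Weighted integrals of decaying families -/

section Weighted

variable {n : ℕ} {I : Type*} {D : Fin n → I → I} {b : ℝ}

/-- A family whose members are continuous in `y` and of size `O((1 + y) ^ (-b - 2))`. -/
structure Decays (b : ℝ) (f : I → Eu n → ℝ → ℝ) : Prop where
  cont : ∀ i x, ContinuousOn (f i x) (Set.Ioi 0)
  bound : ∀ i, ∃ C, 0 ≤ C ∧ ∀ x y, 0 < y → |f i x y| ≤ C * (1 + y) ^ (-b - 2)

/-- Kernels `κ y s` that can be integrated in `s` against decaying families, locally uniformly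
in `y`. -/
structure IsKernel (b : ℝ) (κ : ℝ → ℝ → ℝ) : Prop where
  cont : ∀ y, 0 < y → ContinuousOn (κ y) (Set.Ioi 0)
  dom : ∀ y₀, 0 < y₀ → ∃ g, IntegrableOn g (Set.Ioi 0) ∧ ∀ y, y₀ / 2 < y → y < 2 * y₀ →
    ∀ s, 0 < s → |κ y s| * (1 + s) ^ (-b - 2) ≤ g s

/-- The integral `∫ κ(y, s) f(x, y + 2 s) ds` over `0 < s`. -/
def wint (κ : ℝ → ℝ → ℝ) (f : I → Eu n → ℝ → ℝ) (i : I) (x : Eu n) (y : ℝ) : ℝ :=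
  ∫ s in Set.Ioi (0 : ℝ), κ y s * f i x (y + 2 * s)

theorem Decays.bound_shift {f : I → Eu n → ℝ → ℝ} (hb : -2 < b) {C : ℝ} (hC0 : 0 ≤ C) {i : I}
    (hC : ∀ x y, 0 < y → |f i x y| ≤ C * (1 + y) ^ (-b - 2)) (x : Eu n) {y s : ℝ} (hy : 0 < y)
    (hs : 0 < s) : |f i x (y + 2 * s)| ≤ C * (1 + s) ^ (-b - 2) := by
  refine (hC x _ (by positivity)).trans ?_
  gcongr ?_ * ?_
  exact Real.rpow_le_rpow_of_nonpos (by positivity) (by linarith) (by linarith)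

theorem Decays.lap {f : I → Eu n → ℝ → ℝ} (hf : Decays b f) : Decays b (lap D f) where
  cont i x := continuousOn_finsetSum _ fun k _ => hf.cont (D k (D k i)) x
  bound i := by
    choose C hC0 hC using hf.bound
    refine ⟨∑ k, C (D k (D k i)), Finset.sum_nonneg fun k _ => hC0 _, fun x y hy => ?_⟩
    rw [Finset.sum_mul]
    exact (Finset.abs_sum_le_sum_abs _ _).trans (Finset.sum_le_sum fun k _ => hC _ x y hy)

theorem Decays.neg {f : I → Eu n → ℝ → ℝ} (hf : Decays b f) :
    Decays b (fun i x y => -f i x y) where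
  cont i x := (hf.cont i x).neg
  bound i := by simpa only [abs_neg] using hf.bound i

namespace IsKernel

variable {κ κ1 : ℝ → ℝ → ℝ} {f f1 : I → Eu n → ℝ → ℝ}

theorem aestronglyMeasurable (hκ : IsKernel b κ) (hf : Decays b f) (i : I) (x : Eu n) {y : ℝ}
    (hy : 0 < y) : AEStronglyMeasurable (fun s => κ y s * f i x (y + 2 * s))
      (volume.restrict (Set.Ioi 0)) := by
  refine ContinuousOn.aestronglyMeasurable ((hκ.cont y hy).mul
    ((hf.cont i x).comp (by fun_prop) fun s hs => ?_)) measurableSet_Ioi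
  have : 0 < s := hs
  exact (by positivity : 0 < y + 2 * s)

theorem exists_dom (hb : -2 < b) (hκ : IsKernel b κ) (hf : Decays b f) (i : I) {y₀ : ℝ}
    (hy : 0 < y₀) : ∃ g, IntegrableOn g (Set.Ioi 0) ∧ ∀ x y, y₀ / 2 < y → y < 2 * y₀ →
      ∀ s, 0 < s → |κ y s * f i x (y + 2 * s)| ≤ g s := by
  obtain ⟨g, hg, hgb⟩ := hκ.dom y₀ hy
  obtain ⟨C, hC0, hC⟩ := hf.bound i
  refine ⟨fun s => C * g s, hg.const_mul C, fun x y h1 h2 s hs => ?_⟩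
  have h3 := Decays.bound_shift hb hC0 hC x (by linarith : 0 < y) hs
  rw [abs_mul]
  calc |κ y s| * |f i x (y + 2 * s)| ≤ |κ y s| * (C * (1 + s) ^ (-b - 2)) := by gcongr
    _ = C * (|κ y s| * (1 + s) ^ (-b - 2)) := by ring
    _ ≤ C * g s := by gcongr; exact hgb y h1 h2 s hs

theorem integrable (hb : -2 < b) (hκ : IsKernel b κ) (hf : Decays b f) (i : I) (x : Eu n) {y : ℝ}
    (hy : 0 < y) : IntegrableOn (fun s => κ y s * f i x (y + 2 * s)) (Set.Ioi 0) := by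
  obtain ⟨g, hg, hgb⟩ := exists_dom hb hκ hf i hy
  refine Integrable.mono' hg (hκ.aestronglyMeasurable hf i x hy) ?_
  exact (ae_restrict_iff' measurableSet_Ioi).2 (Eventually.of_forall fun s hs =>
    hgb x y (by linarith) (by linarith) s hs)

theorem hasDerivAt_wint (hb : -2 < b) (hκ : IsKernel b κ) (hκ1 : IsKernel b κ1)
    (hf : Decays b f) (hf1 : Decays b f1)
    (hκd : ∀ s, 0 < s → ∀ y, 0 < y → HasDerivAt (fun y => κ y s) (κ1 y s) y)
    (hfd : ∀ i x y, 0 < y → HasDerivAt (f i x) (f1 i x y) y) (i : I) (x : Eu n) {y : ℝ}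
    (hy : 0 < y) : HasDerivAt (wint κ f i x) (wint κ1 f i x y + wint κ f1 i x y) y := by
  obtain ⟨g, hg, hgb⟩ := exists_dom hb hκ1 hf i hy
  obtain ⟨g', hg', hgb'⟩ := exists_dom hb hκ hf1 i hy
  have := (hasDerivAt_integral_of_dominated_loc_of_deriv_le (μ := volume.restrict (Set.Ioi 0))
    (F := fun y s => κ y s * f i x (y + 2 * s))
    (F' := fun y s => κ1 y s * f i x (y + 2 * s) + κ y s * f1 i x (y + 2 * s))
    (bound := fun s => g s + g' s) (x₀ := y) (s := Set.Ioo (y / 2) (2 * y))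
    (Ioo_mem_nhds (by linarith) (by linarith)) ?_ (hκ.integrable hb hf i x hy) ?_ ?_ (hg.add hg')
    ?_).2
  · have e := integral_add (hκ1.integrable hb hf i x hy) (hκ.integrable hb hf1 i x hy)
    rw [e] at this
    exact this
  · filter_upwards [lt_mem_nhds hy] with t ht using hκ.aestronglyMeasurable hf i x ht
  · exact (hκ1.aestronglyMeasurable hf i x hy).add (hκ.aestronglyMeasurable hf1 i x hy)
  · refine (ae_restrict_iff' measurableSet_Ioi).2 (Eventually.of_forall fun s hs t ht => ?_)
    exact (abs_add_le _ _).trans (add_le_add (hgb x t ht.1 ht.2 s hs) (hgb' x t ht.1 ht.2 s hs))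
  · refine (ae_restrict_iff' measurableSet_Ioi).2 (Eventually.of_forall fun s hs t ht => ?_)
    have hs0 : 0 < s := hs
    have ht0 : 0 < t := by linarith [ht.1]
    exact (hκd s hs0 t ht0).mul ((hfd i x (t + 2 * s) (by positivity)).comp_add_const t (2 * s))

theorem xDiff_wint (hb : -2 < b) (hκ : IsKernel b κ) (hf : Decays b f) (hx : XDiff D f) :
    XDiff D (wint κ f) := fun i k x y hy => by
  obtain ⟨g, hg, hgb⟩ := exists_dom hb hκ hf (D k i) hy
  have := (hasDerivAt_integral_of_dominated_loc_of_deriv_le (μ := volume.restrict (Set.Ioi 0))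
    (F := fun r s => κ y s * f i (x + r • basisVec k) (y + 2 * s))
    (F' := fun r s => κ y s * f (D k i) (x + r • basisVec k) (y + 2 * s))
    (bound := g) (x₀ := (0 : ℝ)) (s := Set.univ)
    univ_mem ?_ (hκ.integrable hb hf i (x + (0 : ℝ) • basisVec k) hy) ?_ ?_ hg ?_).2
  · simp only [zero_smul, add_zero] at this
    exact this
  · exact Eventually.of_forall fun r => hκ.aestronglyMeasurable hf i _ hy
  · exact hκ.aestronglyMeasurable hf _ _ hy
  · refine (ae_restrict_iff' measurableSet_Ioi).2 (Eventually.of_forall fun s hs r _ => ?_)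
    exact hgb _ y (by linarith) (by linarith) s hs
  · refine (ae_restrict_iff' measurableSet_Ioi).2 (Eventually.of_forall fun s hs r _ => ?_)
    have hs0 : 0 < s := hs
    exact (hx.hasDerivAt i k x (by positivity : 0 < y + 2 * s) r).const_mul _

theorem wint_lap (hb : -2 < b) (hκ : IsKernel b κ) (hf : Decays b f) (i : I) (x : Eu n) {y : ℝ}
    (hy : 0 < y) : wint κ (lap D f) i x y = lap D (wint κ f) i x y := by
  simp only [wint, lap, Finset.mul_sum]
  exact integral_finsetSum _ fun k _ => hκ.integrable hb hf (D k (D k i)) x hy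

/-- The kernel `s ^ c`. -/
theorem rpow {c : ℝ} (hc : -1 < c) (hcb : c < b + 1) :
    IsKernel b fun _ s => s ^ c where
  cont y _ s hs := (Real.continuousAt_rpow_const _ _ (Or.inl (ne_of_gt hs))).continuousWithinAt
  dom y₀ _ := ⟨_, integrableOn_rpow_mul_one_add_rpow (c := c) (e := -b - 2) hc (by linarith)
    (by linarith), fun y _ _ s hs => by rw [abs_of_nonneg (Real.rpow_nonneg hs.le _)]⟩

/-- The kernel `(y + s) ^ c`. -/
theorem add_rpow {c : ℝ} (hb : 0 ≤ b) (hcb : c ≤ b) : IsKernel b fun y s => (y + s) ^ c where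
  cont y hy s hs := by
    have hs0 : 0 < s := hs
    exact (ContinuousAt.rpow_const (by fun_prop) (Or.inl (by positivity))).continuousWithinAt
  dom y₀ hy₀ := by
    refine ⟨fun s => ((2 * y₀ + 1) ^ c + (y₀ / 2) ^ c) * (1 + s) ^ (-2 : ℝ),
      (integrableOn_one_add_rpow (by norm_num)).const_mul _, fun y h1 h2 s hs => ?_⟩
    have hy : 0 < y := by linarith
    have h3 : (y + s) ^ c ≤ ((2 * y₀ + 1) ^ c + (y₀ / 2) ^ c) * (1 + s) ^ b := by
      have hs1 : 1 ≤ (1 + s) ^ b := Real.one_le_rpow (by linarith) hb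
      have p1 : 0 ≤ (2 * y₀ + 1) ^ c := by positivity
      have p2 : 0 ≤ (y₀ / 2) ^ c := by positivity
      rcases le_total 0 c with hc | hc
      · have h4 : (y + s) ^ c ≤ ((2 * y₀ + 1) * (1 + s)) ^ c := by
          refine Real.rpow_le_rpow (by positivity) ?_ hc
          nlinarith [mul_pos hy₀ hs]
        rw [Real.mul_rpow (by positivity) (by positivity)] at h4
        have h5 : (1 + s) ^ c ≤ (1 + s) ^ b :=
          Real.rpow_le_rpow_of_exponent_le (by linarith) hcb
        calc (y + s) ^ c ≤ (2 * y₀ + 1) ^ c * (1 + s) ^ c := h4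
          _ ≤ (2 * y₀ + 1) ^ c * (1 + s) ^ b := by gcongr
          _ ≤ _ := by gcongr; linarith
      · have h4 : (y + s) ^ c ≤ (y₀ / 2) ^ c :=
          Real.rpow_le_rpow_of_nonpos (by positivity) (by linarith) hc
        nlinarith
    rw [abs_of_nonneg (by positivity)]
    calc (y + s) ^ c * (1 + s) ^ (-b - 2)
        ≤ ((2 * y₀ + 1) ^ c + (y₀ / 2) ^ c) * (1 + s) ^ b * (1 + s) ^ (-b - 2) := by gcongr
      _ = _ := by
        rw [mul_assoc, ← Real.rpow_add (by positivity)]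
        congr 2; ring

theorem const_mul (hκ : IsKernel b κ) (c : ℝ) : IsKernel b fun y s => c * κ y s where
  cont y hy := (hκ.cont y hy).const_smul c
  dom y₀ hy₀ := by
    obtain ⟨g, hg, hgb⟩ := hκ.dom y₀ hy₀
    refine ⟨fun s => |c| * g s, hg.const_mul _, fun y h1 h2 s hs => ?_⟩
    rw [abs_mul, mul_assoc]
    exact mul_le_mul_of_nonneg_left (hgb y h1 h2 s hs) (abs_nonneg _)

end IsKernel

end Weighted

/-! ### Vanishing of the normal components for negative weights -/

section Normal

variable {n : ℕ} {I : Type*} {D : Fin n → I → I} {a : ℝ}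

/-- The vanishing of a fractional integral of harmonic families forces their vanishing. -/
theorem eq_zero_of_wint_eq_zero {b : ℝ} (hb : 0 < b) (hb1 : b < 1) {z z1 : I → Eu n → ℝ → ℝ}
    (hd : ∀ i x y, 0 < y → HasDerivAt (z i x) (z1 i x y) y) (hz : Decays b z)
    (hz1 : Decays b z1) (h : ∀ i x y, 0 < y → wint (fun _ s => s ^ (b - 1)) z i x y = 0)
    (i : I) (x : Eu n) {y : ℝ} (hy : 0 < y) : z i x y = 0 := by
  have hK : IsKernel b fun _ s => s ^ (b - 1) := IsKernel.rpow (by linarith) (by linarith)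
  have h0 : IsKernel b fun _ _ => 0 := ⟨fun _ _ => continuousOn_const, fun _ _ =>
    ⟨fun _ => 0, integrableOn_zero, fun _ _ _ _ _ => by simp⟩⟩
  -- the same holds for the derivative
  have h1 : ∀ y, 0 < y → ∫ s in Set.Ioi (0 : ℝ), s ^ (b - 1) * z1 i x (y + 2 * s) = 0 :=
    fun y hy => by
      have e1 := IsKernel.hasDerivAt_wint (by linarith) hK h0 hz hz1
        (fun s _ y _ => hasDerivAt_const y _) hd i x hy
      have e2 : HasDerivAt (wint (fun _ s => s ^ (b - 1)) z i x) 0 y := by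
        refine (hasDerivAt_const y (0 : ℝ)).congr_of_eventuallyEq ?_
        filter_upwards [lt_mem_nhds hy] with t ht using h i x t ht
      have e3 := e1.unique e2
      simpa [wint] using e3
  obtain ⟨C, hC0, hC⟩ := hz1.bound i
  obtain ⟨C', hC0', hC'⟩ := hz.bound i
  have h2 := integral_eq_zero_of_fractional_integral hb hb1 (by linarith : -b - 2 < -1)
    (hz1.cont i x) (hC x) h1 hy
  have hpos : ∀ s, 0 ≤ s → 0 < y + 2 * s := fun s hs => by positivity
  have hder : ∀ s, 0 ≤ s → HasDerivAt (fun s => z i x (y + 2 * s)) (z1 i x (y + 2 * s) * 2) s :=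
    fun s hs => by
      exact ((hd i x _ (hpos s hs)).comp s
        (((hasDerivAt_id s).const_mul 2).const_add y)).congr_deriv (by simp)
  have hconst : IsKernel b fun _ s => s ^ (0 : ℝ) :=
    IsKernel.rpow (by norm_num) (by linarith)
  have h3 := integral_Ioi_of_hasDerivAt_of_tendsto (f := fun s => z i x (y + 2 * s)) (m := 0)
    (hder 0 le_rfl).continuousAt.continuousWithinAt (fun s hs => hder s (le_of_lt hs))
    (by
      have := hconst.integrable (by linarith) hz1 i x hy
      simp only [Real.rpow_zero, one_mul] at this
      exact Integrable.mul_const this 2) ?_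
  · rw [integral_mul_const, h2] at h3
    simp only [mul_zero, add_zero] at h3
    linarith
  · have h4 : Tendsto (fun s : ℝ => C' * (1 + s) ^ (-b - 2)) atTop (𝓝 0) := by
      have e := (tendsto_rpow_neg_atTop (by linarith : 0 < b + 2)).comp
        (tendsto_atTop_add_const_left _ (1 : ℝ) tendsto_id)
      have e' := e.const_mul C'
      rw [mul_zero] at e'
      refine e'.congr fun s => ?_
      simp only [Function.comp, id]
      congr 2; ring
    refine squeeze_zero_norm' ?_ h4
    filter_upwards [Ioi_mem_atTop 0] with s hs
    exact Decays.bound_shift (by linarith) hC0' hC' x hy hs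

/-- Decay is inherited by the `y`-derivative of a harmonic family. -/
theorem Decays.deriv_of_harmonic {b : ℝ} (hb : 0 < b) {z z1 : I → Eu n → ℝ → ℝ} (hz : Decays b z)
    (h1 : ∀ i x y, 0 < y → HasDerivAt (z i x) (z1 i x y) y)
    (h2 : ∀ i x y, 0 < y → HasDerivAt (z1 i x) (-CSForms.lap D z i x y) y) : Decays b z1 where
  cont i x y hy := (h2 i x y hy).continuousAt.continuousWithinAt
  bound i := by
    obtain ⟨A, hA0, hA⟩ := hz.bound i
    obtain ⟨B, hB0, hB⟩ := (hz.lap (D := D)).bound i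
    refine ⟨2 * A + B, by positivity, fun x y hy => ?_⟩
    have hpos : ∀ t ∈ Set.Icc y (y + 1), 0 < t := fun t ht => hy.trans_le ht.1
    have hmono : ∀ t ∈ Set.Icc y (y + 1), (1 + t) ^ (-b - 2) ≤ (1 + y) ^ (-b - 2) := fun t ht =>
      Real.rpow_le_rpow_of_nonpos (by positivity) (by linarith [ht.1]) (by linarith)
    have := abs_deriv_le_of_bounds (f := z i x) (f1 := z1 i x) (h := fun _ => 0) (y := y)
      (g := fun t => -CSForms.lap D z i x t) (M := A * (1 + y) ^ (-b - 2)) (N := 0)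
      (K := B * (1 + y) ^ (-b - 2))
      (fun t ht => h1 i x t (hpos t ht)) (fun t ht => by simpa using h2 i x t (hpos t ht))
      (fun t ht => (hA x t (hpos t ht)).trans (by have := hmono t ht; gcongr)) (by simp)
      (fun t ht => by
        rw [abs_neg]
        exact (hB x t (hpos t ht)).trans (by have := hmono t ht; gcongr))
    linarith

/-- If `u'' + Δ u = -b y ^ (b - 1) z` with `z` harmonic, and `u` and `u'` vanish on the boundary,
then `z = 0`: by uniqueness `u = ∫ ((y + s) ^ b - s ^ b) z(y + 2 s) ds`, and the boundary value
of `u'` is a fractional integral of `z`. -/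
theorem eq_zero_of_overdetermined {b : ℝ} (hb : 0 < b) (hb1 : b < 1)
    {u u1 z z1 : I → Eu n → ℝ → ℝ} (hxu : XDiff D u)
    (hu1 : ∀ i x y, 0 < y → HasDerivAt (u i x) (u1 i x y) y)
    (hu2 : ∀ i x y, 0 < y → HasDerivAt (u1 i x) (-b * y ^ (b - 1) * z i x y - lap D u i x y) y)
    (hu : Bdd u) (hu0 : ∀ i x, Tendsto (u i x) (𝓝[>] 0) (𝓝 0))
    (hu10 : ∀ i x, Tendsto (u1 i x) (𝓝[>] 0) (𝓝 0)) (hxz : XDiff D z)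
    (hz1 : ∀ i x y, 0 < y → HasDerivAt (z i x) (z1 i x y) y)
    (hz2 : ∀ i x y, 0 < y → HasDerivAt (z1 i x) (-lap D z i x y) y) (hz : Decays b z)
    (i : I) (x : Eu n) {y : ℝ} (hy : 0 < y) : z i x y = 0 := by
  have hb2 : -2 < b := by linarith
  have hzd : Decays b z1 := hz.deriv_of_harmonic hb hz1 hz2
  have hzl : Decays b (fun i x y => -lap D z i x y) := hz.lap.neg
  have kA : IsKernel b fun y s => (y + s) ^ b := IsKernel.add_rpow hb.le le_rfl
  have kA' : IsKernel b fun y s => (y + s) ^ (b - 1) := IsKernel.add_rpow hb.le (by linarith)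
  have kA1 : IsKernel b fun y s => b * (y + s) ^ (b - 1) := kA'.const_mul b
  have kA2 : IsKernel b fun y s => b * ((b - 1) * (y + s) ^ (b - 2)) :=
    ((IsKernel.add_rpow hb.le (by linarith)).const_mul (b - 1)).const_mul b
  have kB : IsKernel b fun _ s => s ^ b := IsKernel.rpow (by linarith) (by linarith)
  have kX : IsKernel b fun _ s => s ^ (b - 1) := IsKernel.rpow (by linarith) (by linarith)
  have k0 : IsKernel b fun _ _ => 0 := ⟨fun _ _ => continuousOn_const, fun _ _ =>
    ⟨fun _ => 0, integrableOn_zero, fun _ _ _ _ _ => by simp⟩⟩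
  have dA : ∀ s, 0 < s → ∀ y, 0 < y →
      HasDerivAt (fun y => (y + s) ^ b) (b * (y + s) ^ (b - 1)) y := fun s hs y hy => by
    have hys : y + s ≠ 0 := by positivity
    refine (((hasDerivAt_id y).add_const s).rpow_const (p := b) (Or.inl hys)).congr_deriv ?_
    simp
  have dA1 : ∀ s, 0 < s → ∀ y, 0 < y → HasDerivAt (fun y => b * (y + s) ^ (b - 1))
      (b * ((b - 1) * (y + s) ^ (b - 2))) y := fun s hs y hy => by
    have hys : y + s ≠ 0 := by positivity
    refine ((((hasDerivAt_id y).add_const s).rpow_const (p := b - 1)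
      (Or.inl hys)).const_mul b).congr_deriv ?_
    have : b - 1 - 1 = b - 2 := by ring
    simp [this]
  have d0 : ∀ κ : ℝ → ℝ, ∀ s, 0 < s → ∀ y, 0 < y → HasDerivAt (fun _ : ℝ => κ s) 0 y :=
    fun κ s _ y _ => hasDerivAt_const y _
  have w0 : ∀ (f : I → Eu n → ℝ → ℝ) i x y, wint (fun _ _ => 0) f i x y = 0 := fun f i x y => by
    simp [wint]
  -- the derivatives of the two parts of the integral
  set A := wint (fun y s => (y + s) ^ b) z with hA
  set B := wint (fun _ s => s ^ b) z with hB
  set A1 : I → Eu n → ℝ → ℝ := fun i x y => wint (fun y s => b * (y + s) ^ (b - 1)) z i x y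
    + wint (fun y s => (y + s) ^ b) z1 i x y with hA1
  set B1 := wint (fun _ s => s ^ b) z1 with hB1
  have eA : ∀ i x y, 0 < y → HasDerivAt (A i x) (A1 i x y) y := fun i x y hy =>
    IsKernel.hasDerivAt_wint hb2 kA kA1 hz hzd dA hz1 i x hy
  have eB : ∀ i x y, 0 < y → HasDerivAt (B i x) (B1 i x y) y := fun i x y hy => by
    have := IsKernel.hasDerivAt_wint hb2 kB k0 hz hzd (d0 _) hz1 i x hy
    rwa [w0, zero_add] at this
  have eB1 : ∀ i x y, 0 < y → HasDerivAt (B1 i x) (-lap D B i x y) y := fun i x y hy => by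
    have := IsKernel.hasDerivAt_wint hb2 kB k0 hzd hzl (d0 _) hz2 i x hy
    rw [w0, zero_add] at this
    refine this.congr_deriv ?_
    rw [hB, ← IsKernel.wint_lap hb2 kB hz i x hy]
    simp only [wint, mul_neg, integral_neg]
  have eA1 : ∀ i x y, 0 < y →
      HasDerivAt (A1 i x) (-b * y ^ (b - 1) * z i x y - lap D A i x y) y := fun i x y hy => by
    refine ((IsKernel.hasDerivAt_wint hb2 kA1 kA2 hz hzd dA1 hz1 i x hy).add
      (IsKernel.hasDerivAt_wint hb2 kA kA1 hzd hzl dA hz2 i x hy)).congr_deriv ?_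
    have e1 : wint (fun y s => (y + s) ^ b) (fun i x y => -lap D z i x y) i x y
        = -lap D A i x y := by
      rw [hA, ← IsKernel.wint_lap hb2 kA hz i x hy]
      simp only [wint, mul_neg, integral_neg]
    -- the remaining terms are the integral of a derivative in `s`
    have e2 : wint (fun y s => b * ((b - 1) * (y + s) ^ (b - 2))) z i x y
        + (wint (fun y s => b * (y + s) ^ (b - 1)) z1 i x y
          + wint (fun y s => b * (y + s) ^ (b - 1)) z1 i x y) = -b * y ^ (b - 1) * z i x y := by
      have i1 := kA2.integrable hb2 hz i x hy
      have i2 := kA1.integrable hb2 hzd i x hy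
      have hd : ∀ s, 0 ≤ s → HasDerivAt (fun s => b * (y + s) ^ (b - 1) * z i x (y + 2 * s))
          (b * ((b - 1) * (y + s) ^ (b - 2)) * z i x (y + 2 * s)
            + (b * (y + s) ^ (b - 1) * z1 i x (y + 2 * s)
              + b * (y + s) ^ (b - 1) * z1 i x (y + 2 * s))) s := fun s hs => by
        have hys : y + s ≠ 0 := by positivity
        have p1 := (((hasDerivAt_id s).const_add y).rpow_const (p := b - 1)
          (Or.inl hys)).const_mul b
        have p2 := (hz1 i x (y + 2 * s) (by positivity)).comp s
          (((hasDerivAt_id s).const_mul 2).const_add y)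
        refine (p1.mul p2).congr_deriv ?_
        have : b - 1 - 1 = b - 2 := by ring
        simp only [id, Function.comp, this]
        ring
      have h3 := integral_Ioi_of_hasDerivAt_of_tendsto (m := 0)
        (hd 0 le_rfl).continuousAt.continuousWithinAt (fun s hs => hd s (le_of_lt hs))
        (i1.add (i2.add i2)) ?_
      · have h4 := integral_add i1 (i2.add i2)
        have h5 := integral_add i2 i2
        have h6 : ∫ s in Set.Ioi (0 : ℝ), (b * ((b - 1) * (y + s) ^ (b - 2)) * z i x (y + 2 * s)
            + (b * (y + s) ^ (b - 1) * z1 i x (y + 2 * s)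
              + b * (y + s) ^ (b - 1) * z1 i x (y + 2 * s))) = _ := h4
        rw [h6] at h3
        simp only [Pi.add_apply] at h3
        rw [h5] at h3
        simp only [wint]
        rw [h3]
        simp
      · obtain ⟨C, hC0, hC⟩ := hz.bound i
        have h4 : Tendsto (fun s : ℝ => b * y ^ (b - 1) * C * (1 + s) ^ (-b - 2)) atTop (𝓝 0) := by
          have e := (tendsto_rpow_neg_atTop (by linarith : 0 < b + 2)).comp
            (tendsto_atTop_add_const_left _ (1 : ℝ) tendsto_id)
          have e' := e.const_mul (b * y ^ (b - 1) * C)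
          rw [mul_zero] at e'
          refine e'.congr fun s => ?_
          simp only [Function.comp, id]
          congr 2; ring
        refine squeeze_zero_norm' ?_ h4
        filter_upwards [Ioi_mem_atTop 0] with s hs
        have hs0 : 0 < s := hs
        rw [norm_mul, Real.norm_eq_abs, Real.norm_eq_abs, abs_of_nonneg (by positivity)]
        have p1 := Decays.bound_shift hb2 hC0 hC x hy hs
        have p2 : (y + s) ^ (b - 1) ≤ y ^ (b - 1) :=
          Real.rpow_le_rpow_of_nonpos hy (by linarith) (by linarith)
        calc b * (y + s) ^ (b - 1) * |z i x (y + 2 * s)|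
            ≤ b * y ^ (b - 1) * (C * (1 + s) ^ (-b - 2)) := by gcongr
          _ = _ := by ring
    rw [e1, ← e2]
    ring
  -- the integral is of size `y ^ b`
  have hm : IntegrableOn (fun s : ℝ => (1 + s) ^ (-b - 2)) (Set.Ioi 0) :=
    integrableOn_one_add_rpow (by linarith)
  have hdiff : ∀ f : I → Eu n → ℝ → ℝ, Decays b f → ∀ i, ∃ M, ∀ x y, 0 < y →
      |wint (fun y s => (y + s) ^ b) f i x y - wint (fun _ s => s ^ b) f i x y| ≤ M * y ^ b :=
    fun f hf i => by
    obtain ⟨C, hC0, hC⟩ := hf.bound i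
    refine ⟨C * ∫ s in Set.Ioi (0 : ℝ), (1 + s) ^ (-b - 2), fun x y hy => ?_⟩
    have e := integral_sub (kA.integrable hb2 hf i x hy) (kB.integrable hb2 hf i x hy)
    have : ‖∫ s in Set.Ioi (0 : ℝ), ((y + s) ^ b * f i x (y + 2 * s) - s ^ b * f i x (y + 2 * s))‖
        ≤ ∫ s in Set.Ioi (0 : ℝ), y ^ b * C * (1 + s) ^ (-b - 2) := by
      refine norm_integral_le_of_norm_le (hm.const_mul _) ?_
      refine (ae_restrict_iff' measurableSet_Ioi).2 (Eventually.of_forall fun s hs => ?_)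
      have hs0 : 0 < s := hs
      have p1 := Decays.bound_shift hb2 hC0 hC x hy hs
      have p2 := Real.rpow_add_le_add_rpow hy.le hs0.le hb.le hb1.le
      have p3 : s ^ b ≤ (y + s) ^ b := Real.rpow_le_rpow hs0.le (by linarith) hb.le
      rw [← sub_mul, norm_mul, Real.norm_eq_abs, Real.norm_eq_abs, abs_of_nonneg (by linarith)]
      calc ((y + s) ^ b - s ^ b) * |f i x (y + 2 * s)|
          ≤ y ^ b * (C * (1 + s) ^ (-b - 2)) := by
            have : 0 ≤ (y + s) ^ b - s ^ b := by linarith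
            gcongr
            linarith
        _ = _ := by ring
    rw [integral_const_mul, e, Real.norm_eq_abs] at this
    refine this.trans (le_of_eq ?_)
    ring
  have hyb : Tendsto (fun y : ℝ => y ^ b) (𝓝[>] 0) (𝓝 0) := by
    have := (Real.continuousAt_rpow_const 0 b (Or.inr hb.le)).tendsto
    rw [Real.zero_rpow hb.ne'] at this
    exact this.mono_left nhdsWithin_le_nhds
  have hdiff0 : ∀ f : I → Eu n → ℝ → ℝ, Decays b f → ∀ i x, Tendsto (fun y =>
      wint (fun y s => (y + s) ^ b) f i x y - wint (fun _ s => s ^ b) f i x y) (𝓝[>] 0) (𝓝 0) :=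
    fun f hf i x => by
    obtain ⟨M, hM⟩ := hdiff f hf i
    refine squeeze_zero_norm' ?_ (by simpa using hyb.const_mul M)
    filter_upwards [self_mem_nhdsWithin] with y hy using hM x y hy
  -- uniqueness identifies `u` with the integral
  have huN : ∀ i x y, 0 < y → u i x y = A i x y - B i x y := by
    have key := eq_zero_of_harmonic (D := D) (c := b) hb.le hb1
      (F := fun i x y => u i x y - (A i x y - B i x y))
      (F1 := fun i x y => u1 i x y - (A1 i x y - B1 i x y)) ?_ ?_ ?_ ?_ ?_
    · intro i x y hy
      have := key i x hy
      linarith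
    · exact fun i k x y hy => (hxu i k x y hy).sub
        ((IsKernel.xDiff_wint hb2 kA hz hxz i k x y hy).sub
          (IsKernel.xDiff_wint hb2 kB hz hxz i k x y hy))
    · exact fun i x y hy => (hu1 i x y hy).sub ((eA i x y hy).sub (eB i x y hy))
    · intro i x y hy
      refine ((hu2 i x y hy).sub ((eA1 i x y hy).sub (eB1 i x y hy))).congr_deriv ?_
      simp only [lap, Finset.sum_sub_distrib]
      ring
    · intro i
      obtain ⟨M, hM⟩ := hdiff z hz i
      obtain ⟨N, hN0, hN⟩ := hu i
      refine ⟨N + |M|, fun x y hy => ?_⟩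
      have p1 : (1 : ℝ) ≤ (1 + y) ^ b := Real.one_le_rpow (by linarith) hb.le
      have p2 : y ^ b ≤ (1 + y) ^ b := by gcongr; linarith
      have p3 := hM x y hy
      have p4 := hN x y hy
      have p5 : M * y ^ b ≤ |M| * (1 + y) ^ b :=
        mul_le_mul (le_abs_self _) p2 (by positivity) (abs_nonneg _)
      have p6 : N ≤ N * (1 + y) ^ b := le_mul_of_one_le_right hN0 p1
      refine (abs_sub _ _).trans ?_
      rw [add_mul]
      linarith
    · intro i x
      simpa using (hu0 i x).sub (hdiff0 z hz i x)
  -- the boundary value of `u'`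
  have hlim : ∀ i x, Tendsto (wint (fun y s => (y + s) ^ (b - 1)) z i x) (𝓝[>] 0) (𝓝 0) :=
    fun i x => by
    have e : ∀ y, 0 < y → u1 i x y - (wint (fun y s => (y + s) ^ b) z1 i x y
        - wint (fun _ s => s ^ b) z1 i x y) = b * wint (fun y s => (y + s) ^ (b - 1)) z i x y :=
      fun y hy => by
      have p1 : HasDerivAt (u i x) (A1 i x y - B1 i x y) y := by
        refine ((eA i x y hy).sub (eB i x y hy)).congr_of_eventuallyEq ?_
        filter_upwards [lt_mem_nhds hy] with t ht using huN i x t ht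
      rw [(hu1 i x y hy).unique p1]
      have p2 : wint (fun y s => b * (y + s) ^ (b - 1)) z i x y
          = b * wint (fun y s => (y + s) ^ (b - 1)) z i x y := by
        simp only [wint, mul_assoc]
        exact integral_const_mul _ _
      simp only [hA1, hB1, p2]
      ring
    have p1 := ((hu10 i x).sub (hdiff0 z1 hzd i x)).const_mul b⁻¹
    simp only [sub_zero, mul_zero] at p1
    refine p1.congr' ?_
    filter_upwards [self_mem_nhdsWithin] with y hy
    rw [e y hy]
    field_simp
  -- hence the boundary value of the fractional integral
  have hX0 : ∀ i x, Tendsto (wint (fun _ s => s ^ (b - 1)) z i x) (𝓝[>] 0) (𝓝 0) := fun i x => by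
    obtain ⟨C, hC0, hC⟩ := hz.bound i
    have hbound : IntegrableOn (fun s : ℝ => s ^ (b - 1) * (1 + s) ^ (-b - 2) * C) (Set.Ioi 0) :=
      (integrableOn_rpow_mul_one_add_rpow (by linarith) (by linarith) (by linarith)).mul_const C
    have p1 : Tendsto (fun y => ∫ s in Set.Ioi (0 : ℝ),
        (s ^ (b - 1) - (y + s) ^ (b - 1)) * z i x (y + 2 * s)) (𝓝[>] 0) (𝓝 (∫ _ in Set.Ioi (0 : ℝ),
          (0 : ℝ))) := by
      refine tendsto_integral_filter_of_dominated_convergence _ ?_ ?_ hbound ?_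
      · filter_upwards [self_mem_nhdsWithin] with y hy
        have := (kX.aestronglyMeasurable hz i x hy).sub (kA'.aestronglyMeasurable hz i x hy)
        refine this.congr (Eventually.of_forall fun s => ?_)
        simp only [Pi.sub_apply]
        ring
      · filter_upwards [self_mem_nhdsWithin] with y hy
        refine (ae_restrict_iff' measurableSet_Ioi).2 (Eventually.of_forall fun s hs => ?_)
        have hs0 : 0 < s := hs
        have hy0 : 0 < y := hy
        have q1 := Decays.bound_shift hb2 hC0 hC x hy0 hs0
        have q2 : (y + s) ^ (b - 1) ≤ s ^ (b - 1) :=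
          Real.rpow_le_rpow_of_nonpos hs0 (by linarith) (by linarith)
        have q3 : 0 ≤ (y + s) ^ (b - 1) := by positivity
        rw [norm_mul, Real.norm_eq_abs, Real.norm_eq_abs, abs_of_nonneg (by linarith)]
        calc (s ^ (b - 1) - (y + s) ^ (b - 1)) * |z i x (y + 2 * s)|
            ≤ s ^ (b - 1) * (C * (1 + s) ^ (-b - 2)) := by
              have : 0 ≤ s ^ (b - 1) - (y + s) ^ (b - 1) := by linarith
              gcongr
              linarith
          _ = _ := by ring
      · refine (ae_restrict_iff' measurableSet_Ioi).2 (Eventually.of_forall fun s hs => ?_)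
        have hs0 : 0 < s := hs
        have q1 : Tendsto (fun y : ℝ => s ^ (b - 1) - (y + s) ^ (b - 1)) (𝓝[>] 0) (𝓝 0) := by
          have : ContinuousAt (fun y : ℝ => s ^ (b - 1) - (y + s) ^ (b - 1)) 0 :=
            continuousAt_const.sub (ContinuousAt.rpow_const (by fun_prop)
              (Or.inl (by simpa using hs0.ne')))
          have q := this.tendsto
          simp only [zero_add, sub_self] at q
          exact q.mono_left nhdsWithin_le_nhds
        refine squeeze_zero_norm' (a := fun y => |s ^ (b - 1) - (y + s) ^ (b - 1)| *
          (C * (1 + s) ^ (-b - 2))) ?_ ?_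
        · filter_upwards [self_mem_nhdsWithin] with y hy
          rw [norm_mul, Real.norm_eq_abs, Real.norm_eq_abs]
          exact mul_le_mul_of_nonneg_left (Decays.bound_shift hb2 hC0 hC x hy hs0) (abs_nonneg _)
        · simpa using q1.abs.mul_const (C * (1 + s) ^ (-b - 2))
    rw [integral_zero] at p1
    have p2 := p1.add (hlim i x)
    rw [add_zero] at p2
    refine p2.congr' ?_
    filter_upwards [self_mem_nhdsWithin] with y hy
    have e := integral_sub (kX.integrable hb2 hz i x hy) (kA'.integrable hb2 hz i x hy)
    simp only [← sub_mul] at e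
    simp only [wint]
    rw [e]
    ring
  refine eq_zero_of_wint_eq_zero hb hb1 hz1 hz hzd (fun i x y hy => ?_) i x hy
  refine eq_zero_of_harmonic (D := D) le_rfl one_pos (IsKernel.xDiff_wint hb2 kX hz hxz)
    (F1 := wint (fun _ s => s ^ (b - 1)) z1) (fun i x y hy => ?_) (fun i x y hy => ?_)
    (fun i => ?_) hX0 i x hy
  · have := IsKernel.hasDerivAt_wint hb2 kX k0 hz hzd (d0 _) hz1 i x hy
    rwa [w0, zero_add] at this
  · have := IsKernel.hasDerivAt_wint hb2 kX k0 hzd hzl (d0 _) hz2 i x hy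
    rw [w0, zero_add] at this
    refine this.congr_deriv ?_
    rw [← IsKernel.wint_lap hb2 kX hz i x hy]
    simp only [wint, mul_neg, integral_neg]
  · obtain ⟨C, hC0, hC⟩ := hz.bound i
    refine ⟨∫ s in Set.Ioi (0 : ℝ), s ^ (b - 1) * (1 + s) ^ (-b - 2) * C, fun x y hy => ?_⟩
    rw [Real.rpow_zero, mul_one]
    change ‖∫ s in Set.Ioi (0 : ℝ), s ^ (b - 1) * z i x (y + 2 * s)‖ ≤ _
    refine norm_integral_le_of_norm_le ((integrableOn_rpow_mul_one_add_rpow (c := b - 1)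
      (e := -b - 2) (by linarith) (by linarith) (by linarith)).mul_const C) ?_
    refine (ae_restrict_iff' measurableSet_Ioi).2 (Eventually.of_forall fun s hs => ?_)
    have hs0 : 0 < s := hs
    have q1 := Decays.bound_shift hb2 hC0 hC x hy hs0
    rw [norm_mul, Real.norm_eq_abs, Real.norm_eq_abs, abs_of_nonneg (by positivity)]
    calc s ^ (b - 1) * |z i x (y + 2 * s)| ≤ s ^ (b - 1) * (C * (1 + s) ^ (-b - 2)) := by gcongr
      _ = _ := by ring

end Normal

section Normal

variable {n : ℕ} {I : Type*} {D : Fin n → I → I} {a : ℝ}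

namespace NormalSystem

variable {u u1 δ δ1 : I → Eu n → ℝ → ℝ} {g : I → Eu n → ℝ}

/-- Passing to a subfamily that is closed under horizontal derivatives. -/
theorem reindex (h : NormalSystem a D u u1 δ δ1 g) {J : Type*} {D' : Fin n → J → J} (e : J → I)
    (he : ∀ k j, e (D' k j) = D k (e j)) :
    NormalSystem a D' (fun j => u (e j)) (fun j => u1 (e j)) (fun j => δ (e j))
      (fun j => δ1 (e j)) (fun j => g (e j)) where
  xu j k x y hy := by simp only [he]; exact h.xu _ k x y hy
  xu1 j k x y hy := by simp only [he]; exact h.xu1 _ k x y hy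
  xδ j k x y hy := by simp only [he]; exact h.xδ _ k x y hy
  deriv_u j := h.deriv_u (e j)
  deriv_u1 j := by simp only [lap, he]; exact h.deriv_u1 (e j)
  deriv_δ j := h.deriv_δ (e j)
  deriv_δ1 j := by simp only [lap, he]; exact h.deriv_δ1 (e j)
  bdd_u j := h.bdd_u (e j)
  bdd_δ j := h.bdd_δ (e j)
  tendsto_u j := h.tendsto_u (e j)
  tendsto_δ j := h.tendsto_δ (e j)
  tendsto_v j := h.tendsto_v (e j)

/-- For `a < 0` the factor `y ^ a` is large near the boundary, so that `u'` is bounded there. -/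
theorem bound_u1_of_le_one (h : NormalSystem a D u u1 δ δ1 g) (ha : a < 0) (i : I) :
    ∃ M, 0 ≤ M ∧ ∀ x, ∀ y ∈ Set.Ioc (0 : ℝ) 1, |u1 i x y| ≤ M := by
  obtain ⟨M, C, hM0, hC0, hM⟩ := h.bound_rpow_mul_u1 ha.ne i
  refine ⟨M + C / -a, by have : 0 < -a := by linarith
                         positivity, fun x y hy => ?_⟩
  have h1 := hM x y hy
  have h2 : 1 ≤ y ^ a := Real.one_le_rpow_of_pos_of_le_one_of_nonpos hy.1 hy.2 ha.le
  have h3 : C / a * (1 - y ^ a) = C / -a * (y ^ a - 1) := by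
    rw [div_neg]; ring
  have h4 : 0 ≤ C / -a := div_nonneg hC0 (by linarith)
  rw [abs_mul, abs_of_pos (by linarith), h3] at h1
  have h5 : y ^ a * |u1 i x y| ≤ y ^ a * (M + C / -a) := by nlinarith
  exact le_of_mul_le_mul_left h5 (by linarith)

theorem bound_u_of_le_one (h : NormalSystem a D u u1 δ δ1 g) (ha : a < 0) (i : I) :
    ∃ M, 0 ≤ M ∧ ∀ x, ∀ y ∈ Set.Ioc (0 : ℝ) 1, |u i x y| ≤ M * y := by
  obtain ⟨M, hM0, hM⟩ := h.bound_u1_of_le_one ha i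
  refine ⟨M, hM0, fun x y hy => ?_⟩
  have h1 : ∀ᶠ t in 𝓝[>] (0 : ℝ), |u i x y| ≤ M * y + |u i x t| := by
    filter_upwards [Ioo_mem_nhdsGT hy.1] with t ht
    have h2 := (convex_Icc t y).norm_image_sub_le_of_norm_hasDerivWithin_le
      (f := u i x) (f' := u1 i x) (C := M)
      (fun s hs => (h.deriv_u i x s (ht.1.trans_le hs.1)).hasDerivWithinAt)
      (fun s hs => hM x s ⟨ht.1.trans_le hs.1, hs.2.trans hy.2⟩)
      (Set.left_mem_Icc.2 ht.2.le) (Set.right_mem_Icc.2 ht.2.le)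
    rw [Real.norm_eq_abs, Real.norm_eq_abs, abs_of_pos (by linarith [ht.2] : 0 < y - t)] at h2
    have h3 := abs_sub_abs_le_abs_sub (u i x y) (u i x t)
    nlinarith [ht.1]
  have h2 := ((h.tendsto_u i x).abs.const_add (M * y))
  rw [abs_zero, add_zero] at h2
  exact ge_of_tendsto h2 h1

/-- Near the boundary `(y ^ a δ')'` is of size `y ^ a`, because `Δ u` is of size `y`; this is
integrable as `-1 < a`. -/
theorem bound_z1_of_le_one (h : NormalSystem a D u u1 δ δ1 g) (ha : a < 0) (ha1 : -1 < a) (i : I) :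
    ∃ M, 0 ≤ M ∧ ∀ x, ∀ y ∈ Set.Ioc (0 : ℝ) 1, |z1 a D u δ1 i x y| ≤ M := by
  obtain ⟨N, hN0, hN⟩ := h.bound_δ1_of_one_le i
  obtain ⟨B, hB0, hB⟩ := (h.bdd_δ.lap (D := D)) i
  have hu : ∃ C, 0 ≤ C ∧ ∀ x, ∀ y ∈ Set.Ioc (0 : ℝ) 1, |lap D u i x y| ≤ C * y := by
    choose M hM0 hM using fun i => h.bound_u_of_le_one ha i
    refine ⟨∑ k, M (D k (D k i)), Finset.sum_nonneg fun k _ => hM0 _, fun x y hy => ?_⟩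
    rw [Finset.sum_mul]
    exact (Finset.abs_sum_le_sum_abs _ _).trans (Finset.sum_le_sum fun k _ => hM _ x y hy)
  obtain ⟨C, hC0, hC⟩ := hu
  have ha2 : 0 < a + 1 := by linarith
  refine ⟨N + (B + |a| * C) / (a + 1) + C, by positivity, fun x y hy => ?_⟩
  have key := abs_sub_le_of_deriv_le_rpow (h := fun t => t ^ a * δ1 i x t)
    (h1 := fun t => -(t ^ a * lap D δ i x t) - a * t ^ (a - 1) * lap D u i x t)
    (C := B + |a| * C) ha2.ne'
    (fun t ht => by
      have ht0 := ht.1.ne'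
      refine ((Real.hasDerivAt_rpow_const (p := a) (Or.inl ht0)).mul
        (h.deriv_δ1 i x t ht.1)).congr_deriv ?_
      rw [Real.rpow_sub_one ht0]
      field_simp
      ring)
    (fun t ht => by
      have h2 : 0 ≤ t ^ a := Real.rpow_nonneg ht.1.le _
      have h3 : 0 ≤ t ^ (a - 1) := Real.rpow_nonneg ht.1.le _
      have h4 := hB x t ht.1
      have h5 := hC x t ht
      have h6 : t ^ (a - 1) * t = t ^ a := by
        rw [Real.rpow_sub_one ht.1.ne']; field_simp [ht.1.ne']
      refine (abs_sub _ _).trans ?_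
      rw [abs_neg, abs_mul, abs_mul, abs_mul, abs_of_nonneg h2, abs_of_nonneg h3,
        add_sub_cancel_right]
      calc t ^ a * |lap D δ i x t| + |a| * t ^ (a - 1) * |lap D u i x t|
          ≤ t ^ a * B + |a| * t ^ (a - 1) * (C * t) := by gcongr
        _ = t ^ a * B + |a| * C * (t ^ (a - 1) * t) := by ring
        _ = (B + |a| * C) * t ^ a := by rw [h6]; ring) hy
  have h1 := hN x 1 le_rfl
  simp only [Real.one_rpow, one_mul] at key
  have h2 := abs_sub_abs_le_abs_sub (y ^ a * δ1 i x y) (δ1 i x 1)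
  have h3 : (B + |a| * C) / (a + 1) * (1 - y ^ (a + 1)) ≤ (B + |a| * C) / (a + 1) := by
    have : 0 ≤ (B + |a| * C) / (a + 1) := by positivity
    have := Real.rpow_nonneg hy.1.le (a + 1)
    nlinarith
  have h4 : |y ^ a * lap D u i x y| ≤ C := by
    have h5 : 0 ≤ y ^ a := Real.rpow_nonneg hy.1.le _
    have h6 : y ^ a * y ≤ 1 := by
      rw [← Real.rpow_add_one hy.1.ne']
      exact Real.rpow_le_one hy.1.le hy.2 ha2.le
    rw [abs_mul, abs_of_nonneg h5]
    calc y ^ a * |lap D u i x y| ≤ y ^ a * (C * y) := by gcongr; exact hC x y hy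
      _ = C * (y ^ a * y) := by ring
      _ ≤ C := mul_le_of_le_one_right hC0 h6
  rw [z1, mul_add]
  refine (abs_add_le _ _).trans ?_
  linarith

/-- For `a < 0` the weighted codifferential is bounded, and of size `y ^ a` at infinity. -/
theorem bound_z (h : NormalSystem a D u u1 δ δ1 g) (ha : a < 0) (ha1 : -1 < a) (i : I) :
    ∃ M, 0 ≤ M ∧ ∀ x y, 0 < y → |z a u1 δ i x y| ≤ M ∧ |z a u1 δ i x y| ≤ M * y ^ a := by
  obtain ⟨M, hM0, hM⟩ := h.bound_z_of_one_le i
  obtain ⟨N, hN0, hN⟩ := h.bound_z1_of_le_one ha ha1 i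
  refine ⟨M + N, by positivity, fun x y hy => ?_⟩
  rcases le_total 1 y with hy1 | hy1
  · have h1 := hM x y hy1
    have h2 : y ^ a ≤ 1 := Real.rpow_le_one_of_one_le_of_nonpos hy1 ha.le
    have h3 : 0 ≤ y ^ a := Real.rpow_nonneg hy.le _
    constructor <;> nlinarith
  · have h2 := (convex_Icc y 1).norm_image_sub_le_of_norm_hasDerivWithin_le
      (f := z a u1 δ i x) (f' := z1 a D u δ1 i x) (C := N)
      (fun s hs => (h.deriv_z i x s (hy.trans_le hs.1)).hasDerivWithinAt)
      (fun s hs => hN x s ⟨hy.trans_le hs.1, hs.2⟩)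
      (Set.right_mem_Icc.2 hy1) (Set.left_mem_Icc.2 hy1)
    have h3 : N * ‖y - 1‖ ≤ N := by
      refine mul_le_of_le_one_right hN0 ?_
      rw [Real.norm_eq_abs, abs_le]; constructor <;> linarith
    have h4 := hM x 1 le_rfl
    rw [Real.one_rpow, mul_one] at h4
    rw [Real.norm_eq_abs] at h2
    have h5 := abs_sub_abs_le_abs_sub (z a u1 δ i x y) (z a u1 δ i x 1)
    have h6 : |z a u1 δ i x y| ≤ M + N := by linarith
    have h7 : 1 ≤ y ^ a := Real.one_le_rpow_of_pos_of_le_one_of_nonpos hy hy1 ha.le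
    exact ⟨h6, h6.trans (le_mul_of_one_le_right (by positivity) h7)⟩

/-- Each horizontal derivative improves the decay of a bounded harmonic family by one power. -/
theorem decay_gradient (h : NormalSystem a D u u1 δ δ1 g) (hz : Bdd (z a u1 δ)) {e : ℝ}
    (he : e ≤ 0) (k : Fin n) {i : I} {M : ℝ} (hM0 : 0 ≤ M)
    (hM : ∀ x y, 0 < y → |z a u1 δ i x y| ≤ M * y ^ e) :
    ∃ N, 0 ≤ N ∧ ∀ x y, 0 < y → |z a u1 δ (D k i) x y| ≤ N * y ^ (e - 1) := by
  refine ⟨4 * M * 2⁻¹ ^ e * 2, by positivity, fun x y hy => ?_⟩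
  have h1 := abs_gradient_le_of_harmonic h.xz h.deriv_z h.deriv_z1 hz i k (s := y / 2) (h := y / 2)
    (N := M * (y / 2) ^ e) (by positivity) (by positivity) (fun x t ht => ?_) x
  · rw [add_halves] at h1
    refine h1.trans (le_of_eq ?_)
    rw [div_eq_mul_inv y 2, Real.mul_rpow hy.le (by norm_num), Real.rpow_sub_one hy.ne']
    field_simp
  · refine (hM x t (by linarith)).trans ?_
    gcongr ?_ * ?_
    exact Real.rpow_le_rpow_of_nonpos (by positivity) ht he

/-- For `a < 0` the weighted codifferential need not decay fast enough for the integral representation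
of `u`, but its second horizontal derivatives do. -/
theorem eq_zero_of_neg (h : NormalSystem a D u u1 δ δ1 g) (ha : a < 0) (ha1 : -1 < a) (i : I)
    (x : Eu n) {y : ℝ} (hy : 0 < y) : u i x y = 0 := by
  have hzb : Bdd (z a u1 δ) := fun i => by
    obtain ⟨M, hM0, hM⟩ := h.bound_z ha ha1 i
    exact ⟨M, hM0, fun x y hy => (hM x y hy).1⟩
  -- the subfamily of second horizontal derivatives
  set D' : Fin n → Fin n × Fin n × I → Fin n × Fin n × I := fun m j => (m, j.1, D j.2.1 j.2.2)
    with hD'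
  set e : Fin n × Fin n × I → I := fun j => D j.1 (D j.2.1 j.2.2) with he
  have h' := h.reindex (D' := D') e fun k j => rfl
  have hdec : Decays (-a) (z a (fun j => u1 (e j)) (fun j => δ (e j))) := by
    refine ⟨fun j x y hy => (h'.deriv_z j x y hy).continuousAt.continuousWithinAt, fun j => ?_⟩
    obtain ⟨M, hM0, hM⟩ := h.bound_z ha ha1 j.2.2
    obtain ⟨M1, hM10, hM1⟩ := h.decay_gradient hzb ha.le j.2.1 hM0 fun x y hy => (hM x y hy).2
    obtain ⟨M2, hM20, hM2⟩ := h.decay_gradient hzb (by linarith) j.1 hM10 hM1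
    obtain ⟨N, hN0, hN⟩ := hzb (e j)
    refine ⟨(M2 + N) * 2⁻¹ ^ (a - 2), by positivity, fun x y hy => ?_⟩
    have e1 : - -a - 2 = a - 2 := by ring
    have e2 : a - 1 - 1 = a - 2 := by ring
    rw [e1, mul_assoc, ← Real.mul_rpow (by norm_num) (by positivity)]
    rw [e2] at hM2
    rcases le_total 1 y with hy1 | hy1
    · have q1 : y ^ (a - 2) ≤ (2⁻¹ * (1 + y)) ^ (a - 2) :=
        Real.rpow_le_rpow_of_nonpos (by positivity) (by linarith) (by linarith)
      refine (hM2 x y hy).trans ?_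
      gcongr
      linarith
    · have q1 : 1 ≤ (2⁻¹ * (1 + y)) ^ (a - 2) :=
        Real.one_le_rpow_of_pos_of_le_one_of_nonpos (by positivity) (by linarith) (by linarith)
      refine (hN x y hy).trans ?_
      have : N ≤ M2 + N := by linarith
      exact this.trans (le_mul_of_one_le_right (by positivity) q1)
  have hz2 : ∀ j x y, 0 < y → z a u1 δ (e j) x y = 0 := fun j x y hy =>
    eq_zero_of_overdetermined (b := -a) (by linarith) (by linarith) h'.xu h'.deriv_u
      (fun j x y hy => by
        refine (h'.deriv_u1_eq_z j x y hy).congr_deriv ?_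
        rw [neg_neg, show -1 - a = -a - 1 by ring])
      h'.bdd_u h'.tendsto_u h'.tendsto_u1 h'.xz h'.deriv_z h'.deriv_z1 hdec j x hy
  -- so `Δ z = 0`; hence the harmonic `z` is affine in `y`, and it decays
  refine h.eq_zero_of_z (fun i x y hy => ?_) i x hy
  obtain ⟨M, hM0, hM⟩ := h.bound_z ha ha1 i
  have hz1 : ∀ t, 0 < t → HasDerivAt (z1 a D u δ1 i x) 0 t := fun t ht => by
    refine (h.deriv_z1 i x t ht).congr_deriv ?_
    simp only [lap]
    rw [Finset.sum_eq_zero fun k _ => hz2 (k, k, i) x t ht, neg_zero]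
  have hc : ∀ t, 0 < t → z1 a D u δ1 i x t = z1 a D u δ1 i x y := fun t ht => by
    have := (convex_Ioi (0 : ℝ)).norm_image_sub_le_of_norm_hasDerivWithin_le (C := 0)
      (fun s hs => (hz1 s hs).hasDerivWithinAt) (fun s _ => by simp) (Set.mem_Ioi.2 hy)
      (Set.mem_Ioi.2 ht)
    rw [zero_mul] at this
    exact sub_eq_zero.1 (norm_le_zero_iff.1 this)
  set c := z1 a D u δ1 i x y
  have haff : ∀ t, 0 < t → z a u1 δ i x t = z a u1 δ i x y + c * (t - y) := fun t ht => by
    have := (convex_Ioi (0 : ℝ)).norm_image_sub_le_of_norm_hasDerivWithin_le (C := 0)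
      (f := fun t => z a u1 δ i x t - c * (t - y)) (f' := fun _ => 0)
      (fun s hs => by
        refine (((h.deriv_z i x s hs).sub (((hasDerivAt_id s).sub_const y).const_mul
          c)).congr_deriv ?_).hasDerivWithinAt
        rw [hc s hs]; ring) (fun s _ => by simp) (Set.mem_Ioi.2 hy) (Set.mem_Ioi.2 ht)
    rw [zero_mul] at this
    have := sub_eq_zero.1 (norm_le_zero_iff.1 this)
    simp only [sub_self, mul_zero, sub_zero] at this
    linarith
  have hdecay : Tendsto (fun t : ℝ => t ^ a) atTop (𝓝 0) := by
    have := tendsto_rpow_neg_atTop (by linarith : 0 < -a)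
    simpa only [neg_neg] using this
  have hlim : Tendsto (z a u1 δ i x) atTop (𝓝 0) := by
    refine squeeze_zero_norm' ?_ (by simpa using hdecay.const_mul M)
    filter_upwards [Ioi_mem_atTop 0] with t ht using (hM x t ht).2
  have hc0 : c = 0 := by
    have h1 : Tendsto (fun t => z a u1 δ i x (t + 1) - z a u1 δ i x t) atTop (𝓝 (0 - 0)) :=
      (hlim.comp (tendsto_atTop_add_const_right _ 1 tendsto_id)).sub hlim
    have h2 : Tendsto (fun t => z a u1 δ i x (t + 1) - z a u1 δ i x t) atTop (𝓝 c) := by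
      refine tendsto_const_nhds.congr' ?_
      filter_upwards [Ioi_mem_atTop 0] with t ht
      have ht0 : 0 < t := ht
      rw [haff t ht0, haff (t + 1) (by linarith)]
      ring
    simpa using tendsto_nhds_unique h2 h1
  refine tendsto_nhds_unique (tendsto_const_nhds.congr' ?_) hlim
  filter_upwards [Ioi_mem_atTop 0] with t ht
  rw [haff t ht, hc0]
  ring

/-- The normal components vanish. -/
theorem eq_zero (h : NormalSystem a D u u1 δ δ1 g) (ha1 : -1 < a) (ha2 : a < 1) (i : I)
    (x : Eu n) {y : ℝ} (hy : 0 < y) : u i x y = 0 := by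
  rcases lt_trichotomy a 0 with ha | rfl | ha
  · exact h.eq_zero_of_neg ha ha1 i x hy
  · exact h.eq_zero_of_eq_zero i x hy
  · exact h.eq_zero_of_pos ha ha2 i x hy

end NormalSystem

end Normal

/-! ### Test functions and mollification -/

section Mollify

variable {n : ℕ}

/-- The inclusion `x ↦ (x, 0)`. -/
def incl (n : ℕ) : Eu n →L[ℝ] Eu (n + 1) :=
  LinearMap.toContinuousLinearMap
    { toFun := fun x => WithLp.toLp 2 (Fin.snoc (α := fun _ => ℝ) (fun i => x i) 0)
      map_add' := fun x x' => by
        ext i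
        refine Fin.lastCases ?_ (fun i => ?_) i <;> simp
      map_smul' := fun c x => by
        ext i
        refine Fin.lastCases ?_ (fun i => ?_) i <;> simp }

theorem pt_eq (x : Eu n) (y : ℝ) : pt x y = incl n x + y • basisVec (Fin.last n) := by
  ext i
  refine Fin.lastCases ?_ (fun i => ?_) i
  · simp [pt, incl, basisVec]
  · simp [pt, incl, basisVec]

theorem incl_basisVec (k : Fin n) : incl n (basisVec k) = basisVec k.castSucc := by
  ext i
  refine Fin.lastCases ?_ (fun i => ?_) i
  · simp [incl, basisVec]
  · simp [incl, basisVec]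

theorem yCoord_pt (x : Eu n) (y : ℝ) : yCoord (pt x y) = y := by simp [yCoord, pt]

theorem pt_mem_upperHalf (x : Eu n) {y : ℝ} (hy : 0 < y) : pt x y ∈ upperHalf n := by
  simpa [upperHalf, yCoord_pt] using hy

theorem isOpen_upperHalf (n : ℕ) : IsOpen (upperHalf n) :=
  isOpen_lt continuous_const (by unfold yCoord; fun_prop)

theorem continuous_pt : Continuous fun q : Eu n × ℝ => pt q.1 q.2 := by
  simp only [pt_eq]; fun_prop

theorem continuous_slice {E : Type*} [TopologicalSpace E] {A : Eu (n + 1) → E}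
    (hA : ContinuousOn A (upperHalf n)) {y : ℝ} (hy : 0 < y) : Continuous fun t => A (pt t y) :=
  hA.comp_continuous (continuous_pt.comp (continuous_id.prodMk continuous_const))
    fun t => pt_mem_upperHalf t hy

theorem hasDerivAt_pt {A : Eu (n + 1) → ℝ} {x : Eu n} {y : ℝ}
    (hA : DifferentiableAt ℝ A (pt x y)) :
    HasDerivAt (fun y => A (pt x y)) (fderiv ℝ A (pt x y) (basisVec (Fin.last n))) y := by
  have h1 : HasDerivAt (fun y : ℝ => pt x y) (basisVec (Fin.last n)) y := by
    simp only [pt_eq]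
    simpa using ((hasDerivAt_id y).smul_const (basisVec (Fin.last n))).const_add (incl n x)
  exact hA.hasFDerivAt.comp_hasDerivAt y h1

theorem hasFDerivAt_slice {A : Eu (n + 1) → ℝ} {x : Eu n} {y : ℝ}
    (hA : DifferentiableAt ℝ A (pt x y)) :
    HasFDerivAt (fun x => A (pt x y)) ((fderiv ℝ A (pt x y)).comp (incl n)) x := by
  have h1 : HasFDerivAt (fun x : Eu n => pt x y) (incl n) x := by
    simp only [pt_eq]
    exact (incl n).hasFDerivAt.add_const _
  exact hA.hasFDerivAt.comp x h1

theorem two_le_top : (2 : WithTop ℕ∞) ≤ ((⊤ : ℕ∞) : WithTop ℕ∞) :=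
  WithTop.coe_le_coe.2 (le_top : (2 : ℕ∞) ≤ ⊤)

/-- Smooth compactly supported functions. -/
@[ext]
structure Test (n : ℕ) where
  /-- The underlying function. -/
  toFun : Eu n → ℝ
  isTest : IsTest toFun

instance : CoeFun (Test n) fun _ => Eu n → ℝ := ⟨Test.toFun⟩

namespace Test

theorem contDiff (ψ : Test n) : ContDiff ℝ (⊤ : ℕ∞) ψ := ψ.isTest.1

theorem hasCompactSupport (ψ : Test n) : HasCompactSupport ψ := ψ.isTest.2

theorem continuous (ψ : Test n) : Continuous ψ := ψ.contDiff.continuous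

theorem differentiable (ψ : Test n) : Differentiable ℝ ψ := ψ.contDiff.differentiable (by simp)

theorem integrable (ψ : Test n) : Integrable ψ :=
  ψ.continuous.integrable_of_hasCompactSupport ψ.hasCompactSupport

/-- The partial derivative of a test function. -/
def d (k : Fin n) (ψ : Test n) : Test n :=
  ⟨fun x => fderiv ℝ ψ x (basisVec k),
    (ψ.contDiff.fderiv_right (m := ((⊤ : ℕ∞) : WithTop ℕ∞)) le_rfl).clm_apply contDiff_const,
    ψ.hasCompactSupport.fderiv_apply ℝ (basisVec k)⟩

theorem d_apply (k : Fin n) (ψ : Test n) (x : Eu n) : d k ψ x = fderiv ℝ ψ x (basisVec k) := rfl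

theorem d_comm (k l : Fin n) (ψ : Test n) : d k (d l ψ) = d l (d k ψ) :=
  Test.ext (funext fun _ => secondDeriv_comm
    ((ψ.contDiff.of_le two_le_top).contDiffAt) _ _)

/-- The test function `t ↦ ψ (x - t)`. -/
def reflect (x : Eu n) (ψ : Test n) : Test n :=
  ⟨fun t => ψ (x - t), ψ.contDiff.comp (contDiff_const.sub contDiff_id),
    ψ.hasCompactSupport.comp_homeomorph (Homeomorph.subLeft x)⟩

theorem reflect_apply (x t : Eu n) (ψ : Test n) : reflect x ψ t = ψ (x - t) := rfl

theorem fderiv_reflect (x t : Eu n) (ψ : Test n) (k : Fin n) :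
    fderiv ℝ (reflect x ψ) t (basisVec k) = -reflect x (d k ψ) t := by
  have h1 : HasFDerivAt (fun t : Eu n => x - t) (-ContinuousLinearMap.id ℝ (Eu n)) t :=
    (hasFDerivAt_id t).const_sub x
  have h2 : HasFDerivAt (reflect x ψ) _ t := (ψ.differentiable (x - t)).hasFDerivAt.comp t h1
  rw [h2.fderiv]
  simp [reflect_apply, d_apply]

end Test

/-- The convolution of a function with a test function. -/
def conv (f : Eu n → ℝ) (ψ : Test n) (x : Eu n) : ℝ := ∫ t, f t * ψ (x - t)

theorem conv_eq (f : Eu n → ℝ) (ψ : Test n) (x : Eu n) :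
    conv f ψ x = ∫ t, f t * Test.reflect x ψ t := rfl

theorem integrable_mul_test {f : Eu n → ℝ} (hf : LocallyIntegrable f) (ψ : Test n) :
    Integrable fun t => f t * ψ t := by
  have := hf.integrable_smul_right_of_hasCompactSupport ψ.continuous ψ.hasCompactSupport
  simpa only [smul_eq_mul] using this

theorem integrable_conv {f : Eu n → ℝ} (hf : LocallyIntegrable f) (ψ : Test n) (x : Eu n) :
    Integrable fun t => f t * ψ (x - t) := integrable_mul_test hf (Test.reflect x ψ)

theorem hasDerivAt_conv {f : Eu n → ℝ} (hf : LocallyIntegrable f) (ψ : Test n) (k : Fin n)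
    (x : Eu n) :
    HasDerivAt (fun s : ℝ => conv f ψ (x + s • basisVec k)) (conv f (Test.d k ψ) x) 0 := by
  have h1 := ψ.hasCompactSupport.hasFDerivAt_convolution_right (𝕜 := ℝ)
    (ContinuousLinearMap.mul ℝ ℝ) hf
    (ψ.contDiff.of_le (by exact_mod_cast (le_top : (1 : ℕ∞) ≤ ⊤))) x
  have h2 : HasDerivAt (fun s : ℝ => x + s • basisVec k) (basisVec k) 0 := by
    simpa using ((hasDerivAt_id (0 : ℝ)).smul_const (basisVec k)).const_add x
  have e : x = x + (0 : ℝ) • basisVec k := by rw [zero_smul, add_zero]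
  rw [e] at h1
  have h4 := h1.comp_hasDerivAt 0 h2
  rw [← e, convolution_precompR_apply (𝕜 := ℝ) _ hf (ψ.hasCompactSupport.fderiv ℝ)
    (ψ.contDiff.continuous_fderiv (by simp))] at h4
  exact h4

/-- Functions are determined by their convolutions with test functions. -/
theorem ae_eq_of_conv_eq {f g : Eu n → ℝ} (hf : LocallyIntegrable f) (hg : LocallyIntegrable g)
    (h : ∀ ψ : Test n, conv f ψ 0 = conv g ψ 0) : f =ᵐ[volume] g := by
  refine ae_eq_of_integral_contDiff_smul_eq hf hg fun φ hφ hφc => ?_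
  have hψ : IsTest φ := ⟨hφ, hφc⟩
  have h1 := h (Test.reflect 0 ⟨φ, hψ⟩)
  have h2 : ∀ t : Eu n, Test.reflect 0 ⟨φ, hψ⟩ (0 - t) = φ t := fun t => by
    rw [Test.reflect_apply, sub_sub_cancel]
  simp only [conv, h2] at h1
  simpa only [smul_eq_mul, mul_comm] using h1

/-- Mollification in `x` of a function on the half-space. -/
def mol (A : Eu (n + 1) → ℝ) (ψ : Test n) (x : Eu n) (y : ℝ) : ℝ := conv (fun t => A (pt t y)) ψ x

theorem mol_xDiff {A : Eu (n + 1) → ℝ} (hA : ContinuousOn A (upperHalf n)) :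
    XDiff Test.d (mol A) := fun ψ k x _ hy =>
  hasDerivAt_conv (continuous_slice hA hy).locallyIntegrable ψ k x

theorem mol_bdd {A : Eu (n + 1) → ℝ} {M : ℝ} (hM : ∀ z ∈ upperHalf n, |A z| ≤ M) :
    Bdd (mol A) := fun ψ => by
  have hM0 : 0 ≤ M := (abs_nonneg _).trans (hM _ (pt_mem_upperHalf 0 one_pos))
  refine ⟨M * ∫ t, |ψ t|, mul_nonneg hM0 (integral_nonneg fun _ => abs_nonneg _), fun x y hy => ?_⟩
  have h1 : ∫ t, |ψ t| = ∫ t, |ψ (x - t)| := (integral_sub_left_eq_self (fun t => |ψ t|) volume x).symm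
  rw [h1, ← integral_const_mul]
  change ‖∫ t, A (pt t y) * ψ (x - t)‖ ≤ _
  refine norm_integral_le_of_norm_le (((Test.reflect x ψ).integrable.abs).const_mul M)
    (Eventually.of_forall fun t => ?_)
  rw [norm_mul]
  exact mul_le_mul_of_nonneg_right (hM _ (pt_mem_upperHalf t hy)) (norm_nonneg _)

/-- The `y`-derivative commutes with mollification. -/
theorem mol_hasDerivAt {A : Eu (n + 1) → ℝ} (hA : ∀ z ∈ upperHalf n, ContDiffAt ℝ 1 A z)
    (ψ : Test n) (x : Eu n) (y : ℝ) (hy : 0 < y) :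
    HasDerivAt (mol A ψ x) (mol (fun z => fderiv ℝ A z (basisVec (Fin.last n))) ψ x y) y := by
  have hAc : ContinuousOn A (upperHalf n) := fun z hz => (hA z hz).continuousAt.continuousWithinAt
  have hA1 : ContinuousOn (fun z => fderiv ℝ A z (basisVec (Fin.last n))) (upperHalf n) :=
    fun z hz => (((hA z hz).fderiv_right (m := 0) (by simp)).continuousAt.clm_apply
      continuousAt_const).continuousWithinAt
  set χ := Test.reflect x ψ with hχ
  obtain ⟨C, hC⟩ : ∃ C, ∀ q ∈ tsupport χ ×ˢ Set.Icc (y / 2) (2 * y),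
      ‖fderiv ℝ A (pt q.1 q.2) (basisVec (Fin.last n))‖ ≤ C := by
    refine IsCompact.exists_bound_of_continuousOn
      ((show IsCompact (tsupport χ) from χ.hasCompactSupport).prod isCompact_Icc) ?_
    refine ContinuousOn.comp hA1 continuous_pt.continuousOn fun q hq => ?_
    exact pt_mem_upperHalf _ (by linarith [hq.2.1])
  refine (hasDerivAt_integral_of_dominated_loc_of_deriv_le (μ := volume)
    (F := fun s t => A (pt t s) * χ t)
    (F' := fun s t => fderiv ℝ A (pt t s) (basisVec (Fin.last n)) * χ t)
    (bound := fun t => C * |χ t|) (x₀ := y) (s := Set.Ioo (y / 2) (2 * y))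
    (Ioo_mem_nhds (by linarith) (by linarith)) ?_ ?_ ?_ ?_ ?_ ?_).2
  · filter_upwards [lt_mem_nhds hy] with s hs
    exact ((continuous_slice hAc hs).mul χ.continuous).aestronglyMeasurable
  · exact integrable_mul_test (continuous_slice hAc hy).locallyIntegrable χ
  · exact ((continuous_slice hA1 hy).mul χ.continuous).aestronglyMeasurable
  · refine Eventually.of_forall fun t s hs => ?_
    by_cases ht : t ∈ tsupport χ
    · rw [norm_mul]
      exact mul_le_mul_of_nonneg_right (hC (t, s) ⟨ht, Set.Ioo_subset_Icc_self hs⟩) (norm_nonneg _)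
    · simp [image_eq_zero_of_notMem_tsupport ht]
  · exact χ.integrable.abs.const_mul C
  · refine Eventually.of_forall fun t s hs => ?_
    exact (hasDerivAt_pt ((hA _ (pt_mem_upperHalf t (by linarith [hs.1]))).differentiableAt
      (by simp))).mul_const _

/-- Horizontal derivatives are moved to the test function. -/
theorem mol_fderiv {A : Eu (n + 1) → ℝ} (hA : ∀ z ∈ upperHalf n, ContDiffAt ℝ 1 A z)
    (k : Fin n) (ψ : Test n) (x : Eu n) {y : ℝ} (hy : 0 < y) :
    mol (fun z => fderiv ℝ A z (basisVec k.castSucc)) ψ x y = mol A (Test.d k ψ) x y := by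
  have hAc : ContinuousOn A (upperHalf n) := fun z hz => (hA z hz).continuousAt.continuousWithinAt
  have hA1 : ContinuousOn (fun z => fderiv ℝ A z (basisVec k.castSucc)) (upperHalf n) :=
    fun z hz => (((hA z hz).fderiv_right (m := 0) (by simp)).continuousAt.clm_apply
      continuousAt_const).continuousWithinAt
  have hd : ∀ t, HasFDerivAt (fun t => A (pt t y)) ((fderiv ℝ A (pt t y)).comp (incl n)) t :=
    fun t => hasFDerivAt_slice ((hA _ (pt_mem_upperHalf t hy)).differentiableAt (by simp))
  have he : ∀ t, fderiv ℝ (fun t => A (pt t y)) t (basisVec k)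
      = fderiv ℝ A (pt t y) (basisVec k.castSucc) := fun t => by
    rw [(hd t).fderiv, ContinuousLinearMap.comp_apply, incl_basisVec]
  set χ := Test.reflect x ψ with hχ
  have hlA := (continuous_slice hAc hy).locallyIntegrable (μ := (volume : Measure (Eu n)))
  have hlA1 := (continuous_slice hA1 hy).locallyIntegrable (μ := (volume : Measure (Eu n)))
  have key := integral_mul_fderiv_eq_neg_fderiv_mul_of_integrable (μ := (volume : Measure (Eu n)))
    (f := fun t => A (pt t y)) (g := χ) (v := basisVec k) ?_ ?_ ?_
    (fun t _ => (hd t).differentiableAt) (fun t _ => χ.differentiable t)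
  · simp only [he, hχ, Test.fderiv_reflect, mul_neg, integral_neg, neg_inj] at key
    exact key.symm
  · simp only [he]
    exact integrable_mul_test hlA1 χ
  · exact integrable_mul_test hlA (Test.d k χ)
  · exact integrable_mul_test hlA χ

theorem mol_add {A B : Eu (n + 1) → ℝ} (hA : ContinuousOn A (upperHalf n))
    (hB : ContinuousOn B (upperHalf n)) (ψ : Test n) (x : Eu n) {y : ℝ} (hy : 0 < y) :
    mol (fun z => A z + B z) ψ x y = mol A ψ x y + mol B ψ x y := by
  simp only [mol, conv, add_mul]
  exact integral_add (integrable_conv (continuous_slice hA hy).locallyIntegrable ψ x)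
    (integrable_conv (continuous_slice hB hy).locallyIntegrable ψ x)

theorem mol_neg (A : Eu (n + 1) → ℝ) (ψ : Test n) (x : Eu n) (y : ℝ) :
    mol (fun z => -A z) ψ x y = -mol A ψ x y := by
  simp only [mol, conv, neg_mul, integral_neg]

theorem mol_const_mul (c : ℝ) (A : Eu (n + 1) → ℝ) (ψ : Test n) (x : Eu n) (y : ℝ) :
    mol (fun z => c * A z) ψ x y = c * mol A ψ x y := by
  simp only [mol, conv, mul_assoc, integral_const_mul]

theorem mol_sum {ι : Type*} (s : Finset ι) {A : ι → Eu (n + 1) → ℝ}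
    (hA : ∀ i ∈ s, ContinuousOn (A i) (upperHalf n)) (ψ : Test n) (x : Eu n) {y : ℝ}
    (hy : 0 < y) : mol (fun z => ∑ i ∈ s, A i z) ψ x y = ∑ i ∈ s, mol (A i) ψ x y := by
  simp only [mol, conv, Finset.sum_mul]
  exact integral_finsetSum _ fun i hi =>
    integrable_conv (continuous_slice (hA i hi) hy).locallyIntegrable ψ x

end Mollify

/-! ### The mollified equations -/

section Equations

variable {n p : ℕ} {a : ℝ}

/-- A tuple of horizontal indices. -/
def up {p : ℕ} (w : Fin p → Fin n) : Fin p → Fin (n + 1) := fun i => (w i).castSucc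

theorem comp_cons {m p : ℕ} (η : Covec m (p + 1)) (k : Fin m) (w : Fin p → Fin m) :
    comp η (Fin.cons k w) = η (Fin.cons (basisVec k) fun j => basisVec (w j)) := by
  unfold comp
  congr 1
  ext j : 1
  refine Fin.cases ?_ (fun j => ?_) j <;> simp

theorem up_cons {p : ℕ} (k : Fin n) (w : Fin p → Fin n) :
    up (Fin.cons k w : Fin (p + 1) → Fin n) = Fin.cons k.castSucc (up w) := by
  ext j : 1
  refine Fin.cases ?_ (fun j => ?_) j <;> simp [up]

theorem basisVec_up_last {p : ℕ} (w : Fin p → Fin n) (i : Fin p) :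
    (basisVec (up w i) : Eu (n + 1)) (Fin.last n) = 0 := by
  simp [basisVec, up]

/-- The mollification of a component of a form, and its `y`-derivatives. -/
def cm (α : Eu (n + 1) → Covec (n + 1) p) (w : Fin p → Fin (n + 1)) :
    Test n → Eu n → ℝ → ℝ := mol fun z => comp (α z) w

def cm1 (α : Eu (n + 1) → Covec (n + 1) p) (w : Fin p → Fin (n + 1)) :
    Test n → Eu n → ℝ → ℝ :=
  mol fun z => fderiv ℝ (fun x => comp (α x) w) z (basisVec (Fin.last n))

def cm2 (α : Eu (n + 1) → Covec (n + 1) p) (w : Fin p → Fin (n + 1)) :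
    Test n → Eu n → ℝ → ℝ :=
  mol fun z => secondDeriv (fun x => comp (α x) w) (basisVec (Fin.last n))
    (basisVec (Fin.last n)) z

theorem mol_congr_slice {A B : Eu (n + 1) → ℝ} {y : ℝ} (h : ∀ t, A (pt t y) = B (pt t y))
    (ψ : Test n) (x : Eu n) : mol A ψ x y = mol B ψ x y := by
  simp only [mol, conv, h]

section C2

variable {A : Eu (n + 1) → ℝ}

theorem contDiffAt_fderiv_apply (hA : ∀ z ∈ upperHalf n, ContDiffAt ℝ 2 A z) (e : Eu (n + 1)) :
    ∀ z ∈ upperHalf n, ContDiffAt ℝ 1 (fun z => fderiv ℝ A z e) z := fun z hz =>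
  ((hA z hz).fderiv_right (m := 1) (by norm_num)).clm_apply contDiffAt_const

theorem continuousOn_of_contDiffAt {k : WithTop ℕ∞}
    (hA : ∀ z ∈ upperHalf n, ContDiffAt ℝ k A z) : ContinuousOn A (upperHalf n) :=
  fun z hz => (hA z hz).continuousAt.continuousWithinAt

theorem continuousOn_fderiv_apply (hA : ∀ z ∈ upperHalf n, ContDiffAt ℝ 1 A z) (e : Eu (n + 1)) :
    ContinuousOn (fun z => fderiv ℝ A z e) (upperHalf n) := fun z hz =>
  (((hA z hz).fderiv_right (m := 0) (by simp)).continuousAt.clm_apply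
    continuousAt_const).continuousWithinAt

theorem continuousOn_secondDeriv (hA : ∀ z ∈ upperHalf n, ContDiffAt ℝ 2 A z)
    (e f : Eu (n + 1)) : ContinuousOn (secondDeriv A e f) (upperHalf n) :=
  continuousOn_fderiv_apply (contDiffAt_fderiv_apply hA f) e

theorem mol_laplacian (hA : ∀ z ∈ upperHalf n, ContDiffAt ℝ 2 A z) (ψ : Test n) (x : Eu n)
    {y : ℝ} (hy : 0 < y) :
    mol (fun z => ∑ k, secondDeriv A (basisVec k) (basisVec k) z) ψ x y
      = mol (secondDeriv A (basisVec (Fin.last n)) (basisVec (Fin.last n))) ψ x y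
        + lap Test.d (mol A) ψ x y := by
  have h1 : ∀ z ∈ upperHalf n, ContDiffAt ℝ 1 A z := fun z hz => (hA z hz).of_le (by norm_num)
  rw [mol_sum _ (fun k _ => continuousOn_secondDeriv hA _ _) ψ x hy, Fin.sum_univ_castSucc,
    add_comm]
  congr 1
  refine Finset.sum_congr rfl fun k _ => ?_
  have h2 := mol_fderiv (contDiffAt_fderiv_apply hA (basisVec k.castSucc)) k ψ x hy
  exact h2.trans (mol_fderiv h1 k (Test.d k ψ) x hy)

end C2

variable {α : Eu (n + 1) → Covec (n + 1) p} {ω : L2Form n p}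

theorem contDiffAt_of_contDiffOn (hα : ContDiffOn ℝ 2 α (upperHalf n)) :
    ∀ z ∈ upperHalf n, ContDiffAt ℝ 2 α z := fun _ hz =>
  hα.contDiffAt ((isOpen_upperHalf n).mem_nhds hz)

theorem contDiffAt_comp (hα : ContDiffOn ℝ 2 α (upperHalf n)) (w : Fin p → Fin (n + 1)) :
    ∀ z ∈ upperHalf n, ContDiffAt ℝ 2 (fun z => comp (α z) w) z := fun z hz =>
  contDiffAt_covec_apply (contDiffAt_of_contDiffOn hα z hz) _

theorem contDiffAt_comp_one (hα : ContDiffOn ℝ 2 α (upperHalf n)) (w : Fin p → Fin (n + 1)) :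
    ∀ z ∈ upperHalf n, ContDiffAt ℝ 1 (fun z => comp (α z) w) z := fun z hz =>
  (contDiffAt_comp hα w z hz).of_le (by norm_num)

theorem cm_xDiff (hα : ContDiffOn ℝ 2 α (upperHalf n)) (w : Fin p → Fin (n + 1)) :
    XDiff Test.d (cm α w) := mol_xDiff (continuousOn_of_contDiffAt (contDiffAt_comp hα w))

theorem cm1_xDiff (hα : ContDiffOn ℝ 2 α (upperHalf n)) (w : Fin p → Fin (n + 1)) :
    XDiff Test.d (cm1 α w) :=
  mol_xDiff (continuousOn_fderiv_apply (contDiffAt_comp_one hα w) _)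

theorem cm_hasDerivAt (hα : ContDiffOn ℝ 2 α (upperHalf n)) (w : Fin p → Fin (n + 1))
    (ψ : Test n) (x : Eu n) (y : ℝ) (hy : 0 < y) :
    HasDerivAt (cm α w ψ x) (cm1 α w ψ x y) y :=
  mol_hasDerivAt (contDiffAt_comp_one hα w) ψ x y hy

theorem cm1_hasDerivAt (hα : ContDiffOn ℝ 2 α (upperHalf n)) (w : Fin p → Fin (n + 1))
    (ψ : Test n) (x : Eu n) (y : ℝ) (hy : 0 < y) :
    HasDerivAt (cm1 α w ψ x) (cm2 α w ψ x y) y :=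
  mol_hasDerivAt (contDiffAt_fderiv_apply (contDiffAt_comp hα w) _) ψ x y hy

theorem cm_bdd (hα : ∃ M : ℝ, ∀ z ∈ upperHalf n, ‖α z‖ ≤ M) (w : Fin p → Fin (n + 1)) :
    Bdd (cm α w) := by
  obtain ⟨M, hM⟩ := hα
  exact mol_bdd fun z hz => (abs_comp_le _ _).trans (hM z hz)

/-- The mollified contraction of `dα` with the vertical direction. -/
def dm (α : Eu (n + 1) → Covec (n + 1) p) (w : Fin p → Fin n) : Test n → Eu n → ℝ → ℝ :=
  mol fun z => comp (extDeriv α z) (Fin.cons (Fin.last n) (up w))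

theorem continuousOn_extDeriv (hα : ContDiffOn ℝ 2 α (upperHalf n)) (w : Fin (p + 1) → Fin (n + 1)) :
    ContinuousOn (fun z => comp (extDeriv α z) w) (upperHalf n) := fun z hz => by
  have h := differentiableAt_extDeriv (contDiffAt_of_contDiffOn hα z hz)
  exact (h.continuousAt.eval_const _).continuousWithinAt

/-- The extension equation for a tangential component. -/
theorem cm_tangential (hα : IsBoundedExtension a ω α) (w : Fin p → Fin n) (ψ : Test n) (x : Eu n)
    {y : ℝ} (hy : 0 < y) :
    cm2 α (up w) ψ x y + lap Test.d (cm α (up w)) ψ x y + a / y * dm α w ψ x y = 0 := by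
  have h2 := contDiffAt_comp hα.regular (up w)
  have hE := continuousOn_extDeriv hα.regular (Fin.cons (Fin.last n) (up w))
  have key : mol (fun z => ∑ k, secondDeriv (fun z => comp (α z) (up w)) (basisVec k) (basisVec k) z
      + a / y * comp (extDeriv α z) (Fin.cons (Fin.last n) (up w))) ψ x y = mol (fun _ => 0) ψ x y :=
    mol_congr_slice (fun t => by
      have hz := pt_mem_upperHalf t hy
      have := tangential_equation hz (contDiffAt_of_contDiffOn hα.regular _ hz)
        (hα.equation _ hz) (fun j => basisVec (up w j)) (basisVec_up_last w)
      rw [comp_cons]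
      rwa [yCoord_pt] at this) ψ x
  have hE' : ContinuousOn (fun z => a / y * comp (extDeriv α z) (Fin.cons (Fin.last n) (up w)))
    (upperHalf n) := continuousOn_const.mul hE
  rw [mol_add (continuousOn_finsetSum _ fun k _ => continuousOn_secondDeriv h2 _ _)
    hE' ψ x hy, mol_laplacian h2 ψ x hy, mol_const_mul] at key
  refine key.trans ?_
  simp [mol, conv]

theorem dm_zero {α : Eu (n + 1) → Covec (n + 1) 0} (hα : ContDiffOn ℝ 2 α (upperHalf n))
    (w : Fin 0 → Fin n) (ψ : Test n) (x : Eu n) {y : ℝ} (hy : 0 < y) :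
    dm α w ψ x y = cm1 α (up w) ψ x y := by
  refine mol_congr_slice (fun t => ?_) ψ x
  rw [comp_cons, extDeriv_apply_cons ((contDiffAt_of_contDiffOn hα _
    (pt_mem_upperHalf t hy)).differentiableAt (by norm_num))]
  simp [comp]

/-- The vertical part of `dα` in terms of the `y`-derivative of a tangential component and the
horizontal derivatives of the normal components. -/
theorem dm_succ {α : Eu (n + 1) → Covec (n + 1) (p + 1)} (hα : ContDiffOn ℝ 2 α (upperHalf n))
    (w : Fin (p + 1) → Fin n) (ψ : Test n) (x : Eu n) {y : ℝ} (hy : 0 < y) :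
    dm α w ψ x y = cm1 α (up w) ψ x y - ∑ i : Fin (p + 1), (-1) ^ (i : ℕ) *
      cm α (Fin.cons (Fin.last n) (up (i.removeNth w))) (Test.d (w i) ψ) x y := by
  have h1 := contDiffAt_comp_one hα (up w)
  have key : dm α w ψ x y = mol (fun z => fderiv ℝ (fun x => comp (α x) (up w)) z
      (basisVec (Fin.last n)) + ∑ i : Fin (p + 1), -(-1) ^ (i : ℕ) *
        fderiv ℝ (fun x => comp (α x) (Fin.cons (Fin.last n) (up (i.removeNth w)))) z
          (basisVec (w i).castSucc)) ψ x y := by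
    refine mol_congr_slice (fun t => ?_) ψ x
    rw [comp_cons, extDeriv_apply_cons ((contDiffAt_of_contDiffOn hα _
      (pt_mem_upperHalf t hy)).differentiableAt (by norm_num)), sub_eq_add_neg,
      ← Finset.sum_neg_distrib]
    congr 1
    refine Finset.sum_congr rfl fun i _ => ?_
    simp only [removeNth_succ_cons, comp_cons, neg_mul]
    rfl
  have hc : ∀ i : Fin (p + 1), ContinuousOn (fun z => -(-1) ^ (i : ℕ) *
      fderiv ℝ (fun x => comp (α x) (Fin.cons (Fin.last n) (up (i.removeNth w)))) z
        (basisVec (w i).castSucc)) (upperHalf n) := fun i =>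
    continuousOn_const.mul (continuousOn_fderiv_apply (contDiffAt_comp_one hα _) _)
  rw [key, mol_add (continuousOn_fderiv_apply h1 (basisVec (Fin.last n)))
    (continuousOn_finsetSum _ fun i _ => hc i) ψ x hy,
    mol_sum _ (fun i _ => hc i) ψ x hy, sub_eq_add_neg,
    ← Finset.sum_neg_distrib]
  congr 1
  refine Finset.sum_congr rfl fun i _ => ?_
  rw [mol_const_mul, mol_fderiv (contDiffAt_comp_one hα _) (w i) ψ x hy, neg_mul]
  rfl

section Succ

variable {α : Eu (n + 1) → Covec (n + 1) (p + 1)} {ω : L2Form n (p + 1)}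

/-- The mollified horizontal divergence of the components with given remaining indices. -/
def dv (F : (Fin (p + 1) → Fin (n + 1)) → Test n → Eu n → ℝ → ℝ) (w : Fin p → Fin (n + 1))
    (ψ : Test n) (x : Eu n) (y : ℝ) : ℝ :=
  -∑ k : Fin n, F (Fin.cons k.castSucc w) (Test.d k ψ) x y

theorem mol_codiff (hα : ContDiffOn ℝ 2 α (upperHalf n)) (w : Fin p → Fin (n + 1)) (ψ : Test n)
    (x : Eu n) {y : ℝ} (hy : 0 < y) :
    mol (fun z => comp (codiff α z) w) ψ x y
      = dv (cm α) w ψ x y - cm1 α (Fin.cons (Fin.last n) w) ψ x y := by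
  have key : mol (fun z => comp (codiff α z) w) ψ x y = mol (fun z => -∑ k,
      fderiv ℝ (fun x => comp (α x) (Fin.cons k w)) z (basisVec k)) ψ x y :=
    mol_congr_slice (fun t => by
      simp only [comp_cons]
      exact codiff_apply ((contDiffAt_of_contDiffOn hα _
        (pt_mem_upperHalf t hy)).differentiableAt (by norm_num)) _) ψ x
  rw [key, mol_neg, mol_sum _ (fun k _ => continuousOn_fderiv_apply (contDiffAt_comp_one hα _) _)
    ψ x hy, Fin.sum_univ_castSucc, neg_add, ← sub_eq_add_neg]
  congr 1
  unfold dv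
  congr 1
  exact Finset.sum_congr rfl fun k _ => mol_fderiv (contDiffAt_comp_one hα _) k ψ x hy

/-- The extension equation for a normal component. -/
theorem cm_normal (hα : IsBoundedExtension a ω α) (w : Fin p → Fin n) (ψ : Test n) (x : Eu n)
    {y : ℝ} (hy : 0 < y) :
    cm2 α (Fin.cons (Fin.last n) (up w)) ψ x y
      = a / y * (dv (cm α) (up w) ψ x y - cm1 α (Fin.cons (Fin.last n) (up w)) ψ x y)
        - lap Test.d (cm α (Fin.cons (Fin.last n) (up w))) ψ x y := by
  have h2 := contDiffAt_comp hα.regular (Fin.cons (Fin.last n) (up w))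
  have key : mol (fun z => ∑ k, secondDeriv (fun z => comp (α z) (Fin.cons (Fin.last n) (up w)))
      (basisVec k) (basisVec k) z) ψ x y = mol (fun z => a / y * comp (codiff α z) (up w)) ψ x y :=
    mol_congr_slice (fun t => by
      have hz := pt_mem_upperHalf t hy
      have := normal_equation hz (contDiffAt_of_contDiffOn hα.regular _ hz)
        (hα.equation _ hz) (fun j => basisVec (up w j)) (basisVec_up_last w)
      simp only [comp_cons]
      rwa [yCoord_pt] at this) ψ x
  rw [mol_laplacian h2 ψ x hy, mol_const_mul, mol_codiff hα.regular _ ψ x hy] at key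
  rw [← key]
  simp only [cm2, cm]
  ring

end Succ

end Equations

/-! ### Boundary values and vanishing of the normal components -/

section Boundary

variable {n p : ℕ} {a : ℝ}

theorem proj_apply (z : Eu (n + 1)) (i : Fin n) : proj n z i = z i.castSucc := rfl

theorem proj_basisVec_castSucc (k : Fin n) : proj n (basisVec k.castSucc) = basisVec k := by
  ext i
  simp [proj_apply, basisVec]

theorem proj_basisVec_last : proj n (basisVec (Fin.last n)) = 0 := by
  ext i
  simp [proj_apply, basisVec]

theorem comp_pull_up (η : Covec n p) (w : Fin p → Fin n) : comp (pull η) (up w) = comp η w := by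
  simp only [comp, pull, ContinuousAlternatingMap.compContinuousLinearMap_apply]
  congr 1
  ext j : 1
  exact proj_basisVec_castSucc _

theorem comp_pull_eq_zero (η : Covec n p) {w : Fin p → Fin (n + 1)} {j : Fin p}
    (hj : w j = Fin.last n) : comp (pull η) w = 0 := by
  simp only [comp, pull, ContinuousAlternatingMap.compContinuousLinearMap_apply]
  refine η.map_coord_zero j ?_
  simp only [Function.comp, hj]
  exact proj_basisVec_last

theorem tendsto_mol_of_hasBoundaryValue {A : Eu (n + 1) → Covec (n + 1) p} {u : Eu n → Covec n p}
    (h : HasBoundaryValue A u) (w : Fin p → Fin (n + 1)) (ψ : Test n) (x : Eu n) :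
    Tendsto (mol (fun z => comp (A z) w) ψ x) (𝓝[>] 0)
      (𝓝 (conv (fun t => comp (pull (u t)) w) ψ x)) := by
  have := h (fun t => Test.reflect x ψ t • dualCovec w)
    ⟨(Test.reflect x ψ).contDiff.smul contDiff_const,
      (Test.reflect x ψ).hasCompactSupport.smul_right⟩
  simp only [covecInner_smul_right, covecInner_dualCovec, mul_comm (Test.reflect x ψ _)] at this
  exact this

theorem comp_swap {m q : ℕ} (η : Covec m (q + 2)) (k l : Fin m) (v : Fin q → Fin m) :
    comp η (Fin.cons l (Fin.cons k v)) = -comp η (Fin.cons k (Fin.cons l v)) := by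
  have h := η.toAlternatingMap.map_swap
    (fun j => basisVec ((Fin.cons k (Fin.cons l v) : Fin (q + 2) → Fin m) j))
    (i := 0) (j := 1) (by simp)
  rw [show comp η (Fin.cons k (Fin.cons l v)) = η.toAlternatingMap
    (fun j => basisVec ((Fin.cons k (Fin.cons l v) : Fin (q + 2) → Fin m) j)) from rfl, ← h]
  change η _ = η _
  congr 1
  ext j : 1
  simp only [Function.comp]
  congr 1
  refine Fin.cases ?_ (fun j => Fin.cases ?_ (fun j => ?_) j) j
  · rw [Equiv.swap_apply_left]; rfl
  · have : (Fin.succ 0 : Fin (q + 2)) = 1 := rfl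
    rw [this, Equiv.swap_apply_right]; rfl
  · rw [Equiv.swap_apply_of_ne_of_ne (Fin.succ_ne_zero _)]
    · simp
    · intro h
      have : j.succ.succ = Fin.succ 0 := h
      exact Fin.succ_ne_zero j (Fin.succ_injective _ this)

section Dv

variable {F F1 : (Fin (p + 1) → Fin (n + 1)) → Test n → Eu n → ℝ → ℝ}

theorem dv_xDiff (h : ∀ v, XDiff Test.d (F v)) (w : Fin p → Fin (n + 1)) :
    XDiff Test.d (dv F w) := fun ψ l x y hy => by
  have := (HasDerivAt.fun_sum fun (k : Fin n) (_ : k ∈ Finset.univ) =>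
    h (Fin.cons k.castSucc w) (Test.d k ψ) l x y hy).neg
  simp only [dv, Test.d_comm _ l]
  exact this

theorem dv_hasDerivAt (h : ∀ v ψ x y, 0 < y → HasDerivAt (F v ψ x) (F1 v ψ x y) y)
    (w : Fin p → Fin (n + 1)) (ψ : Test n) (x : Eu n) (y : ℝ) (hy : 0 < y) :
    HasDerivAt (dv F w ψ x) (dv F1 w ψ x y) y :=
  (HasDerivAt.fun_sum fun (k : Fin n) (_ : k ∈ Finset.univ) =>
    h (Fin.cons k.castSucc w) (Test.d k ψ) x y hy).neg

theorem dv_bdd (h : ∀ v, Bdd (F v)) (w : Fin p → Fin (n + 1)) : Bdd (dv F w) := fun ψ => by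
  choose M hM0 hM using h
  refine ⟨∑ k : Fin n, M (Fin.cons k.castSucc w) (Test.d k ψ),
    Finset.sum_nonneg fun k _ => hM0 _ _, fun x y hy => ?_⟩
  rw [dv, abs_neg]
  exact (Finset.abs_sum_le_sum_abs _ _).trans (Finset.sum_le_sum fun k _ => hM _ _ x y hy)

theorem lap_dv (w : Fin p → Fin (n + 1)) (ψ : Test n) (x : Eu n) (y : ℝ) :
    lap Test.d (dv F w) ψ x y = -∑ k : Fin n,
      lap Test.d (F (Fin.cons k.castSucc w)) (Test.d k ψ) x y := by
  simp only [lap, dv, Finset.sum_neg_distrib]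
  rw [Finset.sum_comm]
  congr 1
  refine Finset.sum_congr rfl fun k _ => Finset.sum_congr rfl fun l _ => ?_
  rw [Test.d_comm k l (Test.d l ψ), Test.d_comm k l ψ]

end Dv

/-- The horizontal divergence of the normal components vanishes: it is a bounded solution, with zero
boundary values, of the scalar extension equation. -/
theorem dv_normal_eq_zero {α : Eu (n + 1) → Covec (n + 1) (p + 2)} {ω : L2Form n (p + 2)}
    (ha : a ∈ Set.Ioo (-1 : ℝ) 1) (hα : IsBoundedExtension a ω α) (w : Fin p → Fin n)
    (ψ : Test n) (x : Eu n) {y : ℝ} (hy : 0 < y) :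
    dv (fun v => cm α (Fin.cons (Fin.last n) v)) (up w) ψ x y = 0 := by
  have hx : ∀ v, XDiff Test.d (cm α (Fin.cons (Fin.last n) v)) := fun v => cm_xDiff hα.regular _
  refine XDiff.eq_zero_of_solution (D := Test.d) (b := a) (c := 0) ha.1 le_rfl (by linarith [ha.2])
    (dv_xDiff hx (up w))
    (dv_hasDerivAt (F1 := fun v => cm1 α (Fin.cons (Fin.last n) v))
      (fun v => cm_hasDerivAt hα.regular _) (up w))
    (dv_hasDerivAt (F1 := fun v => cm2 α (Fin.cons (Fin.last n) v))
      (fun v => cm1_hasDerivAt hα.regular _) (up w))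
    (fun ψ x y hy => ?_) (Bdd.growth (dv_bdd (fun v => cm_bdd hα.bounded _) (up w))) ?_ ψ x hy
  · -- the horizontal codifferential of the tangential part has square zero
    have hanti : ∑ k : Fin n, dv (cm α) (Fin.cons k.castSucc (up w)) (Test.d k ψ) x y = 0 := by
      simp only [dv, Finset.sum_neg_distrib, neg_eq_zero]
      set S := ∑ k : Fin n, ∑ l : Fin n, cm α (Fin.cons l.castSucc (Fin.cons k.castSucc (up w)))
        (Test.d l (Test.d k ψ)) x y with hS
      have : S = -S := by
        conv_lhs => rw [hS, Finset.sum_comm]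
        rw [hS, ← Finset.sum_neg_distrib]
        refine Finset.sum_congr rfl fun k _ => ?_
        rw [← Finset.sum_neg_distrib]
        refine Finset.sum_congr rfl fun l _ => ?_
        rw [Test.d_comm k l ψ, cm, cm, ← mol_neg]
        exact mol_congr_slice (fun t => comp_swap _ _ _ _) _ _
      linarith
    have hl := lap_dv (F := fun v => cm α (Fin.cons (Fin.last n) v)) (up w) ψ x y
    rw [lap] at hl
    rw [hl]
    have h2 : dv (fun v => cm2 α (Fin.cons (Fin.last n) v)) (up w) ψ x y
        = a / y * (-∑ k : Fin n, dv (cm α) (Fin.cons k.castSucc (up w)) (Test.d k ψ) x y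
          - dv (fun v => cm1 α (Fin.cons (Fin.last n) v)) (up w) ψ x y)
          + ∑ k : Fin n, lap Test.d (cm α (Fin.cons (Fin.last n) (Fin.cons k.castSucc (up w))))
            (Test.d k ψ) x y := by
      have e := fun k : Fin n => cm_normal hα (Fin.cons k w) (Test.d k ψ) x hy
      simp only [up_cons] at e
      simp only [dv, e, Finset.sum_sub_distrib, ← Finset.mul_sum]
      simp only [Finset.sum_neg_distrib]
      ring
    rw [h2, hanti]
    ring
  · intro ψ x
    have : Tendsto (fun y => ∑ k : Fin n, cm α (Fin.cons (Fin.last n) (Fin.cons k.castSucc (up w)))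
        (Test.d k ψ) x y) (𝓝[>] 0) (𝓝 (∑ _k : Fin n, 0)) := by
      refine tendsto_finsetSum _ fun k _ => ?_
      have h := tendsto_mol_of_hasBoundaryValue hα.boundary
        (Fin.cons (Fin.last n) (Fin.cons k.castSucc (up w))) (Test.d k ψ) x
      simp only [fun t => comp_pull_eq_zero (ω t) (w := Fin.cons (Fin.last n)
        (Fin.cons k.castSucc (up w))) (j := 0) rfl, conv, zero_mul, integral_zero] at h
      exact h
    have h := this.neg
    simp only [Finset.sum_const_zero, neg_zero] at h
    exact h

section Succ

variable {α : Eu (n + 1) → Covec (n + 1) (p + 1)} {ω : L2Form n (p + 1)}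

theorem sum_normal_eq_zero (ha : a ∈ Set.Ioo (-1 : ℝ) 1) (hα : IsBoundedExtension a ω α)
    (w : Fin p → Fin n) (ψ : Test n) (x : Eu n) {y : ℝ} (hy : 0 < y) :
    ∑ k : Fin n, ∑ j : Fin p, (-1) ^ (j.succ : ℕ) *
      cm α (Fin.cons (Fin.last n) (up (j.succ.removeNth (Fin.cons k w : Fin (p + 1) → Fin n))))
        (Test.d (w j) (Test.d k ψ)) x y = 0 := by
  cases p with
  | zero => simp
  | succ p =>
    rw [Finset.sum_comm]
    refine Finset.sum_eq_zero fun j _ => ?_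
    rw [← Finset.mul_sum]
    have := dv_normal_eq_zero ha hα (j.removeNth w) (Test.d (w j) ψ) x hy
    rw [dv, neg_eq_zero] at this
    simp only [removeNth_succ_cons, up_cons, Test.d_comm (w j)]
    rw [this, mul_zero]

/-- The horizontal codifferential of the extension equation for the tangential part; the terms with the
horizontal divergence of the normal components drop out. -/
theorem dv_cm2 (ha : a ∈ Set.Ioo (-1 : ℝ) 1) (hα : IsBoundedExtension a ω α)
    (w : Fin p → Fin n) (ψ : Test n) (x : Eu n) {y : ℝ} (hy : 0 < y) :
    dv (cm2 α) (up w) ψ x y = -(a / y * dv (cm1 α) (up w) ψ x y) - lap Test.d (dv (cm α) (up w)) ψ x y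
      - a / y * lap Test.d (cm α (Fin.cons (Fin.last n) (up w))) ψ x y := by
  have e : ∀ k : Fin n, cm2 α (Fin.cons k.castSucc (up w)) (Test.d k ψ) x y
      = -lap Test.d (cm α (Fin.cons k.castSucc (up w))) (Test.d k ψ) x y
        - a / y * (cm1 α (Fin.cons k.castSucc (up w)) (Test.d k ψ) x y
          - (cm α (Fin.cons (Fin.last n) (up w)) (Test.d k (Test.d k ψ)) x y
            + ∑ j : Fin p, (-1) ^ (j.succ : ℕ) * cm α (Fin.cons (Fin.last n)
              (up (j.succ.removeNth (Fin.cons k w : Fin (p + 1) → Fin n))))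
                (Test.d (w j) (Test.d k ψ)) x y)) := fun k => by
    have h1 := cm_tangential hα (Fin.cons k w) (Test.d k ψ) x hy
    rw [dm_succ hα.regular _ _ _ hy, Fin.sum_univ_succ] at h1
    simp only [Fin.cons_zero, Fin.cons_succ, Fin.val_zero, pow_zero, one_mul, up_cons] at h1
    have h2 : (Fin.removeNth 0 (Fin.cons k w : Fin (p + 1) → Fin n) : Fin p → Fin n) = w := by
      ext i : 1
      simp [Fin.removeNth]
    rw [h2] at h1
    linarith
  rw [lap_dv]
  simp only [dv, e, Finset.sum_sub_distrib, ← Finset.mul_sum, Finset.sum_neg_distrib,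
    Finset.sum_add_distrib, sum_normal_eq_zero ha hα w ψ x hy, lap]
  ring

theorem tendsto_dv (hα : IsBoundedExtension a ω α) (w : Fin p → Fin n) (ψ : Test n) (x : Eu n) :
    Tendsto (dv (cm α) (up w) ψ x) (𝓝[>] 0)
      (𝓝 (-∑ k, conv (fun t => comp (ω t) (Fin.cons k w)) (Test.d k ψ) x)) := by
  have : Tendsto (fun y => ∑ k : Fin n, cm α (Fin.cons k.castSucc (up w)) (Test.d k ψ) x y) (𝓝[>] 0)
      (𝓝 (∑ k, conv (fun t => comp (ω t) (Fin.cons k w)) (Test.d k ψ) x)) := by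
    refine tendsto_finsetSum _ fun k _ => ?_
    have h := tendsto_mol_of_hasBoundaryValue hα.boundary (Fin.cons k.castSucc (up w))
      (Test.d k ψ) x
    simp only [← up_cons, comp_pull_up] at h
    rw [up_cons] at h
    exact h
  exact this.neg

theorem locallyIntegrable_comp {q : ℕ} (u : L2Form n q) (w : Fin q → Fin n) :
    LocallyIntegrable fun t => comp (u t) w := by
  have h1 : LocallyIntegrable u := (Lp.memLp u).locallyIntegrable (by norm_num)
  refine fun x => ?_
  obtain ⟨s, hs, hs'⟩ := h1 x
  refine ⟨s, hs, Integrable.mono' (Integrable.norm hs') ?_ (Eventually.of_forall fun t =>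
    abs_comp_le _ _)⟩
  exact ((continuous_eval_const (F := Covec n q) _).comp_aestronglyMeasurable
    (Lp.aestronglyMeasurable u)).restrict

/-- The weak codifferential in components, after mollification. -/
theorem conv_weakCodiff {δ : L2Form n p} (h : IsWeakCodiff ω δ) (w : Fin p → Fin n) (ψ : Test n)
    (x : Eu n) : conv (fun t => comp (δ t) w) ψ x
      = -∑ k, conv (fun t => comp (ω t) (Fin.cons k w)) (Test.d k ψ) x := by
  have := h (fun t => Test.reflect x ψ t • dualCovec w)
    ⟨(Test.reflect x ψ).contDiff.smul contDiff_const,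
      (Test.reflect x ψ).hasCompactSupport.smul_right⟩
  simp only [covecInner_smul_right, covecInner_dualCovec, mul_comm (Test.reflect x ψ _),
    fun t => covecInner_extDeriv_smul_dualCovec ((Test.reflect x ψ).differentiable t) (ω t) w,
    Test.fderiv_reflect] at this
  refine this.trans ?_
  rw [integral_finsetSum]
  · rw [← Finset.sum_neg_distrib]
    refine Finset.sum_congr rfl fun k _ => ?_
    rw [conv_eq, ← integral_neg]
    exact integral_congr_ae (Eventually.of_forall fun t => by simp only; ring)
  · intro k _
    have := (integrable_mul_test (locallyIntegrable_comp ω (Fin.cons k w))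
      (Test.reflect x (Test.d k ψ))).neg
    refine this.congr (Eventually.of_forall fun t => ?_)
    simp only [Pi.neg_apply]
    ring

/-- The mollified normal components and the horizontal codifferential of the tangential part. -/
theorem normalSystem (ha : a ∈ Set.Ioo (-1 : ℝ) 1) (hα : IsBoundedExtension a ω α)
    (w : Fin p → Fin n) :
    NormalSystem a Test.d (cm α (Fin.cons (Fin.last n) (up w)))
      (cm1 α (Fin.cons (Fin.last n) (up w))) (dv (cm α) (up w)) (dv (cm1 α) (up w))
      (fun ψ x => -∑ k, conv (fun t => comp (ω t) (Fin.cons k w)) (Test.d k ψ) x) where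
  xu := cm_xDiff hα.regular _
  xu1 := cm1_xDiff hα.regular _
  xδ := dv_xDiff (fun v => cm_xDiff hα.regular v) _
  deriv_u := cm_hasDerivAt hα.regular _
  deriv_u1 ψ x y hy := (cm1_hasDerivAt hα.regular _ ψ x y hy).congr_deriv (cm_normal hα w ψ x hy)
  deriv_δ := dv_hasDerivAt (fun v => cm_hasDerivAt hα.regular v) _
  deriv_δ1 ψ x y hy := (dv_hasDerivAt (fun v => cm1_hasDerivAt hα.regular v) _ ψ x y
    hy).congr_deriv (dv_cm2 ha hα w ψ x hy)
  bdd_u := cm_bdd hα.bounded _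
  bdd_δ := dv_bdd (fun v => cm_bdd hα.bounded v) _
  tendsto_u ψ x := by
    have h := tendsto_mol_of_hasBoundaryValue hα.boundary (Fin.cons (Fin.last n) (up w)) ψ x
    simp only [fun t => comp_pull_eq_zero (ω t) (w := Fin.cons (Fin.last n) (up w)) (j := 0) rfl,
      conv, zero_mul, integral_zero] at h
    exact h
  tendsto_δ := tendsto_dv hα w
  tendsto_v ψ x := by
    obtain ⟨δ, hδ, hb⟩ := hα.boundary_codiff
    have h := tendsto_mol_of_hasBoundaryValue hb (up w) ψ x
    simp only [comp_pull_up] at h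
    rw [conv_weakCodiff hδ] at h
    refine h.congr' ?_
    filter_upwards [self_mem_nhdsWithin] with y hy using mol_codiff hα.regular _ ψ x hy

theorem cm_normal_eq_zero (ha : a ∈ Set.Ioo (-1 : ℝ) 1) (hα : IsBoundedExtension a ω α)
    (w : Fin p → Fin n) (ψ : Test n) (x : Eu n) {y : ℝ} (hy : 0 < y) :
    cm α (Fin.cons (Fin.last n) (up w)) ψ x y = 0 :=
  (normalSystem ha hα w).eq_zero ha.1 ha.2 ψ x hy

end Succ

variable {α : Eu (n + 1) → Covec (n + 1) p} {ω : L2Form n p}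

/-- In the absence of normal components, the vertical part of `dα` is the `y`-derivative of `α`. -/
theorem dm_eq (ha : a ∈ Set.Ioo (-1 : ℝ) 1) (hα : IsBoundedExtension a ω α)
    (w : Fin p → Fin n) (ψ : Test n) (x : Eu n) {y : ℝ} (hy : 0 < y) :
    dm α w ψ x y = cm1 α (up w) ψ x y := by
  cases p with
  | zero => exact dm_zero hα.regular w ψ x hy
  | succ p =>
    rw [dm_succ hα.regular w ψ x hy, Finset.sum_eq_zero, sub_zero]
    intro i _
    rw [cm_normal_eq_zero ha hα _ _ _ hy, mul_zero]

/-- The tangential components solve the scalar extension equation. -/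
theorem cm2_up (ha : a ∈ Set.Ioo (-1 : ℝ) 1) (hα : IsBoundedExtension a ω α)
    (w : Fin p → Fin n) (ψ : Test n) (x : Eu n) {y : ℝ} (hy : 0 < y) :
    cm2 α (up w) ψ x y + a / y * cm1 α (up w) ψ x y + lap Test.d (cm α (up w)) ψ x y = 0 := by
  have := cm_tangential hα w ψ x hy
  rw [dm_eq ha hα w ψ x hy] at this
  linarith

theorem tendsto_cm_up (hα : IsBoundedExtension a ω α) (w : Fin p → Fin n) (ψ : Test n) (x : Eu n) :
    Tendsto (cm α (up w) ψ x) (𝓝[>] 0) (𝓝 (conv (fun t => comp (ω t) w) ψ x)) := by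
  have h := tendsto_mol_of_hasBoundaryValue hα.boundary (up w) ψ x
  simp only [comp_pull_up] at h
  exact h

end Boundary

/-! ### Square integrable forms tested componentwise -/

section Pairing

variable {n p : ℕ}

/-- A component of covectors, as a linear functional. -/
def compL {m p : ℕ} (w : Fin p → Fin m) : Covec m p →L[ℝ] ℝ :=
  LinearMap.toContinuousLinearMap
    { toFun := fun η => comp η w
      map_add' := fun _ _ => rfl
      map_smul' := fun _ _ => rfl }

theorem compL_apply {m p : ℕ} (w : Fin p → Fin m) (η : Covec m p) : compL w η = comp η w := rfl

theorem Test.memLp (ψ : Test n) : MemLp ψ 2 (volume : Measure (Eu n)) :=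
  ψ.continuous.memLp_of_hasCompactSupport ψ.hasCompactSupport

/-- The functional `u ↦ ∫ u_w(t) ψ(x - t) dt` on square integrable forms. -/
def pairL (w : Fin p → Fin n) (ψ : Test n) (x : Eu n) : L2Form n p →L[ℝ] ℝ :=
  (innerSL ℝ (Test.reflect x ψ).memLp.toLp).comp ((compL w).compLpL 2 volume)

theorem pairL_apply (w : Fin p → Fin n) (ψ : Test n) (x : Eu n) (u : L2Form n p) :
    pairL w ψ x u = conv (fun t => comp (u t) w) ψ x := by
  simp only [pairL, ContinuousLinearMap.comp_apply, innerSL_apply_apply, L2.inner_def]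
  refine integral_congr_ae ?_
  filter_upwards [(Test.reflect x ψ).memLp.coeFn_toLp, (compL w).coeFn_compLpL u] with t h1 h2
  rw [h1, h2]
  simp [Test.reflect_apply, compL_apply]

theorem exists_pairL_bound (w : Fin p → Fin n) (ψ : Test n) :
    ∃ C, 0 ≤ C ∧ ∀ x u, |pairL w ψ x u| ≤ C * ‖u‖ := by
  refine ⟨‖ψ.memLp.toLp‖ * ‖(compL w).compLpL (F := ℝ) 2 (volume : Measure (Eu n))‖, by positivity,
    fun x u => ?_⟩
  have h1 : ‖(Test.reflect x ψ).memLp.toLp‖ = ‖ψ.memLp.toLp‖ := by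
    rw [Lp.norm_toLp, Lp.norm_toLp]
    congr 1
    exact eLpNorm_comp_measurePreserving ψ.memLp.1 (Measure.measurePreserving_sub_left volume x)
  rw [← h1]
  refine (norm_inner_le_norm (𝕜 := ℝ) (Test.reflect x ψ).memLp.toLp
    ((compL w).compLpL 2 volume u)).trans ?_
  rw [mul_assoc]
  exact mul_le_mul_of_nonneg_left (ContinuousLinearMap.le_opNorm _ _) (norm_nonneg _)

theorem Test.d_d_reflect (x : Eu n) (ψ : Test n) (k : Fin n) :
    Test.d k (Test.d k (Test.reflect x ψ)) = Test.reflect x (Test.d k (Test.d k ψ)) := by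
  have h : ∀ t, Test.d k (Test.reflect x ψ) t = -Test.reflect x (Test.d k ψ) t := fun t =>
    Test.fderiv_reflect x t ψ k
  ext t
  have h2 : (Test.d k (Test.reflect x ψ)).toFun = fun t => -Test.reflect x (Test.d k ψ) t :=
    funext h
  change fderiv ℝ (Test.d k (Test.reflect x ψ)).toFun t (basisVec k) = _
  rw [h2, fderiv_fun_neg, neg_apply, Test.fderiv_reflect, neg_neg]

theorem Test.reflect_reflect (ψ : Test n) : Test.reflect 0 (Test.reflect 0 ψ) = ψ := by
  ext t
  change ψ (0 - (0 - t)) = ψ t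
  rw [sub_sub_cancel]

/-- The weak Hodge Laplacian acts componentwise. -/
theorem isHodgeLaplacian_iff {u v : L2Form n p} : IsHodgeLaplacian u v ↔
    ∀ w ψ x, pairL w ψ x v = -∑ k, pairL w (Test.d k (Test.d k ψ)) x u := by
  have hI : ∀ (u : L2Form n p) (w : Fin p → Fin n) (χ : Test n),
      Integrable fun t => comp (u t) w * χ t := fun u w χ =>
    integrable_mul_test (locallyIntegrable_comp u w) χ
  have hL : ∀ (φ : Eu n → Covec n p), IsTest φ → ∀ t (w : Fin p → Fin n),
      comp (hodgeLaplacian φ t) w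
        = -∑ k, secondDeriv (fun x => comp (φ x) w) (basisVec k) (basisVec k) t := fun φ hφ t w =>
    hodgeLaplacian_apply ((hφ.1.of_le two_le_top).contDiffAt) _
  constructor
  · intro h w ψ x
    have hφ : IsTest fun t => Test.reflect x ψ t • (dualCovec w : Covec n p) :=
      ⟨(Test.reflect x ψ).contDiff.smul contDiff_const,
        (Test.reflect x ψ).hasCompactSupport.smul_right⟩
    have h1 := h _ hφ
    have h2 : ∀ t, covecInner (u t) (hodgeLaplacian (fun t => Test.reflect x ψ t •
        (dualCovec w : Covec n p)) t)
        = -∑ k, comp (u t) w * Test.reflect x (Test.d k (Test.d k ψ)) t := fun t => by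
      have e : hodgeLaplacian (fun t => Test.reflect x ψ t • (dualCovec w : Covec n p)) t
          = (-∑ k, Test.reflect x (Test.d k (Test.d k ψ)) t) • dualCovec w := by
        refine covec_ext fun w' => ?_
        rw [hL _ hφ]
        have e1 : ∀ k, secondDeriv (fun t => comp (Test.reflect x ψ t • (dualCovec w : Covec n p)) w')
            (basisVec k) (basisVec k) t
            = Test.reflect x (Test.d k (Test.d k ψ)) t * comp (dualCovec w) w' := fun k => by
          rw [← Test.d_d_reflect]
          have e2 : ∀ t, fderiv ℝ (fun t => comp (Test.reflect x ψ t • (dualCovec w : Covec n p)) w') t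
              (basisVec k) = Test.d k (Test.reflect x ψ) t * comp (dualCovec w) w' := fun t => by
            have := ((Test.reflect x ψ).differentiable t).hasFDerivAt.mul_const
              (comp (dualCovec w : Covec n p) w')
            refine (congrArg (fun L : Eu n →L[ℝ] ℝ => L (basisVec k)) this.fderiv).trans ?_
            simp [Test.d_apply, mul_comm]
          simp only [secondDeriv, e2]
          have := ((Test.d k (Test.reflect x ψ)).differentiable t).hasFDerivAt.mul_const
              (comp (dualCovec w : Covec n p) w')
          refine (congrArg (fun L : Eu n →L[ℝ] ℝ => L (basisVec k)) this.fderiv).trans ?_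
          simp [Test.d_apply, mul_comm]
        simp only [e1, ← Finset.sum_mul]
        rw [← neg_mul]
        rfl
      rw [e, covecInner_smul_right, covecInner_dualCovec, ← Finset.mul_sum]
      ring
    simp only [h2, covecInner_smul_right, covecInner_dualCovec, integral_neg] at h1
    rw [integral_finsetSum _ fun k _ => hI u w (Test.reflect x (Test.d k (Test.d k ψ)))] at h1
    simp only [pairL_apply, conv_eq]
    rw [h1]
    simp only [mul_comm]
  · intro h φ hφ
    have hψ : ∀ w : Fin p → Fin n, IsTest fun t => comp (φ t) w := fun w =>
      ⟨(compL w).contDiff.comp hφ.1, hφ.2.comp_left (g := compL w) (map_zero _)⟩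
    set ψ : (Fin p → Fin n) → Test n := fun w => ⟨_, hψ w⟩ with hψd
    have h1 : ∀ w, ∫ t, comp (v t) w * ψ w t
        = -∑ k, ∫ t, comp (u t) w * Test.d k (Test.d k (ψ w)) t := fun w => by
      have := h w (Test.reflect 0 (ψ w)) 0
      simp only [pairL_apply, conv_eq, ← Test.d_d_reflect, Test.reflect_reflect] at this
      exact this
    have h2 : ∀ t, covecInner (u t) (hodgeLaplacian φ t) = (p.factorial : ℝ)⁻¹ *
        ∑ w, -∑ k, comp (u t) w * Test.d k (Test.d k (ψ w)) t := fun t => by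
      rw [covecInner_eq]
      congr 1
      refine Finset.sum_congr rfl fun w _ => ?_
      rw [hL φ hφ, mul_neg, Finset.mul_sum]
      rfl
    have h3 : ∀ t, covecInner (v t) (φ t) = (p.factorial : ℝ)⁻¹ *
        ∑ w, comp (v t) w * ψ w t := fun t => covecInner_eq _ _
    simp only [h2, h3, integral_const_mul]
    congr 1
    have h4 : ∀ w, Integrable fun t => -∑ k, comp (u t) w * Test.d k (Test.d k (ψ w)) t := fun w =>
      (integrable_finsetSum _ fun k _ => hI u w _).neg
    rw [integral_finsetSum _ fun w _ => h4 w,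
      integral_finsetSum _ fun w _ => hI v w (ψ w)]
    refine Finset.sum_congr rfl fun w _ => ?_
    rw [h1, integral_neg, integral_finsetSum _ fun k _ => hI u w _]

theorem L2Form.ext_pairL {u v : L2Form n p} (h : ∀ w ψ, pairL w ψ 0 u = pairL w ψ 0 v) : u = v := by
  refine Lp.ext ?_
  have h1 : ∀ w : Fin p → Fin n, ∀ᵐ t, comp (u t) w = comp (v t) w := fun w =>
    ae_eq_of_conv_eq (locallyIntegrable_comp u w) (locallyIntegrable_comp v w) fun ψ => by
      rw [← pairL_apply, ← pairL_apply]; exact h w ψ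
  filter_upwards [ae_all_iff.2 h1] with t ht using covec_ext ht

end Pairing

/-! ### The heat semigroup -/

section Gauss

variable {n : ℕ}

theorem differentiableAt_conv {f : Eu n → ℝ} (hf : LocallyIntegrable f) (ψ : Test n) (x : Eu n) :
    DifferentiableAt ℝ (conv f ψ) x :=
  (ψ.hasCompactSupport.hasFDerivAt_convolution_right (𝕜 := ℝ)
    (ContinuousLinearMap.mul ℝ ℝ) hf
    (ψ.contDiff.of_le (by exact_mod_cast (le_top : (1 : ℕ∞) ≤ ⊤))) x).differentiableAt

theorem fderiv_conv {f : Eu n → ℝ} (hf : LocallyIntegrable f) (ψ : Test n) (x : Eu n) (k : Fin n) :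
    fderiv ℝ (conv f ψ) x (basisVec k) = conv f (Test.d k ψ) x := by
  have h2 : HasDerivAt (fun s : ℝ => x + s • basisVec k) (basisVec k) 0 := by
    simpa using ((hasDerivAt_id (0 : ℝ)).smul_const (basisVec k)).const_add x
  have h1 := (differentiableAt_conv hf ψ x).hasFDerivAt
  have e : x = x + (0 : ℝ) • basisVec k := by rw [zero_smul, add_zero]
  rw [e] at h1
  have h3 := h1.comp_hasDerivAt 0 h2
  rw [← e] at h3
  exact h3.unique (hasDerivAt_conv hf ψ k x)

theorem sum_basisVec (k : Eu n) : ∑ i, k i • basisVec i = k := by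
  have := (EuclideanSpace.basisFun (Fin n) ℝ).sum_repr k
  simpa [basisVec] using this

theorem integrable_exp_neg_sq {b : ℝ} (hb : 0 < b) :
    Integrable fun k : Eu n => Real.exp (-b * ‖k‖ ^ 2) := by
  by_contra h
  have h1 := GaussianFourier.integral_rexp_neg_mul_sq_norm (V := Eu n) hb
  rw [integral_undef h] at h1
  have : 0 < (Real.pi / b) ^ ((Module.finrank ℝ (Eu n) : ℝ) / 2) := by
    have := Real.pi_pos
    positivity
  linarith

/-- The Gaussian density of the heat kernel at time one. -/
def gauss (k : Eu n) : ℝ :=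
  (∫ k : Eu n, Real.exp (-(1 / 4) * ‖k‖ ^ 2))⁻¹ * Real.exp (-(1 / 4) * ‖k‖ ^ 2)

theorem integral_exp_pos : 0 < ∫ k : Eu n, Real.exp (-(1 / 4) * ‖k‖ ^ 2) := by
  rw [GaussianFourier.integral_rexp_neg_mul_sq_norm (by norm_num)]
  have := Real.pi_pos
  positivity

theorem gauss_nonneg (k : Eu n) : 0 ≤ gauss k :=
  mul_nonneg (inv_nonneg.2 integral_exp_pos.le) (Real.exp_pos _).le

theorem continuous_gauss : Continuous (gauss : Eu n → ℝ) := by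
  unfold gauss; fun_prop

theorem integrable_gauss : Integrable (gauss : Eu n → ℝ) :=
  (integrable_exp_neg_sq (by norm_num)).const_mul _

theorem integral_gauss : ∫ k : Eu n, gauss k = 1 := by
  simp only [gauss]
  rw [integral_const_mul, inv_mul_cancel₀ integral_exp_pos.ne']

theorem integrable_norm_mul_gauss : Integrable fun k : Eu n => ‖k‖ * gauss k := by
  refine Integrable.mono' ((integrable_exp_neg_sq (n := n) (b := 1 / 8) (by norm_num)).const_mul
    (2 * (∫ k : Eu n, Real.exp (-(1 / 4) * ‖k‖ ^ 2))⁻¹))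
    (continuous_norm.mul continuous_gauss).aestronglyMeasurable (Eventually.of_forall fun k => ?_)
  have h0 : 0 < (∫ k : Eu n, Real.exp (-(1 / 4) * ‖k‖ ^ 2))⁻¹ := inv_pos.2 integral_exp_pos
  rw [Real.norm_eq_abs, abs_of_nonneg (mul_nonneg (norm_nonneg _) (gauss_nonneg _)), gauss]
  have h1 : Real.exp (-(1 / 4) * ‖k‖ ^ 2)
      = Real.exp (-(1 / 8) * ‖k‖ ^ 2) * Real.exp (-(1 / 8) * ‖k‖ ^ 2) := by
    rw [← Real.exp_add]; congr 1; ring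
  have h2 : ‖k‖ * Real.exp (-(1 / 8) * ‖k‖ ^ 2) ≤ 2 := by
    have h3 : ‖k‖ ≤ 2 * Real.exp (1 / 8 * ‖k‖ ^ 2) := by
      have := Real.add_one_le_exp (1 / 8 * ‖k‖ ^ 2)
      nlinarith [sq_nonneg (‖k‖ - 2)]
    rw [neg_mul, Real.exp_neg, ← div_eq_mul_inv, div_le_iff₀ (Real.exp_pos _)]
    exact h3
  rw [h1]
  have h4 := Real.exp_pos (-(1 / 8) * ‖k‖ ^ 2)
  calc ‖k‖ * ((∫ k : Eu n, Real.exp (-(1 / 4) * ‖k‖ ^ 2))⁻¹ *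
        (Real.exp (-(1 / 8) * ‖k‖ ^ 2) * Real.exp (-(1 / 8) * ‖k‖ ^ 2)))
      = (‖k‖ * Real.exp (-(1 / 8) * ‖k‖ ^ 2)) * ((∫ k : Eu n, Real.exp (-(1 / 4) * ‖k‖ ^ 2))⁻¹ *
        Real.exp (-(1 / 8) * ‖k‖ ^ 2)) := by ring
    _ ≤ 2 * ((∫ k : Eu n, Real.exp (-(1 / 4) * ‖k‖ ^ 2))⁻¹ *
        Real.exp (-(1 / 8) * ‖k‖ ^ 2)) := by gcongr
    _ = _ := by ring

theorem hasFDerivAt_gauss (k : Eu n) :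
    HasFDerivAt gauss (-(gauss k / 2) • innerSL ℝ k) k := by
  have h1 := (hasStrictFDerivAt_norm_sq k).hasFDerivAt
  have h2 := ((h1.const_mul (-(1 / 4))).exp).const_mul
    (∫ k : Eu n, Real.exp (-(1 / 4) * ‖k‖ ^ 2))⁻¹
  refine h2.congr_fderiv ?_
  ext v
  simp only [gauss, smul_apply, smul_eq_mul, nsmul_eq_mul, Nat.cast_ofNat]
  ring

theorem fderiv_gauss (k : Eu n) (i : Fin n) :
    fderiv ℝ gauss k (basisVec i) = -(k i / 2) * gauss k := by
  rw [(hasFDerivAt_gauss k).fderiv]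
  simp only [smul_apply, smul_eq_mul, innerSL_apply_apply, basisVec,
    EuclideanSpace.inner_single_right]
  simp
  ring

end Gauss

section Heat

variable {n p : ℕ}

/-- Translation of square integrable forms. -/
def trans (h : Eu n) (u : L2Form n p) : L2Form n p :=
  Lp.compMeasurePreserving (fun x => h + x) (measurePreserving_add_left volume h) u

theorem norm_trans (h : Eu n) (u : L2Form n p) : ‖trans h u‖ = ‖u‖ :=
  Lp.norm_compMeasurePreserving _ _

theorem trans_zero (u : L2Form n p) : trans 0 u = u := by
  refine Lp.ext ?_
  filter_upwards [Lp.coeFn_compMeasurePreserving u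
    (measurePreserving_add_left (volume : Measure (Eu n)) 0)] with x hx
  rw [trans, hx]
  simp

theorem continuous_trans (u : L2Form n p) : Continuous fun h => trans h u := by
  let g : Eu n → C(Eu n, Eu n) := fun h => ⟨fun x => h + x, by fun_prop⟩
  have hg : Continuous g := by
    have : Continuous fun q : Eu n × Eu n => q.1 + q.2 := continuous_add
    exact (ContinuousMap.curry ⟨_, this⟩).continuous
  exact Continuous.compMeasurePreservingLp (continuous_const (y := u)) hg
    (fun h => measurePreserving_add_left volume h) (by norm_num)

theorem pairL_trans (w : Fin p → Fin n) (ψ : Test n) (x h : Eu n) (u : L2Form n p) :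
    pairL w ψ x (trans h u) = pairL w ψ (x + h) u := by
  rw [pairL_apply, pairL_apply]
  have h1 := integral_add_left_eq_self (μ := (volume : Measure (Eu n)))
    (fun s => comp (u s) w * ψ (x + h - s)) h
  refine Eq.trans ?_ h1
  refine integral_congr_ae ?_
  filter_upwards [Lp.coeFn_compMeasurePreserving u
    (measurePreserving_add_left (volume : Measure (Eu n)) h)] with t ht
  rw [trans, ht]
  simp only [Function.comp]
  congr 2
  abel

/-- The heat semigroup on square integrable forms: Gaussian averages of translates. -/
def heat (t : ℝ) (u : L2Form n p) : L2Form n p := ∫ k : Eu n, gauss k • trans (√t • k) u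

theorem continuous_heat_integrand (t : ℝ) (u : L2Form n p) :
    Continuous fun k : Eu n => gauss k • trans (√t • k) u :=
  continuous_gauss.smul ((continuous_trans u).comp (by fun_prop))

theorem norm_heat_integrand (t : ℝ) (u : L2Form n p) (k : Eu n) :
    ‖gauss k • trans (√t • k) u‖ = gauss k * ‖u‖ := by
  rw [norm_smul, norm_trans, Real.norm_eq_abs, abs_of_nonneg (gauss_nonneg _)]

theorem integrable_heat (t : ℝ) (u : L2Form n p) :
    Integrable fun k : Eu n => gauss k • trans (√t • k) u :=
  (integrable_gauss.mul_const ‖u‖).mono' (continuous_heat_integrand t u).aestronglyMeasurable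
    (Eventually.of_forall fun k => (norm_heat_integrand t u k).le)

theorem heat_zero (u : L2Form n p) : heat 0 u = u := by
  simp only [heat, Real.sqrt_zero, zero_smul, trans_zero]
  rw [integral_smul_const, integral_gauss, one_smul]

theorem norm_heat_le (t : ℝ) (u : L2Form n p) : ‖heat t u‖ ≤ ‖u‖ := by
  refine (norm_integral_le_of_norm_le (integrable_gauss.mul_const ‖u‖)
    (Eventually.of_forall fun k => (norm_heat_integrand t u k).le)).trans (le_of_eq ?_)
  rw [integral_mul_const, integral_gauss, one_mul]

theorem continuous_heat (u : L2Form n p) : Continuous fun t => heat t u := by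
  refine continuous_of_dominated (fun t => (continuous_heat_integrand t u).aestronglyMeasurable)
    (fun t => Eventually.of_forall fun k => (norm_heat_integrand t u k).le)
    (integrable_gauss.mul_const ‖u‖) (Eventually.of_forall fun k => ?_)
  exact ((continuous_trans u).comp (by fun_prop)).const_smul (gauss k)

theorem pairL_heat (w : Fin p → Fin n) (ψ : Test n) (x : Eu n) (t : ℝ) (u : L2Form n p) :
    pairL w ψ x (heat t u) = ∫ k : Eu n, gauss k * pairL w ψ (x + √t • k) u := by
  rw [heat, ← ContinuousLinearMap.integral_comp_comm _ (integrable_heat t u)]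
  simp only [map_smul, pairL_trans, smul_eq_mul]

theorem pairL_fun_eq (w : Fin p → Fin n) (ψ : Test n) (u : L2Form n p) :
    (fun x => pairL w ψ x u) = conv (fun t => comp (u t) w) ψ :=
  funext fun x => pairL_apply w ψ x u

theorem differentiableAt_pairL (w : Fin p → Fin n) (ψ : Test n) (u : L2Form n p) (x : Eu n) :
    DifferentiableAt ℝ (fun x => pairL w ψ x u) x := by
  rw [pairL_fun_eq]; exact differentiableAt_conv (locallyIntegrable_comp u w) ψ x

theorem fderiv_pairL (w : Fin p → Fin n) (ψ : Test n) (u : L2Form n p) (x : Eu n) (k : Fin n) :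
    fderiv ℝ (fun x => pairL w ψ x u) x (basisVec k) = pairL w (Test.d k ψ) x u := by
  rw [pairL_fun_eq, pairL_apply]; exact fderiv_conv (locallyIntegrable_comp u w) ψ x k

theorem continuous_pairL (w : Fin p → Fin n) (ψ : Test n) (u : L2Form n p) :
    Continuous fun x => pairL w ψ x u :=
  continuous_iff_continuousAt.2 fun x => (differentiableAt_pairL w ψ u x).continuousAt

/-- Gaussian integration by parts. -/
theorem integral_gauss_by_parts (w : Fin p → Fin n) (ψ : Test n) (u : L2Form n p) (x : Eu n) (r : ℝ)
    (i : Fin n) : ∫ k : Eu n, gauss k * (k i * pairL w ψ (x + r • k) u)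
      = 2 * r * ∫ k : Eu n, gauss k * pairL w (Test.d i ψ) (x + r • k) u := by
  obtain ⟨C, hC0, hC⟩ := exists_pairL_bound w ψ
  obtain ⟨C', hC0', hC'⟩ := exists_pairL_bound w (Test.d i ψ)
  have hd : ∀ k : Eu n, HasFDerivAt (fun k : Eu n => pairL w ψ (x + r • k) u)
      ((fderiv ℝ (fun x => pairL w ψ x u) (x + r • k)).comp
        (r • ContinuousLinearMap.id ℝ (Eu n))) k := fun k => by
    have h1 : HasFDerivAt (fun k : Eu n => x + r • k) (r • ContinuousLinearMap.id ℝ (Eu n)) k :=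
      ((hasFDerivAt_id k).const_smul r).const_add x
    exact HasFDerivAt.comp (g := fun x => pairL w ψ x u) k
      (differentiableAt_pairL w ψ u (x + r • k)).hasFDerivAt h1
  have he : ∀ k : Eu n, fderiv ℝ (fun k : Eu n => pairL w ψ (x + r • k) u) k (basisVec i)
      = r * pairL w (Test.d i ψ) (x + r • k) u := fun k => by
    rw [(hd k).fderiv, ContinuousLinearMap.comp_apply]
    simp only [smul_apply, ContinuousLinearMap.id_apply, map_smul, fderiv_pairL, smul_eq_mul]
  have hc : ∀ ψ : Test n, Continuous fun k : Eu n => pairL w ψ (x + r • k) u := fun ψ =>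
    (continuous_pairL w ψ u).comp (by fun_prop)
  have hki : ∀ k : Eu n, |k i| ≤ ‖k‖ := fun k => by simpa using PiLp.norm_apply_le k i
  have hci : Continuous fun k : Eu n => k i := by fun_prop
  have key := integral_mul_fderiv_eq_neg_fderiv_mul_of_integrable (μ := (volume : Measure (Eu n)))
    (f := fun k => pairL w ψ (x + r • k) u) (g := gauss) (v := basisVec i) ?_ ?_ ?_
    (fun k _ => (hd k).differentiableAt) (fun k _ => (hasFDerivAt_gauss k).differentiableAt)
  · simp only [he, fderiv_gauss] at key
    have e1 : ∫ k : Eu n, pairL w ψ (x + r • k) u * (-(k i / 2) * gauss k)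
        = -(1 / 2) * ∫ k : Eu n, gauss k * (k i * pairL w ψ (x + r • k) u) := by
      rw [← integral_const_mul]
      exact integral_congr_ae (Eventually.of_forall fun k => by simp only; ring)
    have e2 : ∫ k : Eu n, r * pairL w (Test.d i ψ) (x + r • k) u * gauss k
        = r * ∫ k : Eu n, gauss k * pairL w (Test.d i ψ) (x + r • k) u := by
      rw [← integral_const_mul]
      exact integral_congr_ae (Eventually.of_forall fun k => by simp only; ring)
    rw [e1, e2] at key
    linarith
  · simp only [he]
    refine Integrable.mono' (integrable_gauss.const_mul (|r| * (C' * ‖u‖)))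
      (((hc _).const_smul r).mul continuous_gauss).aestronglyMeasurable
      (Eventually.of_forall fun k => ?_)
    rw [norm_mul, norm_mul, Real.norm_eq_abs, Real.norm_eq_abs, Real.norm_eq_abs,
      abs_of_nonneg (gauss_nonneg k)]
    have := gauss_nonneg k
    gcongr
    exact hC' _ _
  · simp only [fderiv_gauss]
    refine Integrable.mono' (integrable_norm_mul_gauss.const_mul (C * ‖u‖))
      ((hc _).mul (((hci.div_const 2).neg).mul continuous_gauss)).aestronglyMeasurable
      (Eventually.of_forall fun k => ?_)
    rw [norm_mul, norm_mul, norm_neg, norm_div, Real.norm_eq_abs, Real.norm_eq_abs,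
      Real.norm_eq_abs, Real.norm_eq_abs, abs_of_nonneg (gauss_nonneg k)]
    have := gauss_nonneg k
    have h2 : |k i| / |(2 : ℝ)| ≤ ‖k‖ := by
      rw [abs_two]; linarith [hki k, abs_nonneg (k i)]
    gcongr
    exact hC _ _
  · refine Integrable.mono' (integrable_gauss.const_mul (C * ‖u‖))
      ((hc _).mul continuous_gauss).aestronglyMeasurable (Eventually.of_forall fun k => ?_)
    rw [norm_mul, Real.norm_eq_abs, Real.norm_eq_abs, abs_of_nonneg (gauss_nonneg k)]
    have := gauss_nonneg k
    gcongr
    exact hC _ _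

/-- The weak form of the heat equation. -/
theorem hasDerivAt_pairL_heat (w : Fin p → Fin n) (ψ : Test n) (x : Eu n) (u : L2Form n p) {t : ℝ}
    (ht : 0 < t) : HasDerivAt (fun t => pairL w ψ x (heat t u))
      (∑ k, pairL w (Test.d k (Test.d k ψ)) x (heat t u)) t := by
  choose C hC0 hC using fun i => exists_pairL_bound w (Test.d i ψ)
  obtain ⟨C', hC0', hC'⟩ := exists_pairL_bound w ψ
  have hki : ∀ (k : Eu n) i, |k i| ≤ ‖k‖ := fun k i => by simpa using PiLp.norm_apply_le k i
  have hc : ∀ (ψ : Test n) (r : ℝ), Continuous fun k : Eu n => pairL w ψ (x + r • k) u := fun ψ r =>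
    (continuous_pairL w ψ u).comp (by fun_prop)
  have hd : ∀ k : Eu n, ∀ s, 0 < s → HasDerivAt (fun s => pairL w ψ (x + √s • k) u)
      (1 / (2 * √s) * ∑ i, k i * pairL w (Test.d i ψ) (x + √s • k) u) s := fun k s hs => by
    have h1 := (differentiableAt_pairL w ψ u (x + √s • k)).hasFDerivAt.comp_hasDerivAt s
      (((Real.hasDerivAt_sqrt hs.ne').smul_const k).const_add x)
    refine h1.congr_deriv ?_
    conv_lhs => rw [← sum_basisVec k]
    simp only [map_smul, map_sum, fderiv_pairL, smul_eq_mul]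
    rw [sum_basisVec]
  have key := (hasDerivAt_integral_of_dominated_loc_of_deriv_le (μ := (volume : Measure (Eu n)))
    (F := fun s k => gauss k * pairL w ψ (x + √s • k) u)
    (F' := fun s k => gauss k * (1 / (2 * √s) * ∑ i, k i * pairL w (Test.d i ψ) (x + √s • k) u))
    (bound := fun k => 1 / (2 * √(t / 2)) * (∑ i, C i * ‖u‖) * (‖k‖ * gauss k)) (x₀ := t)
    (s := Set.Ioi (t / 2)) (Ioi_mem_nhds (by linarith)) ?_ ?_ ?_ ?_ ?_ ?_).2
  · have e : (fun t => pairL w ψ x (heat t u))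
        = fun t => ∫ k : Eu n, gauss k * pairL w ψ (x + √t • k) u :=
      funext fun t => pairL_heat w ψ x t u
    rw [e]
    refine key.congr_deriv ?_
    have hst : √t ≠ 0 := (Real.sqrt_pos.2 ht).ne'
    have e1 : ∀ k : Eu n, gauss k * (1 / (2 * √t) * ∑ i, k i * pairL w (Test.d i ψ) (x + √t • k) u)
        = ∑ i, 1 / (2 * √t) * (gauss k * (k i * pairL w (Test.d i ψ) (x + √t • k) u)) := fun k => by
      rw [Finset.mul_sum, Finset.mul_sum]
      exact Finset.sum_congr rfl fun i _ => by ring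
    simp only [e1]
    rw [integral_finsetSum]
    · refine Finset.sum_congr rfl fun i _ => ?_
      rw [integral_const_mul, integral_gauss_by_parts, pairL_heat]
      field_simp
    · intro i _
      refine Integrable.const_mul ?_ _
      refine Integrable.mono' (integrable_norm_mul_gauss.const_mul (C i * ‖u‖))
        (continuous_gauss.mul ((by fun_prop : Continuous fun k : Eu n => k i).mul
          (hc _ _))).aestronglyMeasurable (Eventually.of_forall fun k => ?_)
      rw [norm_mul, norm_mul, Real.norm_eq_abs, Real.norm_eq_abs, Real.norm_eq_abs,
        abs_of_nonneg (gauss_nonneg k)]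
      have := gauss_nonneg k
      calc gauss k * (|k i| * |pairL w (Test.d i ψ) (x + √t • k) u|)
          ≤ gauss k * (‖k‖ * (C i * ‖u‖)) := by
            gcongr
            · exact hki k i
            · exact hC i _ _
        _ = _ := by ring
  · exact Eventually.of_forall fun s => (continuous_gauss.mul (hc _ _)).aestronglyMeasurable
  · refine Integrable.mono' (integrable_gauss.const_mul (C' * ‖u‖))
      (continuous_gauss.mul (hc _ _)).aestronglyMeasurable (Eventually.of_forall fun k => ?_)
    rw [norm_mul, Real.norm_eq_abs, Real.norm_eq_abs, abs_of_nonneg (gauss_nonneg k), mul_comm]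
    exact mul_le_mul_of_nonneg_right (hC' _ _) (gauss_nonneg k)
  · refine (continuous_gauss.mul (continuous_const.mul
      (continuous_finsetSum _ fun i _ => ?_))).aestronglyMeasurable
    exact (by fun_prop : Continuous fun k : Eu n => k i).mul (hc _ _)
  · refine Eventually.of_forall fun k s hs => ?_
    have hs' : t / 2 < s := hs
    have hs0 : 0 < s := by linarith
    have h1 : 1 / (2 * √s) ≤ 1 / (2 * √(t / 2)) := by
      have : 0 < √(t / 2) := Real.sqrt_pos.2 (by linarith)
      have : √(t / 2) ≤ √s := Real.sqrt_le_sqrt hs'.le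
      gcongr
    have h2 : |∑ i, k i * pairL w (Test.d i ψ) (x + √s • k) u| ≤ ‖k‖ * ∑ i, C i * ‖u‖ := by
      rw [Finset.mul_sum]
      refine (Finset.abs_sum_le_sum_abs _ _).trans (Finset.sum_le_sum fun i _ => ?_)
      rw [abs_mul]
      exact mul_le_mul (hki k i) (hC i _ _) (abs_nonneg _) (norm_nonneg _)
    have h3 := gauss_nonneg k
    have h4 : 0 ≤ 1 / (2 * √s) := by positivity
    rw [norm_mul, norm_mul, Real.norm_eq_abs, Real.norm_eq_abs, Real.norm_eq_abs,
      abs_of_nonneg h3, abs_of_nonneg h4]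
    calc gauss k * (1 / (2 * √s) * |∑ i, k i * pairL w (Test.d i ψ) (x + √s • k) u|)
        ≤ gauss k * (1 / (2 * √(t / 2)) * (‖k‖ * ∑ i, C i * ‖u‖)) := by gcongr
      _ = _ := by ring
  · exact integrable_norm_mul_gauss.const_mul _
  · refine Eventually.of_forall fun k s hs => ?_
    have hs' : t / 2 < s := hs
    exact (hd k s (by linarith)).const_mul _

theorem isHodgeLaplacian_heat {u v : L2Form n p} (h : IsHodgeLaplacian u v) (t : ℝ) :
    IsHodgeLaplacian (heat t u) (heat t v) := by
  rw [isHodgeLaplacian_iff] at h ⊢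
  intro w ψ x
  simp only [pairL_heat, h, mul_neg, Finset.mul_sum, integral_neg]
  rw [integral_finsetSum]
  intro k _
  have := ContinuousLinearMap.integrable_comp (pairL w (Test.d k (Test.d k ψ)) x)
    (integrable_heat t u)
  simpa only [map_smul, pairL_trans, smul_eq_mul] using this

/-- Duhamel's formula, obtained from its weak form. -/
theorem heat_eq {u v : L2Form n p} (h : IsHodgeLaplacian u v) {t : ℝ} (ht : 0 ≤ t) :
    heat t u = u - ∫ s in (0 : ℝ)..t, heat s v := by
  refine L2Form.ext_pairL fun w ψ => ?_
  have hint : IntervalIntegrable (fun s => heat s v) volume 0 t :=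
    (continuous_heat v).intervalIntegrable _ _
  rw [map_sub, ← ContinuousLinearMap.intervalIntegral_comp_comm _ hint]
  have h1 := intervalIntegral.integral_eq_sub_of_hasDerivAt_of_le (f := fun t =>
    pairL w ψ 0 (heat t u)) (f' := fun t => -pairL w ψ 0 (heat t v)) ht
    ((pairL w ψ 0).continuous.comp (continuous_heat u)).continuousOn
    (fun s hs => (hasDerivAt_pairL_heat w ψ 0 u hs.1).congr_deriv (by
      rw [isHodgeLaplacian_iff.1 (isHodgeLaplacian_heat h s), neg_neg]))
    (((pairL w ψ 0).continuous.comp (continuous_heat v)).neg.intervalIntegrable _ _)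
  rw [intervalIntegral.integral_neg, heat_zero] at h1
  linarith

theorem hasDerivAt_heat {u v : L2Form n p} (h : IsHodgeLaplacian u v) {t : ℝ} (ht : 0 < t) :
    HasDerivAt (fun t => heat t u) (-heat t v) t := by
  have h1 := ((continuous_heat v).integral_hasStrictDerivAt 0 t).hasDerivAt.const_sub u
  refine h1.congr_of_eventuallyEq ?_
  filter_upwards [lt_mem_nhds ht] with s hs using heat_eq h hs.le

theorem isHeatFlow_heat {u v : L2Form n p} (h : IsHodgeLaplacian u v) :
    IsHeatFlow u fun t => heat t u :=
  ⟨(continuous_heat u).continuousOn, heat_zero u, fun t ht =>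
    ⟨heat t v, isHodgeLaplacian_heat h t, hasDerivAt_heat h ht⟩⟩

theorem norm_heat_sub_le {u v : L2Form n p} (h : IsHodgeLaplacian u v) {t : ℝ} (ht : 0 ≤ t) :
    ‖heat t u - u‖ ≤ ‖v‖ * t := by
  rw [heat_eq h ht, sub_sub_cancel_left, norm_neg]
  have := intervalIntegral.norm_integral_le_of_norm_le_const (a := 0) (b := t)
    (f := fun s => heat s v) (C := ‖v‖) fun s _ => norm_heat_le s v
  rwa [sub_zero, abs_of_nonneg ht] at this

end Heat

/-! ### Subordination integrals -/

section Subordination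

variable {E : Type*} [NormedAddCommGroup E] [NormedSpace ℝ E] {γ : ℝ} {η : ℝ → E}

/-- Functions on the half-line that are continuous, bounded, and of at least linear decay at `0`;
the differences `exp(-tΔ) u - u` are of this kind for `u` in the domain of `Δ`. -/
structure IsIncrement (η : ℝ → E) : Prop where
  cont : ContinuousOn η (Set.Ioi 0)
  bdd : ∃ B, ∀ t, 0 < t → ‖η t‖ ≤ B
  small : ∃ B, ∀ t, 0 < t → ‖η t‖ ≤ B * t

theorem continuousOn_weight (γ : ℝ) : ContinuousOn (fun t : ℝ => t ^ (-(1 + γ))) (Set.Ioi 0) :=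
  fun t ht => (Real.continuousAt_rpow_const t _ (Or.inl (ne_of_gt ht))).continuousWithinAt

theorem IsIncrement.continuousOn_weight_smul (h : IsIncrement η) (γ : ℝ) :
    ContinuousOn (fun t : ℝ => t ^ (-(1 + γ)) • η t) (Set.Ioi 0) :=
  (continuousOn_weight γ).smul h.cont

theorem IsIncrement.integrableOn (h : IsIncrement η) (hγ : γ ∈ Set.Ioo (0 : ℝ) 1) :
    IntegrableOn (fun t : ℝ => t ^ (-(1 + γ)) • η t) (Set.Ioi 0) := by
  obtain ⟨B, hB⟩ := h.bdd
  obtain ⟨B', hB'⟩ := h.small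
  rw [← Set.Ioc_union_Ioi_eq_Ioi (zero_le_one (α := ℝ))]
  refine IntegrableOn.union ?_ ?_
  · have h1 : IntegrableOn (fun t : ℝ => B' * t ^ (-γ)) (Set.Ioc 0 1) :=
      ((intervalIntegrable_iff_integrableOn_Ioc_of_le zero_le_one).1
        (intervalIntegral.intervalIntegrable_rpow' (by linarith [hγ.2]))).const_mul B'
    refine Integrable.mono' h1 ?_ ?_
    · exact ((h.continuousOn_weight_smul γ).mono
        (fun t ht => ht.1)).aestronglyMeasurable measurableSet_Ioc
    · filter_upwards [ae_restrict_mem measurableSet_Ioc] with t ht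
      have e : t ^ (-γ) = t ^ (-(1 + γ)) * t := by
        rw [← Real.rpow_add_one ht.1.ne']; congr 1; ring
      rw [norm_smul, Real.norm_eq_abs, abs_of_nonneg (Real.rpow_nonneg ht.1.le _), e]
      have := mul_le_mul_of_nonneg_left (hB' t ht.1) (Real.rpow_nonneg ht.1.le (-(1 + γ)))
      linarith
  · have h1 : IntegrableOn (fun t : ℝ => B * t ^ (-(1 + γ))) (Set.Ioi 1) :=
      (integrableOn_Ioi_rpow_of_lt (by linarith [hγ.1]) zero_lt_one).const_mul B
    have hpos : ∀ t ∈ Set.Ioi (1 : ℝ), 0 < t := fun t ht => zero_lt_one.trans ht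
    refine Integrable.mono' h1 ?_ ?_
    · exact ((h.continuousOn_weight_smul γ).mono hpos).aestronglyMeasurable measurableSet_Ioi
    · filter_upwards [ae_restrict_mem measurableSet_Ioi] with t ht
      have h0 := hpos t ht
      rw [norm_smul, Real.norm_eq_abs, abs_of_nonneg (Real.rpow_nonneg h0.le _), mul_comm B]
      exact mul_le_mul_of_nonneg_left (hB t h0) (Real.rpow_nonneg h0.le _)

/-- The integral of `g(y²/t) t^(-1-γ) η(t)` over the half-line. -/
def subInt (γ : ℝ) (η : ℝ → E) (g : ℝ → ℝ) (y : ℝ) : E :=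
  ∫ t in Set.Ioi (0 : ℝ), g (y ^ 2 / t) • (t ^ (-(1 + γ)) • η t)

theorem continuousOn_comp_div {g : ℝ → ℝ} (hg : Continuous g) (y : ℝ) :
    ContinuousOn (fun t : ℝ => g (y ^ 2 / t)) (Set.Ioi 0) :=
  hg.comp_continuousOn (continuousOn_const.div continuousOn_id fun _ ht => ne_of_gt ht)

theorem IsIncrement.integrableOn_subInt (h : IsIncrement η) (hγ : γ ∈ Set.Ioo (0 : ℝ) 1)
    {g : ℝ → ℝ} (hg : Continuous g) {M : ℝ} (hM : ∀ s, 0 ≤ s → |g s| ≤ M) (y : ℝ) :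
    IntegrableOn (fun t : ℝ => g (y ^ 2 / t) • (t ^ (-(1 + γ)) • η t)) (Set.Ioi 0) := by
  refine Integrable.mono' ((h.integrableOn hγ).norm.const_mul M)
    (((continuousOn_comp_div hg y).smul
      (h.continuousOn_weight_smul γ)).aestronglyMeasurable measurableSet_Ioi) ?_
  filter_upwards [ae_restrict_mem measurableSet_Ioi] with t ht
  rw [norm_smul]
  exact mul_le_mul_of_nonneg_right (hM _ (div_nonneg (sq_nonneg y) (le_of_lt ht))) (norm_nonneg _)

theorem IsIncrement.hasDerivAt_subInt (hη : IsIncrement η) (hγ : γ ∈ Set.Ioo (0 : ℝ) 1)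
    {g h : ℝ → ℝ} (hg : Continuous g) (hh : Continuous h)
    (hgh : ∀ s, 0 < s → HasDerivAt g (h s / s) s) {M M' : ℝ} (hM : ∀ s, 0 ≤ s → |g s| ≤ M)
    (hM' : ∀ s, 0 ≤ s → |h s| ≤ M') {y : ℝ} (hy : 0 < y) :
    HasDerivAt (subInt γ η g) ((2 / y) • subInt γ η h y) y := by
  have hM0 : 0 ≤ M' := (abs_nonneg _).trans (hM' 0 le_rfl)
  have key := (hasDerivAt_integral_of_dominated_loc_of_deriv_le
    (μ := volume.restrict (Set.Ioi (0 : ℝ)))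
    (F := fun y t => g (y ^ 2 / t) • (t ^ (-(1 + γ)) • η t))
    (F' := fun y t => (2 / y * h (y ^ 2 / t)) • (t ^ (-(1 + γ)) • η t))
    (bound := fun t => 2 / (y / 2) * M' * ‖t ^ (-(1 + γ)) • η t‖) (x₀ := y)
    (s := Set.Ioi (y / 2)) (Ioi_mem_nhds (by linarith)) ?_ ?_ ?_ ?_ ?_ ?_).2
  · refine key.congr_deriv ?_
    rw [subInt, ← integral_smul]
    simp only [mul_smul]
  · exact Eventually.of_forall fun s => (hη.integrableOn_subInt hγ hg hM s).1
  · exact hη.integrableOn_subInt hγ hg hM y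
  · have := (Integrable.smul (2 / y) (hη.integrableOn_subInt hγ hh hM' y)).1
    refine this.congr (Eventually.of_forall fun t => ?_)
    simp only [Pi.smul_apply, mul_smul]
  · filter_upwards [ae_restrict_mem measurableSet_Ioi] with t ht s hs
    have hs' : y / 2 < s := hs
    have hs0 : 0 < s := by linarith
    rw [norm_smul, norm_mul, Real.norm_eq_abs, Real.norm_eq_abs, abs_of_pos (by positivity)]
    have h1 := hM' (s ^ 2 / t) (div_nonneg (sq_nonneg s) (le_of_lt ht))
    gcongr
  · exact (hη.integrableOn hγ).norm.const_mul _
  · filter_upwards [ae_restrict_mem measurableSet_Ioi] with t ht s hs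
    have ht' : 0 < t := ht
    have hs' : y / 2 < s := hs
    have hs0 : 0 < s := by linarith
    have h1 := (hgh (s ^ 2 / t) (by positivity)).comp s (((hasDerivAt_pow 2 s).div_const t))
    refine (h1.congr_deriv ?_).smul_const _
    field_simp
    ring

theorem IsIncrement.tendsto_subInt (hη : IsIncrement η) (hγ : γ ∈ Set.Ioo (0 : ℝ) 1)
    {g : ℝ → ℝ} (hg : Continuous g) {M : ℝ} (hM : ∀ s, 0 ≤ s → |g s| ≤ M) :
    Tendsto (subInt γ η g) (𝓝[>] 0)
      (𝓝 (g 0 • ∫ t in Set.Ioi (0 : ℝ), t ^ (-(1 + γ)) • η t)) := by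
  rw [← integral_smul]
  refine tendsto_integral_filter_of_dominated_convergence
    (fun t => M * ‖t ^ (-(1 + γ)) • η t‖) ?_ ?_ ((hη.integrableOn hγ).norm.const_mul _) ?_
  · exact Eventually.of_forall fun s => (hη.integrableOn_subInt hγ hg hM s).1
  · refine Eventually.of_forall fun y => ?_
    filter_upwards [ae_restrict_mem measurableSet_Ioi] with t ht
    rw [norm_smul]
    exact mul_le_mul_of_nonneg_right (hM _ (div_nonneg (sq_nonneg y) (le_of_lt ht))) (norm_nonneg _)
  · refine Eventually.of_forall fun t => Tendsto.smul_const ?_ _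
    have : Continuous fun y : ℝ => g (y ^ 2 / t) := by fun_prop
    refine (this.tendsto' 0 (g 0) (by simp)).mono_left nhdsWithin_le_nhds

/-- The profile of the subordination kernel of the extension problem. -/
def profile (s : ℝ) : ℝ := Real.exp (-s / 4)

/-- The Euler derivative `s ∂/∂s` of the profile. -/
def profile1 (s : ℝ) : ℝ := -(s / 4) * Real.exp (-s / 4)

/-- The second Euler derivative `(s ∂/∂s)²` of the profile. -/
def profile2 (s : ℝ) : ℝ := ((s / 4) ^ 2 - s / 4) * Real.exp (-s / 4)

theorem continuous_profile : Continuous profile := by unfold profile; fun_prop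

theorem continuous_profile1 : Continuous profile1 := by unfold profile1; fun_prop

theorem continuous_profile2 : Continuous profile2 := by unfold profile2; fun_prop

theorem hasDerivAt_profile (s : ℝ) : HasDerivAt profile (-(1 / 4) * Real.exp (-s / 4)) s :=
  (((hasDerivAt_id' s).fun_neg.div_const 4).exp).congr_deriv (by ring)

theorem hasDerivAt_profile_euler (s : ℝ) (hs : 0 < s) : HasDerivAt profile (profile1 s / s) s :=
  (hasDerivAt_profile s).congr_deriv (by unfold profile1; field_simp)

theorem hasDerivAt_profile1_euler (s : ℝ) (hs : 0 < s) : HasDerivAt profile1 (profile2 s / s) s := by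
  have h := ((hasDerivAt_id' s).div_const 4).fun_neg.fun_mul (hasDerivAt_profile s)
  refine HasDerivAt.congr_deriv (f := profile1) h ?_
  unfold profile profile2
  field_simp
  ring

theorem abs_exp_mul_le {q s M : ℝ} (hq : |q| ≤ M * Real.exp (s / 4)) :
    |q * Real.exp (-s / 4)| ≤ M := by
  rw [abs_mul, abs_of_pos (Real.exp_pos _), neg_div, Real.exp_neg, ← div_eq_mul_inv,
    div_le_iff₀ (Real.exp_pos _)]
  exact hq

theorem abs_profile_le (s : ℝ) (hs : 0 ≤ s) : |profile s| ≤ 1 := by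
  rw [profile, abs_of_pos (Real.exp_pos _)]
  exact Real.exp_le_one_iff.2 (by linarith)

theorem profile_pos (s : ℝ) : 0 < profile s := Real.exp_pos _

theorem abs_profile1_le (s : ℝ) (hs : 0 ≤ s) : |profile1 s| ≤ 1 := by
  refine abs_exp_mul_le ?_
  rw [abs_neg, abs_of_nonneg (by positivity), one_mul]
  linarith [Real.add_one_le_exp (s / 4)]

theorem abs_profile2_le (s : ℝ) (hs : 0 ≤ s) : |profile2 s| ≤ 2 := by
  refine abs_exp_mul_le ?_
  have h1 := Real.quadratic_le_exp_of_nonneg (show 0 ≤ s / 4 by positivity)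
  have h2 : 0 ≤ s / 4 := by positivity
  rw [abs_le]
  constructor <;> nlinarith

theorem profile_div_le {y t : ℝ} (hy : 0 < y) (ht : 0 < t) : profile (y ^ 2 / t) ≤ 4 / y ^ 2 * t := by
  rw [profile, neg_div, Real.exp_neg]
  have h : y ^ 2 / t / 4 ≤ Real.exp (y ^ 2 / t / 4) := by
    linarith [Real.add_one_le_exp (y ^ 2 / t / 4)]
  refine (inv_anti₀ (by positivity) h).trans (le_of_eq ?_)
  field_simp

theorem isIncrement_profile {y : ℝ} (hy : 0 < y) : IsIncrement fun t : ℝ => profile (y ^ 2 / t) where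
  cont := continuousOn_comp_div continuous_profile y
  bdd := ⟨1, fun t ht => abs_profile_le _ (by positivity)⟩
  small := ⟨4 / y ^ 2, fun t ht => by
    rw [Real.norm_eq_abs, abs_of_pos (profile_pos _)]
    exact profile_div_le hy ht⟩

/-- The mass of the kernel `exp(-y²/4t) t^(-1-γ)`. -/
def mass (γ y : ℝ) : ℝ := ∫ t in Set.Ioi (0 : ℝ), t ^ (-(1 + γ)) • profile (y ^ 2 / t)

theorem mass_pos (hγ : γ ∈ Set.Ioo (0 : ℝ) 1) {y : ℝ} (hy : 0 < y) : 0 < mass γ y := by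
  have hpos : ∀ t ∈ Set.Ioi (0 : ℝ), 0 < t ^ (-(1 + γ)) • profile (y ^ 2 / t) := fun t ht =>
    mul_pos (Real.rpow_pos_of_pos ht _) (profile_pos _)
  refine (setIntegral_pos_iff_support_of_nonneg_ae ?_
    ((isIncrement_profile hy).integrableOn hγ)).2 ?_
  · filter_upwards [ae_restrict_mem measurableSet_Ioi] with t ht using (hpos t ht).le
  · have : Function.support (fun t : ℝ => t ^ (-(1 + γ)) • profile (y ^ 2 / t)) ∩ Set.Ioi 0
        = Set.Ioi 0 := Set.inter_eq_right.2 fun t ht => (hpos t ht).ne'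
    rw [this, Real.volume_Ioi]
    exact ENNReal.zero_lt_top

/-- The substitution `t = y² s`. -/
theorem rpow_mul_mass (γ : ℝ) {y : ℝ} (hy : 0 < y) : y ^ (2 * γ) * mass γ y = mass γ 1 := by
  have h := integral_comp_mul_left_Ioi' (fun t : ℝ => t ^ (-(1 + γ)) • profile (y ^ 2 / t)) 0
    (b := y ^ 2) (by positivity)
  rw [mul_zero] at h
  rw [mass, ← h, smul_eq_mul, ← mul_assoc, mass, ← integral_const_mul]
  refine setIntegral_congr_fun measurableSet_Ioi fun t ht => ?_
  have ht' : 0 < t := ht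
  have e : y ^ (2 * γ) * y ^ 2 * (y ^ 2) ^ (-(1 + γ)) = 1 := by
    rw [← Real.rpow_natCast, ← Real.rpow_mul hy.le, ← Real.rpow_add hy, ← Real.rpow_add hy]
    convert Real.rpow_zero y using 2
    push_cast
    ring
  have e2 : y ^ 2 / (y ^ 2 * t) = 1 ^ 2 / t := by field_simp
  simp only [smul_eq_mul]
  rw [e2, Real.mul_rpow (by positivity) ht'.le, ← mul_assoc, ← mul_assoc, e, one_mul]

theorem norm_subInt_profile_le (hγ : γ ∈ Set.Ioo (0 : ℝ) 1) {B : ℝ}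
    (hB : ∀ t, 0 < t → ‖η t‖ ≤ B) {y : ℝ} (hy : 0 < y) :
    ‖subInt γ η profile y‖ ≤ B * mass γ y := by
  rw [mass, ← integral_const_mul]
  refine norm_integral_le_of_norm_le (((isIncrement_profile hy).integrableOn hγ).const_mul B) ?_
  filter_upwards [ae_restrict_mem measurableSet_Ioi] with t ht
  rw [norm_smul, norm_smul, Real.norm_eq_abs, Real.norm_eq_abs, abs_of_pos (profile_pos _),
    abs_of_pos (Real.rpow_pos_of_pos ht _), smul_eq_mul]
  have h1 := (profile_pos (y ^ 2 / t)).le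
  have h2 := Real.rpow_nonneg (le_of_lt ht) (-(1 + γ))
  calc profile (y ^ 2 / t) * (t ^ (-(1 + γ)) * ‖η t‖)
      ≤ profile (y ^ 2 / t) * (t ^ (-(1 + γ)) * B) := by gcongr; exact hB t ht
    _ = _ := by ring

/-- As functions of `(t, y)`, the kernel `k = y^(2γ) exp(-y²/4t) t^(-1-γ)` satisfies
`∂²k/∂y² + (1 - 2γ)/y ∂k/∂y = ∂k/∂t`; the factor `y^(2γ)` is left out here. -/
theorem hasDerivAt_kernel (γ : ℝ) {y t : ℝ} (hy : 0 < y) (ht : 0 < t) :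
    HasDerivAt (fun t : ℝ => t ^ (-(1 + γ)) * profile (y ^ 2 / t))
      (4 / y ^ 2 * (t ^ (-(1 + γ)) * (γ * profile1 (y ^ 2 / t) + profile2 (y ^ 2 / t)))) t := by
  have h1 := Real.hasDerivAt_rpow_const (x := t) (p := -(1 + γ)) (Or.inl ht.ne')
  have h2 := (hasDerivAt_profile (y ^ 2 / t)).comp t ((hasDerivAt_inv ht.ne').const_mul (y ^ 2))
  refine (h1.fun_mul h2).congr_deriv ?_
  rw [Real.rpow_sub_one ht.ne']
  simp only [Function.comp, profile, profile1, profile2]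
  field_simp
  ring

/-- Integration by parts in `t` for the subordination integral of a weak solution `η + u` of the heat
equation: `L` and `M` stand for the pairings with a test form and with its Laplacian. -/
theorem IsIncrement.subInt_heat (hη : IsIncrement η) (hγ : γ ∈ Set.Ioo (0 : ℝ) 1) [CompleteSpace E]
    {L M : E →L[ℝ] ℝ} {u : E} (hd : ∀ t, 0 < t → HasDerivAt (fun t => L (η t)) (M (η t + u)) t)
    {y : ℝ} (hy : 0 < y) :
    4 / y ^ 2 * (γ * L (subInt γ η profile1 y) + L (subInt γ η profile2 y))
      + M (subInt γ η profile y) + mass γ y * M u = 0 := by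
  have hi : ∀ {g : ℝ → ℝ} {C : ℝ} (_ : Continuous g) (_ : ∀ s, 0 ≤ s → |g s| ≤ C) (L : E →L[ℝ] ℝ),
      IntegrableOn (fun t : ℝ => g (y ^ 2 / t) * (t ^ (-(1 + γ)) * L (η t))) (Set.Ioi 0) ∧
      L (subInt γ η g y) = ∫ t in Set.Ioi (0 : ℝ), g (y ^ 2 / t) * (t ^ (-(1 + γ)) * L (η t)) := by
    intro g C hg hC L
    have h1 := hη.integrableOn_subInt hγ hg hC y
    have h2 := L.integrable_comp h1
    have h3 := L.integral_comp_comm h1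
    simp only [map_smul, smul_eq_mul] at h2 h3
    exact ⟨h2, h3.symm⟩
  obtain ⟨i0, e0⟩ := hi continuous_profile abs_profile_le M
  obtain ⟨i1, e1⟩ := hi continuous_profile1 abs_profile1_le L
  obtain ⟨i2, e2⟩ := hi continuous_profile2 abs_profile2_le L
  have i3 := ((isIncrement_profile hy).integrableOn hγ).mul_const (M u)
  have e3 : mass γ y * M u = ∫ t in Set.Ioi (0 : ℝ), t ^ (-(1 + γ)) • profile (y ^ 2 / t) * M u := by
    rw [mass, integral_mul_const]
  obtain ⟨B, hB⟩ := hη.bdd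
  obtain ⟨B', hB'⟩ := hη.small
  have hB0 : 0 ≤ B := (norm_nonneg _).trans (hB 1 one_pos)
  have hB0' : 0 ≤ B' := by simpa using (norm_nonneg _).trans (hB' 1 one_pos)
  have hΦ : ∀ t ∈ Set.Ioi (0 : ℝ), HasDerivAt
      (fun t : ℝ => t ^ (-(1 + γ)) * profile (y ^ 2 / t) * L (η t))
      (4 / y ^ 2 * (γ * (profile1 (y ^ 2 / t) * (t ^ (-(1 + γ)) * L (η t)))
        + profile2 (y ^ 2 / t) * (t ^ (-(1 + γ)) * L (η t)))
        + profile (y ^ 2 / t) * (t ^ (-(1 + γ)) * M (η t))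
        + t ^ (-(1 + γ)) • profile (y ^ 2 / t) * M u) t := fun t ht =>
    ((hasDerivAt_kernel γ hy ht).fun_mul (hd t ht)).congr_deriv (by
      rw [map_add, smul_eq_mul]; ring)
  have habs : ∀ t, 0 < t → ‖t ^ (-(1 + γ)) * profile (y ^ 2 / t) * L (η t)‖
      = t ^ (-(1 + γ)) * profile (y ^ 2 / t) * |L (η t)| := fun t ht => by
    rw [norm_mul, norm_mul, Real.norm_eq_abs, Real.norm_eq_abs, Real.norm_eq_abs,
      abs_of_pos (profile_pos _), abs_of_pos (Real.rpow_pos_of_pos ht _)]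
  have key := integral_Ioi_of_hasDerivAt_of_tendsto (m := 0) ?_ hΦ
    (((((i1.const_mul γ).add i2).const_mul (4 / y ^ 2)).add i0).add i3) ?_
  · rw [Real.zero_rpow (by linarith [hγ.1]), zero_mul, zero_mul, sub_zero, integral_add, integral_add,
      integral_const_mul, integral_add, integral_const_mul, ← e0, ← e1, ← e2, ← e3] at key
    · exact key
    · exact i1.const_mul γ
    · exact i2
    · exact ((i1.const_mul γ).add i2).const_mul (4 / y ^ 2)
    · exact i0
    · exact (((i1.const_mul γ).add i2).const_mul (4 / y ^ 2)).add i0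
    · exact i3
  · -- the boundary term is of the order `t ^ (1 - γ)`, and takes the value `0` at `t = 0` because
    -- `0 ^ (-(1 + γ)) = 0`
    rw [← continuousWithinAt_Ioi_iff_Ici]
    rw [ContinuousWithinAt, Real.zero_rpow (by linarith [hγ.1]), zero_mul, zero_mul]
    have hlim : Tendsto (fun t : ℝ => 4 / y ^ 2 * (‖L‖ * B') * t ^ (1 - γ)) (𝓝[>] 0) (𝓝 0) := by
      have := (Real.continuousAt_rpow_const 0 (1 - γ) (Or.inr (by linarith [hγ.2]))).tendsto
      rw [Real.zero_rpow (by linarith [hγ.2])] at this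
      simpa using (this.mono_left nhdsWithin_le_nhds).const_mul (4 / y ^ 2 * (‖L‖ * B'))
    refine squeeze_zero_norm' ?_ hlim
    filter_upwards [self_mem_nhdsWithin] with t ht
    have ht' : 0 < t := ht
    rw [habs t ht]
    have e : t ^ (1 - γ) = t ^ (-(1 + γ)) * t * t := by
      rw [← Real.rpow_add_one ht'.ne', ← Real.rpow_add_one ht'.ne']; congr 1; ring
    have h1 := profile_div_le hy ht'
    have h2 : |L (η t)| ≤ ‖L‖ * (B' * t) :=
      (L.le_opNorm _).trans (mul_le_mul_of_nonneg_left (hB' t ht) (norm_nonneg _))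
    have h3 := Real.rpow_nonneg ht'.le (-(1 + γ))
    calc t ^ (-(1 + γ)) * profile (y ^ 2 / t) * |L (η t)|
        ≤ t ^ (-(1 + γ)) * (4 / y ^ 2 * t) * (‖L‖ * (B' * t)) := by
          have := (profile_pos (y ^ 2 / t)).le
          gcongr
      _ = _ := by rw [e]; ring
  · have hlim : Tendsto (fun t : ℝ => ‖L‖ * B * t ^ (-(1 + γ))) atTop (𝓝 0) := by
      simpa using (tendsto_rpow_neg_atTop (show 0 < 1 + γ by linarith [hγ.1])).const_mul (‖L‖ * B)
    refine squeeze_zero_norm' ?_ hlim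
    filter_upwards [eventually_gt_atTop 0] with t ht
    rw [habs t ht]
    have h1 := (le_abs_self _).trans (abs_profile_le (y ^ 2 / t) (by positivity))
    have h2 : |L (η t)| ≤ ‖L‖ * B :=
      (L.le_opNorm _).trans (mul_le_mul_of_nonneg_left (hB t ht) (norm_nonneg _))
    have h3 := Real.rpow_nonneg ht.le (-(1 + γ))
    calc t ^ (-(1 + γ)) * profile (y ^ 2 / t) * |L (η t)|
        ≤ t ^ (-(1 + γ)) * 1 * (‖L‖ * B) := by
          have := (profile_pos (y ^ 2 / t)).le
          gcongr
      _ = _ := by ring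

/-- The solution of the extension problem with boundary value `u`, where `η t = exp(-tΔ) u - u`.
As the kernel `y ^ (2γ) exp(-y²/4t) t ^ (-1-γ)` divided by `mass γ 1` has integral one, this is the
average of `exp(-tΔ) u` with respect to it. -/
def sol (γ : ℝ) (u : E) (η : ℝ → E) (y : ℝ) : E :=
  u + ((mass γ 1)⁻¹ * y ^ (2 * γ)) • subInt γ η profile y

/-- The `y`-derivative of `sol`. -/
def sol1 (γ : ℝ) (η : ℝ → E) (y : ℝ) : E :=
  (2 * (mass γ 1)⁻¹ * y ^ (2 * γ - 1)) • (γ • subInt γ η profile y + subInt γ η profile1 y)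

/-- The second `y`-derivative of `sol`, written so as to display the term
`sol2 + (1 - 2γ) / y • sol1`. -/
def sol2 (γ : ℝ) (η : ℝ → E) (y : ℝ) : E :=
  ((mass γ 1)⁻¹ * (y ^ (2 * γ) * (4 / y ^ 2))) • (γ • subInt γ η profile1 y + subInt γ η profile2 y)
    - ((1 - 2 * γ) / y) • sol1 γ η y

theorem hasDerivAt_sol (hη : IsIncrement η) (hγ : γ ∈ Set.Ioo (0 : ℝ) 1) (u : E) {y : ℝ}
    (hy : 0 < y) : HasDerivAt (sol γ u η) (sol1 γ η y) y := by
  have h0 := hη.hasDerivAt_subInt hγ continuous_profile continuous_profile1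
    hasDerivAt_profile_euler abs_profile_le abs_profile1_le hy
  have h1 := (Real.hasDerivAt_rpow_const (x := y) (p := 2 * γ) (Or.inl hy.ne')).const_mul (mass γ 1)⁻¹
  refine ((h1.fun_smul h0).const_add u).congr_deriv ?_
  rw [sol1, Real.rpow_sub_one hy.ne']
  match_scalars <;> field_simp

theorem hasDerivAt_sol1 (hη : IsIncrement η) (hγ : γ ∈ Set.Ioo (0 : ℝ) 1) {y : ℝ}
    (hy : 0 < y) : HasDerivAt (sol1 γ η) (sol2 γ η y) y := by
  have h0 := hη.hasDerivAt_subInt hγ continuous_profile continuous_profile1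
    hasDerivAt_profile_euler abs_profile_le abs_profile1_le hy
  have h1 := hη.hasDerivAt_subInt hγ continuous_profile1 continuous_profile2
    hasDerivAt_profile1_euler abs_profile1_le abs_profile2_le hy
  have h2 := (Real.hasDerivAt_rpow_const (x := y) (p := 2 * γ - 1) (Or.inl hy.ne')).const_mul
    (2 * (mass γ 1)⁻¹)
  refine (h2.fun_smul ((h0.const_smul γ).fun_add h1)).congr_deriv ?_
  simp only [Pi.smul_apply]
  rw [sol2, sol1, Real.rpow_sub_one hy.ne' (2 * γ - 1), Real.rpow_sub_one hy.ne']
  match_scalars <;> field_simp <;> ring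

/-- The extension equation, tested with a functional `L`; the functional `M` corresponds to the
horizontal Laplacian. -/
theorem sol_equation (hη : IsIncrement η) (hγ : γ ∈ Set.Ioo (0 : ℝ) 1) [CompleteSpace E]
    {L M : E →L[ℝ] ℝ} {u : E} (hd : ∀ t, 0 < t → HasDerivAt (fun t => L (η t)) (M (η t + u)) t)
    {y : ℝ} (hy : 0 < y) :
    L (sol2 γ η y) + (1 - 2 * γ) / y * L (sol1 γ η y) + M (sol γ u η y) = 0 := by
  have h := hη.subInt_heat hγ hd hy
  have hm := (mass_pos hγ one_pos).ne'
  have e := rpow_mul_mass γ hy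
  rw [sol2, sol, map_sub, map_add, map_smul, map_smul, map_smul, map_add, map_smul]
  simp only [smul_eq_mul]
  have e' : M u = (mass γ 1)⁻¹ * (y ^ (2 * γ) * (mass γ y * M u)) := by
    rw [← mul_assoc (y ^ (2 * γ)), e, ← mul_assoc, inv_mul_cancel₀ hm, one_mul]
  rw [e']
  linear_combination (mass γ 1)⁻¹ * y ^ (2 * γ) * h

theorem norm_sol_le (hγ : γ ∈ Set.Ioo (0 : ℝ) 1) {B : ℝ} (hB : ∀ t, 0 < t → ‖η t‖ ≤ B) (u : E)
    {y : ℝ} (hy : 0 < y) : ‖sol γ u η y‖ ≤ ‖u‖ + B := by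
  refine (norm_add_le _ _).trans (add_le_add le_rfl ?_)
  have hm := mass_pos hγ one_pos
  have hp := Real.rpow_pos_of_pos hy (2 * γ)
  rw [norm_smul, Real.norm_eq_abs, abs_of_pos (by positivity)]
  refine (mul_le_mul_of_nonneg_left (norm_subInt_profile_le hγ hB hy) (by positivity)).trans
    (le_of_eq ?_)
  have hm' := (mass_pos hγ hy).ne'
  rw [← rpow_mul_mass γ hy]
  field_simp

theorem tendsto_sol (hη : IsIncrement η) (hγ : γ ∈ Set.Ioo (0 : ℝ) 1) (u : E) :
    Tendsto (sol γ u η) (𝓝[>] 0) (𝓝 u) := by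
  have h1 : Tendsto (fun y : ℝ => (mass γ 1)⁻¹ * y ^ (2 * γ)) (𝓝[>] 0) (𝓝 0) := by
    have := (Real.continuousAt_rpow_const 0 (2 * γ) (Or.inr (by linarith [hγ.1]))).tendsto
    rw [Real.zero_rpow (by linarith [hγ.1])] at this
    simpa using (this.mono_left nhdsWithin_le_nhds).const_mul (mass γ 1)⁻¹
  have h2 := (h1.smul (hη.tendsto_subInt hγ continuous_profile abs_profile_le)).const_add u
  rw [zero_smul, add_zero] at h2
  exact h2

/-- The weighted normal derivative of the solution at the boundary. -/
theorem tendsto_sol1 (hη : IsIncrement η) (hγ : γ ∈ Set.Ioo (0 : ℝ) 1) :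
    Tendsto (fun y : ℝ => y ^ (1 - 2 * γ) • sol1 γ η y) (𝓝[>] 0)
      (𝓝 ((2 * (mass γ 1)⁻¹ * γ) • ∫ t in Set.Ioi (0 : ℝ), t ^ (-(1 + γ)) • η t)) := by
  have h0 := (hη.tendsto_subInt hγ continuous_profile abs_profile_le).const_smul γ
  have h1 := hη.tendsto_subInt hγ continuous_profile1 abs_profile1_le
  have h2 := (h0.add h1).const_smul (2 * (mass γ 1)⁻¹)
  have e0 : profile 0 = 1 := by simp [profile]
  have e1 : profile1 0 = 0 := by simp [profile1]
  rw [e0, e1, one_smul, zero_smul, add_zero, smul_smul] at h2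
  refine h2.congr' ?_
  filter_upwards [self_mem_nhdsWithin] with y hy
  rw [sol1, smul_smul]
  congr 1
  rw [mul_left_comm, ← Real.rpow_add hy]
  simp

end Subordination

/-! ### The solution and its normal derivative -/

section Final

variable {n p : ℕ} {γ a : ℝ} {u v : L2Form n p}

/-- The increments of the heat flow of `u`. -/
def heatInc (u : L2Form n p) (t : ℝ) : L2Form n p := heat t u - u

theorem norm_heatInc_le (u : L2Form n p) (t : ℝ) : ‖heatInc u t‖ ≤ 2 * ‖u‖ := by
  refine (norm_sub_le _ _).trans ?_
  linarith [norm_heat_le t u]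

theorem isIncrement_heatInc (h : IsHodgeLaplacian u v) : IsIncrement (heatInc u) where
  cont := ((continuous_heat u).sub continuous_const).continuousOn
  bdd := ⟨_, fun t _ => norm_heatInc_le u t⟩
  small := ⟨_, fun _ ht => norm_heat_sub_le h ht.le⟩

/-- Pairings of the solution of the extension problem with translates of a test function. -/
theorem pairL_sol_equation (h : IsHodgeLaplacian u v) (hγ : γ ∈ Set.Ioo (0 : ℝ) 1)
    (w : Fin p → Fin n) (ψ : Test n) (x : Eu n) {y : ℝ} (hy : 0 < y) :
    pairL w ψ x (sol2 γ (heatInc u) y) + (1 - 2 * γ) / y * pairL w ψ x (sol1 γ (heatInc u) y)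
      + ∑ k, pairL w (Test.d k (Test.d k ψ)) x (sol γ u (heatInc u) y) = 0 := by
  have := sol_equation (isIncrement_heatInc h) hγ (L := pairL w ψ x)
    (M := ∑ k, pairL w (Test.d k (Test.d k ψ)) x) (u := u) (fun t ht => ?_) hy
  · simpa only [sum_apply] using this
  · simp only [heatInc, sub_add_cancel, map_sub, sum_apply]
    exact (hasDerivAt_pairL_heat w ψ x u ht).sub_const _

/-- The tangential components of a bounded extension are given by subordination to the heat flow. -/
theorem cm_eq_pairL_sol (h : IsHodgeLaplacian u v) (ha : a ∈ Set.Ioo (-1 : ℝ) 1)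
    (hγ : 2 * γ = 1 - a) {α : Eu (n + 1) → Covec (n + 1) p} (hα : IsBoundedExtension a u α)
    (w : Fin p → Fin n) (ψ : Test n) (x : Eu n) {y : ℝ} (hy : 0 < y) :
    cm α (up w) ψ x y = pairL w ψ x (sol γ u (heatInc u) y) := by
  have hγ' : γ ∈ Set.Ioo (0 : ℝ) 1 := ⟨by linarith [ha.2], by linarith [ha.1]⟩
  have hη := isIncrement_heatInc h
  have hae : a = 1 - 2 * γ := by linarith
  rw [← sub_eq_zero]
  refine XDiff.eq_zero_of_solution (D := Test.d) (b := a) (c := 0)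
    (F := fun ψ x y => cm α (up w) ψ x y - pairL w ψ x (sol γ u (heatInc u) y))
    (F1 := fun ψ x y => cm1 α (up w) ψ x y - pairL w ψ x (sol1 γ (heatInc u) y))
    (F2 := fun ψ x y => cm2 α (up w) ψ x y - pairL w ψ x (sol2 γ (heatInc u) y))
    ha.1 le_rfl (by linarith [ha.2]) ?_ ?_ ?_ ?_ ?_ ?_ ψ x hy
  · intro ψ k x y hy
    refine (cm_xDiff hα.regular (up w) ψ k x y hy).sub ?_
    simp only [pairL_apply]
    exact hasDerivAt_conv (locallyIntegrable_comp _ w) ψ k x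
  · intro ψ x y hy
    exact (cm_hasDerivAt hα.regular (up w) ψ x y hy).sub
      ((pairL w ψ x).hasFDerivAt.comp_hasDerivAt y (hasDerivAt_sol hη hγ' u hy))
  · intro ψ x y hy
    exact (cm1_hasDerivAt hα.regular (up w) ψ x y hy).sub
      ((pairL w ψ x).hasFDerivAt.comp_hasDerivAt y (hasDerivAt_sol1 hη hγ' hy))
  · intro ψ x y hy
    have h1 := pairL_sol_equation h hγ' w ψ x hy
    have h2 := cm2_up ha hα w ψ x hy
    rw [CSForms.lap] at h2
    rw [Finset.sum_sub_distrib]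
    rw [hae] at h2 ⊢
    linarith
  · intro ψ
    obtain ⟨M, -, hM⟩ := cm_bdd hα.bounded (up w) ψ
    obtain ⟨C, hC0, hC⟩ := exists_pairL_bound w ψ
    refine ⟨M + C * (‖u‖ + 2 * ‖u‖), fun x y hy => ?_⟩
    rw [Real.rpow_zero, mul_one]
    refine (abs_sub _ _).trans (add_le_add (hM x y hy) ((hC _ _).trans ?_))
    exact mul_le_mul_of_nonneg_left (norm_sol_le hγ' (fun t _ => norm_heatInc_le u t) u hy) hC0
  · intro ψ x
    have h1 := tendsto_cm_up hα w ψ x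
    have h2 := ((pairL w ψ x).continuous.tendsto u).comp (tendsto_sol hη hγ' u)
    rw [← pairL_apply] at h1
    simpa using h1.sub h2

theorem dm_eq_pairL_sol1 (h : IsHodgeLaplacian u v) (ha : a ∈ Set.Ioo (-1 : ℝ) 1)
    (hγ : 2 * γ = 1 - a) {α : Eu (n + 1) → Covec (n + 1) p} (hα : IsBoundedExtension a u α)
    (w : Fin p → Fin n) (ψ : Test n) (x : Eu n) {y : ℝ} (hy : 0 < y) :
    dm α w ψ x y = pairL w ψ x (sol1 γ (heatInc u) y) := by
  have hγ' : γ ∈ Set.Ioo (0 : ℝ) 1 := ⟨by linarith [ha.2], by linarith [ha.1]⟩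
  rw [dm_eq ha hα w ψ x hy]
  refine (cm_hasDerivAt hα.regular (up w) ψ x y hy).unique ?_
  refine ((pairL w ψ x).hasFDerivAt.comp_hasDerivAt y
    (hasDerivAt_sol (isIncrement_heatInc h) hγ' u hy)).congr_of_eventuallyEq ?_
  filter_upwards [lt_mem_nhds hy] with z hz using cm_eq_pairL_sol h ha hγ hα w ψ x hz

/-- The normal contraction of `dα` on almost all of a horizontal slice: a continuous function
and a square integrable one with the same mollifications agree almost everywhere. -/
theorem curryLeft_extDeriv_ae (h : IsHodgeLaplacian u v) (ha : a ∈ Set.Ioo (-1 : ℝ) 1)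
    (hγ : 2 * γ = 1 - a) {α : Eu (n + 1) → Covec (n + 1) p} (hα : IsBoundedExtension a u α)
    {y : ℝ} (hy : 0 < y) :
    ∀ᵐ x, (extDeriv α (pt x y)).curryLeft (basisVec (Fin.last n))
      = pull (sol1 γ (heatInc u) y x) := by
  have h1 : ∀ w : Fin p → Fin n, ∀ᵐ x, comp (extDeriv α (pt x y)) (Fin.cons (Fin.last n) (up w))
      = comp (sol1 γ (heatInc u) y x) w := fun w =>
    ae_eq_of_conv_eq
      (continuous_slice (continuousOn_extDeriv hα.regular _) hy).locallyIntegrable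
      (locallyIntegrable_comp _ w) fun ψ => by
        rw [← pairL_apply]; exact dm_eq_pairL_sol1 h ha hγ hα w ψ 0 hy
  filter_upwards [ae_all_iff.2 h1] with x hx
  refine covec_ext fun w => ?_
  have e : comp ((extDeriv α (pt x y)).curryLeft (basisVec (Fin.last n))) w
      = comp (extDeriv α (pt x y)) (Fin.cons (Fin.last n) w) := (comp_cons _ _ _).symm
  rw [e]
  by_cases hw : ∃ j, w j = Fin.last n
  · obtain ⟨j, hj⟩ := hw
    rw [comp_pull_eq_zero _ hj]
    refine ContinuousAlternatingMap.map_eq_zero_of_eq _ _ (i := 0) (j := j.succ) ?_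
      (Fin.succ_ne_zero j).symm
    simp [hj]
  · push Not at hw
    obtain ⟨w', rfl⟩ : ∃ w' : Fin p → Fin n, w = up w' :=
      ⟨fun j => (w j).castPred (hw j), funext fun j => (Fin.castSucc_castPred _ (hw j)).symm⟩
    rw [hx w', comp_pull_up]

theorem norm_pull_le (η : Covec n p) : ‖pull η‖ ≤ ‖proj n‖ ^ p * ‖η‖ := by
  have := ContinuousAlternatingMap.norm_compContinuousLinearMap_le η (proj n)
  rw [Fintype.card_fin] at this
  exact this.trans_eq (mul_comm _ _)

/-- On a horizontal slice the difference is the pull-back of an `L²` form, up to a sign. -/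
theorem interiorLast_sub_ae (h : IsHodgeLaplacian u v) (ha : a ∈ Set.Ioo (-1 : ℝ) 1)
    (hγ : 2 * γ = 1 - a) {α : Eu (n + 1) → Covec (n + 1) p} (hα : IsBoundedExtension a u α)
    (C : ℝ) (σ : L2Form n p) {y : ℝ} (hy : 0 < y) :
    ∀ᵐ x, y ^ a • interiorLast (basisVec (Fin.last n)) (extDeriv α (pt x y))
      - ((-1 : ℝ) ^ (p + 1) * C) • pull (σ x)
        = (-1 : ℝ) ^ p • pull ((y ^ a • sol1 γ (heatInc u) y + C • σ : L2Form n p) x) := by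
  filter_upwards [curryLeft_extDeriv_ae h ha hγ hα hy,
    Lp.coeFn_add (y ^ a • sol1 γ (heatInc u) y) (C • σ),
    Lp.coeFn_smul (y ^ a) (sol1 γ (heatInc u) y), Lp.coeFn_smul C σ] with x h1 h2 h3 h4
  rw [h2, Pi.add_apply, h3, h4, Pi.smul_apply, Pi.smul_apply, interiorLast, h1]
  have e : ∀ (r s : ℝ) (η θ : Covec n p), pull (r • η + s • θ) = r • pull η + s • pull θ :=
    fun r s η θ => rfl
  rw [e]
  module

/-- A bound for the `L²` norm of a form on a horizontal slice by that of the boundary form. -/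
theorem eLpNorm_le_of_ae_eq_pull {f : Eu n → Covec (n + 1) p} {z : L2Form n p}
    (hf : ∀ᵐ x, f x = (-1 : ℝ) ^ p • pull (z x)) :
    eLpNorm f 2 volume ≤ ENNReal.ofReal (‖proj n‖ ^ p * ‖z‖) := by
  rw [ENNReal.ofReal_mul (by positivity), ofReal_norm, Lp.enorm_def]
  refine eLpNorm_le_mul_eLpNorm_of_ae_le_mul ?_ 2
  filter_upwards [hf] with x hx
  rw [hx, norm_smul, norm_pow, norm_neg, norm_one, one_pow, one_mul]
  exact norm_pull_le _

/-- The constant relating the weighted normal derivative to the fractional power. -/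
def extensionConst (γ : ℝ) : ℝ := 2 * Real.Gamma (1 - γ) / mass γ 1

theorem extensionConst_pos (hγ : γ ∈ Set.Ioo (0 : ℝ) 1) : 0 < extensionConst γ :=
  div_pos (mul_pos two_pos (Real.Gamma_pos_of_pos (by linarith [hγ.2]))) (mass_pos hγ one_pos)

/-- The limit follows from `-γ Γ(-γ) = Γ(1 - γ)`. -/
theorem tendsto_normal_derivative (h : IsHodgeLaplacian u v) (hγ : γ ∈ Set.Ioo (0 : ℝ) 1) :
    Tendsto (fun y : ℝ => y ^ (1 - 2 * γ) • sol1 γ (heatInc u) y + extensionConst γ •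
      (Real.Gamma (-γ))⁻¹ • ∫ t in Set.Ioi (0 : ℝ), t ^ (-(1 + γ)) • heatInc u t) (𝓝[>] 0) (𝓝 0) := by
  have h1 := (tendsto_sol1 (isIncrement_heatInc h) hγ).add_const (extensionConst γ •
      (Real.Gamma (-γ))⁻¹ • ∫ t in Set.Ioi (0 : ℝ), t ^ (-(1 + γ)) • heatInc u t)
  convert h1 using 2
  have hG : Real.Gamma (1 - γ) = -γ * Real.Gamma (-γ) := by
    rw [← Real.Gamma_add_one (by linarith [hγ.1])]; congr 1; ring
  have hG0 : Real.Gamma (-γ) ≠ 0 := fun h0 => by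
    rw [h0, mul_zero] at hG
    exact (Real.Gamma_pos_of_pos (show 0 < 1 - γ by linarith [hγ.2])).ne' hG
  rw [extensionConst, hG, smul_smul, ← add_smul, eq_comm]
  convert zero_smul ℝ _ using 2
  field_simp
  ring

end Final

end CSForms

end

theorem mainTheorem1 (n : ℕ) (a γ : ℝ) (ha : a ∈ Set.Ioo (-1 : ℝ) 1) (hγ : 2 * γ = 1 - a) :
    ∃ C : ℝ, 0 < C ∧
      ∀ (p : ℕ) (ω : CSForms.L2Form n p), CSForms.InHodgeDomain ω →
        ∀ α : CSForms.Eu (n + 1) → CSForms.Covec (n + 1) p,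
          CSForms.IsBoundedExtension a ω α →
          ∃ σ : CSForms.L2Form n p, CSForms.IsFracHodgeLaplacian γ ω σ ∧
            Tendsto
              (fun y : ℝ => eLpNorm
                (fun x : CSForms.Eu n =>
                  y ^ a • CSForms.interiorLast (CSForms.basisVec (Fin.last n))
                      (extDeriv α (CSForms.pt x y))
                    - ((-1 : ℝ) ^ (p + 1) * C) • CSForms.pull (σ x)) 2 volume)
              (𝓝[>] 0) (𝓝 0) := by
  have hγ' : γ ∈ Set.Ioo (0 : ℝ) 1 := ⟨by linarith [ha.2], by linarith [ha.1]⟩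
  refine ⟨CSForms.extensionConst γ, CSForms.extensionConst_pos hγ', fun p ω ⟨v, h⟩ α hα =>
    ⟨(Real.Gamma (-γ))⁻¹ • ∫ t in Set.Ioi (0 : ℝ), t ^ (-(1 + γ)) • CSForms.heatInc ω t,
      ⟨_, CSForms.isHeatFlow_heat h, (CSForms.isIncrement_heatInc h).integrableOn hγ', rfl⟩, ?_⟩⟩
  have h1 := ((CSForms.tendsto_normal_derivative h hγ').norm.const_mul (‖CSForms.proj n‖ ^ p))
  rw [norm_zero, mul_zero] at h1
  have h2 := ENNReal.tendsto_ofReal h1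
  rw [ENNReal.ofReal_zero] at h2
  refine tendsto_of_tendsto_of_tendsto_of_le_of_le' tendsto_const_nhds h2
    (Eventually.of_forall fun _ => bot_le) ?_
  filter_upwards [self_mem_nhdsWithin] with y hy
  refine CSForms.eLpNorm_le_of_ae_eq_pull ?_
  rw [show 1 - 2 * γ = a by linarith]
  exact CSForms.interiorLast_sub_ae h ha hγ hα _ _ hy
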